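/- By a knot we mean a tame knot in $\mathbb{R}^3$; a knot type is an ambient isotopy class of knots. A knot diagram is a closed curve in the plane $\mathbb{R}^2$ whose only self-intersections are finitely many transverse double points (the crossings), with a choice of the over strand at each of them. A Reidemeister sequence for a pair $(D,D')$ of diagrams is a finite sequence of planar isotopies and Reidemeister moves that transforms $D$ into $D'$; the moves are the cusp moves ($\Omega_1$), the self-tangency moves ($\Omega_2$) and the triple point moves ($\Omega_3$), in either direction. The pair $(D,D')$ is $\Omega_2$-dependent if it has a Reidemeister sequence and each of its Reidemeister sequences contains an $\Omega_2$-move. Theorem. Every knot type admits an $\Omega_2$-dependent diagram pair: for every knot $K$ there are two diagrams $D$ and $D'$ of the knot type of $K$ such that $(D,D')$ is $\Omega_2$-dependent. Moreover, $D$ and $D'$ can be chosen so that $D'$ results from $D$ by a single $\Omega_2$-move. -/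

import Mathlib

open Set Topology

namespace KnotDiagrams

/-- The plane `ℝ²`. Only its topology and its affine structure are used. -/
abbrev Plane : Type := ℝ × ℝ

/-- Three-space `ℝ³ = ℝ² × ℝ`; the last coordinate is the height above the plane. -/
abbrev Space : Type := Plane × ℝ

/-- The circle `S¹ = ℝ / ℤ`, with its topology and its cyclic order. -/
abbrev S1 : Type := UnitAddCircle

/-! ### Ambient isotopy -/

/-- An ambient isotopy of `X`: a continuous family `H t`, `t ∈ [0,1]`, of homeomorphisms of `X`
with `H 0 = id`. -/
structure AmbientIsotopy (X : Type) [TopologicalSpace X] where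
  toFun : unitInterval → X → X
  continuous_toFun : Continuous fun p : unitInterval × X => toFun p.1 p.2
  isHomeomorph : ∀ t, IsHomeomorph (toFun t)
  map_zero : ∀ x, toFun 0 x = x

/-- The homeomorphism of `X` at the end of an ambient isotopy. -/
def AmbientIsotopy.final {X : Type} [TopologicalSpace X] (H : AmbientIsotopy X) : X → X :=
  H.toFun 1

/-- Two subsets of `X` are ambient isotopic. -/
def AmbientIsotopic {X : Type} [TopologicalSpace X] (A B : Set X) : Prop :=
  ∃ H : AmbientIsotopy X, H.final '' A = B

/-! ### Knots in three-space -/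

/-- A closed curve in space is polygonal if, for some `n ≥ 1`, it is affine on each of the arcs
`[i/n, (i+1)/n]`; the points `v i` are its successive vertices. -/
def IsPolygonal (γ : S1 → Space) : Prop :=
  ∃ (n : ℕ) (v : ℕ → Space), 0 < n ∧ ∀ i < n, ∀ r ∈ Set.Icc (0 : ℝ) 1,
    γ (((i + r) / n : ℝ) : S1) = AffineMap.lineMap (v i) (v (i + 1)) r

/-- A (tame) knot: an embedding of the circle in space whose image is ambient isotopic to a
simple closed polygon. A knot type is an ambient isotopy class of (images of) such knots. -/
structure Knot where
  toFun : S1 → Space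
  continuous_toFun : Continuous toFun
  injective_toFun : Function.Injective toFun
  tame : ∃ γ : S1 → Space, Continuous γ ∧ Function.Injective γ ∧ IsPolygonal γ ∧
    AmbientIsotopic (range γ) (range toFun)

/-! ### Knot diagrams -/

/-- `s` and `t` are two different parameters at which the curve passes through the same point. -/
def IsDoublePoint (φ : S1 → Plane) (s t : S1) : Prop :=
  s ≠ t ∧ φ s = φ t

/-- The branches of `φ` at the parameters `s` and `t` cross each other transversally: in some
local chart of the plane around `φ s`, the first runs in the horizontal axis and the second in
the vertical axis. -/
def CrossTransversally (φ : S1 → Plane) (s t : S1) : Prop :=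
  ∃ e : OpenPartialHomeomorph Plane Plane, φ s ∈ e.source ∧ e (φ s) = (0, 0) ∧
    (∀ᶠ u in 𝓝 s, (e (φ u)).2 = 0) ∧ (∀ᶠ u in 𝓝 t, (e (φ u)).1 = 0)

/-- A knot diagram in general position: a closed curve in the plane whose only self-intersections
are finitely many transverse double points, together with, at each double point, a choice of the
over strand. Here `isOver s t` says that `s` and `t` are the two parameters of a crossing point and
that the strand at `s` is the over strand. -/
structure Diagram where
  curve : S1 → Plane
  continuous_curve : Continuous curve
  finite_double : {p : S1 × S1 | IsDoublePoint curve p.1 p.2}.Finite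
  no_triple : ∀ s t u, curve s = curve t → curve t = curve u → s = t ∨ t = u ∨ s = u
  transverse : ∀ s t, IsDoublePoint curve s t → CrossTransversally curve s t
  isOver : S1 → S1 → Prop
  isOver_or : ∀ s t, (isOver s t ∨ isOver t s) ↔ IsDoublePoint curve s t
  isOver_asymm : ∀ s t, isOver s t → ¬ isOver t s

/-- `D` is a diagram of (a knot of the type of) `K`: lifting the curve of `D` to space, with the
over strand above the under strand at each crossing, gives a knot that is ambient isotopic to
`K`. -/
def Diagram.Represents (D : Diagram) (K : Knot) : Prop :=
  ∃ h : S1 → ℝ, Continuous h ∧ (∀ s t, D.isOver s t → h t < h s) ∧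
    AmbientIsotopic (range fun s => ((D.curve s, h s) : Space)) (range K.toFun)

/-- Planar isotopy of diagrams. Diagrams are unoriented and have no preferred parametrization,
so a change of parameter `ρ` (possibly reversing the direction) is allowed. -/
def PlanarIsotopic (D D' : Diagram) : Prop :=
  ∃ (H : AmbientIsotopy Plane) (ρ : S1 ≃ₜ S1),
    (∀ s, D'.curve (ρ s) = H.final (D.curve s)) ∧
    (∀ s t, D'.isOver (ρ s) (ρ t) ↔ D.isOver s t)

/-! ### Reidemeister moves -/

/-- A closed disc in the plane. -/
def IsClosedDisc (B : Set Plane) : Prop :=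
  ∃ f : Plane ≃ₜ Plane, B = f '' Metric.closedBall 0 1

/-- A proper closed arc of the circle, running in the positive direction from `a` to `b`. -/
structure Arc where
  a : S1
  b : S1
  ne : a ≠ b

/-- The set of points of a closed arc, end points included. -/
def Arc.closed (I : Arc) : Set S1 := Set.cIcc I.a I.b

/-- The set of points of a closed arc, end points excluded. -/
def Arc.inner (I : Arc) : Set S1 := Set.cIoo I.a I.b

/-- The point `x` of the arc comes strictly before its point `y` (for inner points `x`, `y`). -/
def Arc.Before (I : Arc) (x y : S1) : Prop := sbtw I.a x y

/-- The points of a finite family of closed arcs. -/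
def arcs {k : ℕ} (I : Fin k → Arc) : Set S1 := ⋃ i, (I i).closed

/-- The disc `B` meets the diagram `D` precisely in the images of the arcs `I i`, which run inside
`B` between boundary points of `B`. -/
def MeetsDiscIn (D : Diagram) (B : Set Plane) {k : ℕ} (I : Fin k → Arc) : Prop :=
  (∀ s, s ∉ arcs I → D.curve s ∉ B) ∧
  (∀ i, ∀ s ∈ (I i).inner, D.curve s ∈ interior B) ∧
  (∀ i, D.curve (I i).a ∈ frontier B ∧ D.curve (I i).b ∈ frontier B)

/-- The diagrams `D` and `D'` coincide outside a closed disc, which meets both of them in the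
images of the pairwise disjoint arcs `I i`. -/
def SameOutsideDisc (D D' : Diagram) {k : ℕ} (I : Fin k → Arc) : Prop :=
  (∀ i j, i ≠ j → Disjoint (I i).closed (I j).closed) ∧
  (∃ B : Set Plane, IsClosedDisc B ∧ MeetsDiscIn D B I ∧ MeetsDiscIn D' B I) ∧
  (∀ s, s ∉ arcs I → D.curve s = D'.curve s) ∧
  (∀ s t, s ∉ arcs I → t ∉ arcs I → (D.isOver s t ↔ D'.isOver s t))

/-- A cusp move that creates a crossing: inside a disc, an arc without crossings is replaced by an
arc with exactly one self-crossing (the signs and the over strand being arbitrary). -/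
def CreatesKink (D D' : Diagram) : Prop :=
  ∃ I : Fin 1 → Arc, SameOutsideDisc D D' I ∧
    Set.InjOn D.curve (arcs I) ∧
    ∃ s ∈ (I 0).inner, ∃ t ∈ (I 0).inner, IsDoublePoint D'.curve s t ∧
      ∀ u ∈ arcs I, ∀ v ∈ arcs I, IsDoublePoint D'.curve u v →
        (u = s ∧ v = t) ∨ (u = t ∧ v = s)

/-- A self-tangency move that creates two crossings: inside a disc, two disjoint arcs without
crossings are replaced by two arcs without self-crossings which cross each other exactly twice,
the same arc being the over strand at both crossings. -/
def CreatesBigon (D D' : Diagram) : Prop :=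
  ∃ I : Fin 2 → Arc, SameOutsideDisc D D' I ∧
    Set.InjOn D.curve (arcs I) ∧
    ∃ s t : Fin 2 → S1, (∀ m, s m ∈ (I 0).inner) ∧ (∀ m, t m ∈ (I 1).inner) ∧ s 0 ≠ s 1 ∧
      (∀ m, D'.isOver (s m) (t m)) ∧
      ∀ u ∈ arcs I, ∀ v ∈ arcs I, IsDoublePoint D'.curve u v →
        ∃ m, (u = s m ∧ v = t m) ∨ (u = t m ∧ v = s m)

/-- The three arcs `I 0`, `I 1`, `I 2` of the diagram `D` have no self-crossings, any two of them
cross exactly once, and the arc with the smaller index is the over strand. For `i ≠ j`, the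
parameter of the crossing of `I i` and `I j` on `I i` is `c i j`. -/
def IsLayeredTriangle (D : Diagram) (I : Fin 3 → Arc) (c : Fin 3 → Fin 3 → S1) : Prop :=
  (∀ i j, i ≠ j → c i j ∈ (I i).inner) ∧
  (∀ i j, i < j → D.isOver (c i j) (c j i)) ∧
  ∀ u ∈ arcs I, ∀ v ∈ arcs I, IsDoublePoint D.curve u v →
    ∃ i j, i ≠ j ∧ u = c i j ∧ v = c j i

/-- A triple point move: inside a disc, three arcs lying above one another, any two of which cross
exactly once, are replaced by three such arcs in the same layers, so that on each arc the order of
its crossings with the two other arcs is reversed. -/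
def FlipsTriangle (D D' : Diagram) : Prop :=
  ∃ I : Fin 3 → Arc, SameOutsideDisc D D' I ∧
    ∃ c c' : Fin 3 → Fin 3 → S1, IsLayeredTriangle D I c ∧ IsLayeredTriangle D' I c' ∧
      ∀ i j k, i ≠ j → j ≠ k → i ≠ k →
        ((I i).Before (c i j) (c i k) ↔ (I i).Before (c' i k) (c' i j))

/-- The three classes of Reidemeister moves: cusp moves `Ω₁`, self-tangency moves `Ω₂`, triple
point moves `Ω₃`. -/
inductive MoveClass where
  | omega1
  | omega2
  | omega3

/-- `D'` results from `D` by one Reidemeister move of the given class (in either direction). -/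
def IsMove : MoveClass → Diagram → Diagram → Prop
  | .omega1, D, D' => CreatesKink D D' ∨ CreatesKink D' D
  | .omega2, D, D' => CreatesBigon D D' ∨ CreatesBigon D' D
  | .omega3, D, D' => FlipsTriangle D D'

/-- One step of a Reidemeister sequence that uses only moves of the classes in `S`: a planar
isotopy or a move of a class in `S`. -/
def Step (S : Set MoveClass) (D D' : Diagram) : Prop :=
  PlanarIsotopic D D' ∨ ∃ m ∈ S, IsMove m D D'

/-- There is a (finite) Reidemeister sequence from `D` to `D'` that uses only planar isotopies and
moves of the classes in `S`. -/
def HasReidemeisterSequence (S : Set MoveClass) (D D' : Diagram) : Prop :=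
  Relation.ReflTransGen (Step S) D D'

/-- Two diagrams are equivalent if some Reidemeister sequence leads from one to the other. -/
def Equivalent (D D' : Diagram) : Prop :=
  HasReidemeisterSequence Set.univ D D'

/-- The pair is independent of the class `m` of moves: it has a Reidemeister sequence without a
move of class `m`. -/
def Independent (m : MoveClass) (D D' : Diagram) : Prop :=
  HasReidemeisterSequence {m}ᶜ D D'

/-- A pair of equivalent diagrams is dependent on the class `m` of moves if it is not independent
of it, that is, if each of its Reidemeister sequences contains a move of class `m`. -/
def Dependent (m : MoveClass) (D D' : Diagram) : Prop :=
  Equivalent D D' ∧ ¬ Independent m D D'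

end KnotDiagrams

/-!
Moves of type `Ω₂` are unavoidable if they destroy a part of the diagram on which the moves of type
`Ω₁` and `Ω₃` have no hold. A set of crossing parameters is called *rigid* (`Rigid`)
if the chords of the Gauss diagram with ends in it form a connected subdiagram without isolated
chords, without bigons and without layered triangles, such that the two ends of every other chord
lie in the same gap between points of the set. A kink is an isolated chord, and one, two or three of
the crossings of a layered triangle form, inside a rigid set, an isolated chord, a bigon or a layered
triangle (`IsLayeredTriangle.disjoint`); so the disc of a move of type `Ω₁` or `Ω₃` contains no
crossing of a rigid set, and the rigid sets of the diagrams before and after the move are the same.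
A planar isotopy carries rigid sets to rigid sets. Hence the finite number of rigid sets is unchanged
by all moves except those of type `Ω₂` (`Independent.ncard_rigid`).

An unknotted tangle with rigid crossings turns this invariant into a proof of the theorem. The path
`tangle ((6, -42), 12)` projects to a hard diagram of a straight strand: its Gauss word is connected
and reduced (`wordConnected_short`, `wordReduced_short`), so its crossings are a rigid set of every
diagram that contains it (`HasWord.rigid`). Moving one vertex of the path to `((6, -30), 12)` pushes
one strand across another one, which is a move of type `Ω₂` (`createsBigon_insertPath`). A
rigid set that met the new tangle would contain all of its crossings, as its word is connected, and
with them the new bigon; so no rigid set meets it (`HasWord.disjoint_of_rigid`). The rigid sets of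
the new diagram are therefore rigid for the old one, but the tangle itself is lost: the numbers of
rigid sets differ (`HasWord.ncard_rigid_ne`).

Both tangles are straightened by an explicit sequence of moves of a corner across a triangle,
each of which is realized by an ambient isotopy (`ambientIsotopic_triangle`) and certified by
the signs of finitely many integer determinants (`run_straightening`). So inserting them
in a straight piece of a knot does not change the knot type (`ambientIsotopic_insertPath`). Finally,
every knot has a position with a straight piece in an otherwise empty rectangle of its diagram
(`exists_hasStraightPiece`): a polygon projects to a diagram along every direction at which finitely
many nonzero quadratic forms do not vanish (`exists_genericDirection`,
`GenericDirection.generalPosition`), and a short piece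
of its first edge is then enlarged by a similarity of the plane and levelled by a shear.
-/


open Set Topology

namespace KnotDiagrams

/-! ### Rigid sets of a Gauss diagram -/

/-- The points `a` and `b` of the circle lie in one connected set that avoids `m` and `m'`, so that
the pair `m`, `m'` does not separate `a` from `b`. -/
def Joined (m m' a b : S1) : Prop :=
  ∃ C : Set S1, IsPreconnected C ∧ a ∈ C ∧ b ∈ C ∧ m ∉ C ∧ m' ∉ C

theorem joined_of_isPreconnected {C : Set S1} (hC : IsPreconnected C) {m m' a b : S1} (ha : a ∈ C)
    (hb : b ∈ C) (hm : m ∉ C) (hm' : m' ∉ C) : Joined m m' a b :=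
  ⟨C, hC, ha, hb, hm, hm'⟩

theorem Joined.trans {m m' a b c : S1} (h : Joined m m' a b) (h' : Joined m m' b c) :
    Joined m m' a c := by
  obtain ⟨C, hC, ha, hb, hm, hm'⟩ := h
  obtain ⟨C', hC', hb', hc, hn, hn'⟩ := h'
  exact ⟨C ∪ C', hC.union b hb hb' hC', Or.inl ha, Or.inr hc, by simp [hm, hn], by simp [hm', hn']⟩

theorem Joined.symm {m m' a b : S1} (h : Joined m m' a b) : Joined m m' b a := by
  obtain ⟨C, hC, ha, hb, hm⟩ := h
  exact ⟨C, hC, hb, ha, hm⟩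

theorem Joined.image (ρ : S1 ≃ₜ S1) {m m' a b : S1} (h : Joined m m' a b) :
    Joined (ρ m) (ρ m') (ρ a) (ρ b) := by
  obtain ⟨C, hC, ha, hb, hm, hm'⟩ := h
  exact ⟨ρ '' C, hC.image _ ρ.continuous.continuousOn, mem_image_of_mem _ ha, mem_image_of_mem _ hb,
    by simpa using hm, by simpa using hm'⟩

theorem joined_image_iff (ρ : S1 ≃ₜ S1) {m m' a b : S1} :
    Joined (ρ m) (ρ m') (ρ a) (ρ b) ↔ Joined m m' a b :=
  ⟨fun h => by simpa using h.image ρ.symm, Joined.image ρ⟩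

/-- `s` and `t` are the two parameters of a crossing: the end points of a chord of the Gauss
diagram whose over/under information is given by `ov`. -/
def Chord (ov : S1 → S1 → Prop) (s t : S1) : Prop := ov s t ∨ ov t s

/-- The points `a` and `b` are neighbours with respect to `M`: no two other points of `M`
separate them. -/
def Adj (M : Set S1) (a b : S1) : Prop :=
  ∀ m ∈ M, ∀ m' ∈ M, m ≠ a → m ≠ b → m' ≠ a → m' ≠ b → Joined m m' a b

/-- A rigid set of crossing parameters of a Gauss diagram. It spans a subdiagram which is connected
and contains no isolated chord, no bigon and no layered triangle, and every other chord has both its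
end points in the same gap of the subdiagram. -/
structure Rigid (ov : S1 → S1 → Prop) (M : Set S1) : Prop where
  nonempty : M.Nonempty
  exists_chord : ∀ s ∈ M, ∃ t, Chord ov s t
  closed : ∀ s t, Chord ov s t → s ∈ M → t ∈ M
  joined_of_notMem : ∀ s t, Chord ov s t → s ∉ M → ∀ m ∈ M, ∀ m' ∈ M, Joined m m' s t
  not_isolated : ∀ s t, Chord ov s t → s ∈ M →
    ∃ m ∈ M, ∃ m' ∈ M, m ≠ s ∧ m ≠ t ∧ m' ≠ s ∧ m' ≠ t ∧ ¬ Joined m m' s t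
  no_bigon : ∀ s t s' t', Chord ov s t → Chord ov s' t' → s ∈ M → s' ∈ M → s' ≠ s → s' ≠ t →
    Adj M s s' → ¬ Adj M t t'
  no_layered_triangle : ∀ p p' q q' r r', ov p p' → ov q q' → ov r r' → p ∈ M → q ∈ M →
    r ∈ M → p ≠ q → p ≠ r → q ≠ r → Adj M p q → Adj M p' r → ¬ Adj M q' r'
  connected : ∀ S ⊆ M, S.Nonempty → (∀ s t, Chord ov s t → s ∈ S → t ∈ S) →
    (∀ a a' b b', Chord ov a a' → Chord ov b b' → a ∈ S → b ∈ M → b ∉ S → Joined a a' b b') →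
    S = M

theorem Chord.symm {ov : S1 → S1 → Prop} {s t : S1} (h : Chord ov s t) : Chord ov t s :=
  Or.symm h

theorem Diagram.chord_iff (D : Diagram) {s t : S1} :
    Chord D.isOver s t ↔ IsDoublePoint D.curve s t :=
  D.isOver_or s t

/-- Two Gauss diagrams which agree outside `A` have the same rigid sets disjoint from `A`, as
long as no such set separates the end points of a chord inside `A`. -/
theorem Rigid.of_eq_outside {ov ov' : S1 → S1 → Prop} {M A : Set S1} (hM : Rigid ov M)
    (hMA : Disjoint M A)
    (heq : ∀ s t, s ∉ A → t ∉ A → (ov s t ↔ ov' s t))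
    (hA : ∀ s t, Chord ov s t → s ∉ A → t ∉ A)
    (hA' : ∀ s t, Chord ov' s t → s ∉ A → t ∉ A)
    (hin : ∀ s t, Chord ov' s t → s ∈ A → t ∈ A → ∀ m ∈ M, ∀ m' ∈ M, Joined m m' s t) :
    Rigid ov' M := by
  have hMA' : ∀ s ∈ M, s ∉ A := fun s hs hs' => (Set.disjoint_left.mp hMA) hs hs'
  have key : ∀ s t, s ∉ A → (Chord ov s t ↔ Chord ov' s t) := by
    intro s t hs
    by_cases ht : t ∈ A
    · exact ⟨fun h => absurd ht (hA s t h hs), fun h => absurd ht (hA' s t h hs)⟩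
    · simp only [Chord, heq s t hs ht, heq t s ht hs]
  refine ⟨hM.nonempty, ?_, ?_, ?_, ?_, ?_, ?_, ?_⟩
  · intro s hs
    obtain ⟨t, ht⟩ := hM.exists_chord s hs
    exact ⟨t, (key s t (hMA' s hs)).1 ht⟩
  · intro s t h hs
    exact hM.closed s t ((key s t (hMA' s hs)).2 h) hs
  · intro s t h hs m hm m' hm'
    by_cases hsA : s ∈ A
    · by_cases htA : t ∈ A
      · exact hin s t h hsA htA m hm m' hm'
      · exact absurd hsA (hA' t s h.symm htA)
    · exact hM.joined_of_notMem s t ((key s t hsA).2 h) hs m hm m' hm'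
  · intro s t h hs
    exact hM.not_isolated s t ((key s t (hMA' s hs)).2 h) hs
  · intro s t s' t' h h' hs hs'
    exact hM.no_bigon s t s' t' ((key s t (hMA' s hs)).2 h) ((key s' t' (hMA' s' hs')).2 h') hs hs'
  · have ov_of : ∀ s t, ov' s t → s ∈ M → ov s t := fun s t h hs =>
      (heq s t (hMA' s hs) (hA' s t (Or.inl h) (hMA' s hs))).2 h
    intro p p' q q' r r' hp hq hr hpM hqM hrM
    exact hM.no_layered_triangle p p' q q' r r' (ov_of _ _ hp hpM) (ov_of _ _ hq hqM)
      (ov_of _ _ hr hrM) hpM hqM hrM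
  · intro S hS hne hcl hj
    refine hM.connected S hS hne ?_ ?_
    · intro s t h hs
      exact hcl s t ((key s t (hMA' s (hS hs))).1 h) hs
    · intro a a' b b' ha hb haS hbM hbS
      exact hj a a' b b' ((key a a' (hMA' a (hS haS))).1 ha) ((key b b' (hMA' b hbM)).1 hb) haS hbM
        hbS

theorem adj_image_iff (ρ : S1 ≃ₜ S1) {M : Set S1} {a b : S1} :
    Adj (ρ '' M) (ρ a) (ρ b) ↔ Adj M a b := by
  simp only [Adj, Set.forall_mem_image, ρ.injective.ne_iff, joined_image_iff]

theorem Rigid.image {ov ov' : S1 → S1 → Prop} {M : Set S1} (hM : Rigid ov M) (ρ : S1 ≃ₜ S1)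
    (h : ∀ s t, ov' (ρ s) (ρ t) ↔ ov s t) : Rigid ov' (ρ '' M) := by
  have hc : ∀ s t, Chord ov' (ρ s) (ρ t) ↔ Chord ov s t := fun s t => by
    simp only [Chord, h]
  have hmem : ∀ (S : Set S1) s, ρ s ∈ ρ '' S ↔ s ∈ S := fun S s => ρ.injective.mem_set_image
  have hex : ∀ s, ∃ s', ρ s' = s := ρ.surjective
  refine ⟨hM.nonempty.image _, ?_, ?_, ?_, ?_, ?_, ?_, ?_⟩
  · rintro _ ⟨s, hs, rfl⟩
    obtain ⟨t, ht⟩ := hM.exists_chord s hs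
    exact ⟨ρ t, (hc s t).2 ht⟩
  · intro s t hst hs
    obtain ⟨s, rfl⟩ := hex s
    obtain ⟨t, rfl⟩ := hex t
    rw [hmem] at hs ⊢
    exact hM.closed s t ((hc s t).1 hst) hs
  · intro s t hst hs
    obtain ⟨s, rfl⟩ := hex s
    obtain ⟨t, rfl⟩ := hex t
    rw [hmem] at hs
    rintro _ ⟨m, hm, rfl⟩ _ ⟨m', hm', rfl⟩
    exact (hM.joined_of_notMem s t ((hc s t).1 hst) hs m hm m' hm').image ρ
  · intro s t hst hs
    obtain ⟨s, rfl⟩ := hex s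
    obtain ⟨t, rfl⟩ := hex t
    rw [hmem] at hs
    obtain ⟨m, hm, m', hm', h1, h2, h3, h4, hj⟩ := hM.not_isolated s t ((hc s t).1 hst) hs
    have hi := fun x y => (ρ.injective.ne_iff (x := x) (y := y)).2
    exact ⟨ρ m, mem_image_of_mem _ hm, ρ m', mem_image_of_mem _ hm', hi _ _ h1, hi _ _ h2, hi _ _ h3,
      hi _ _ h4, fun h => hj ((joined_image_iff ρ).1 h)⟩
  · intro s t s' t' hst hst'
    obtain ⟨s, rfl⟩ := hex s
    obtain ⟨t, rfl⟩ := hex t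
    obtain ⟨s', rfl⟩ := hex s'
    obtain ⟨t', rfl⟩ := hex t'
    rw [hmem, hmem, adj_image_iff, adj_image_iff, ρ.injective.ne_iff, ρ.injective.ne_iff]
    exact hM.no_bigon s t s' t' ((hc s t).1 hst) ((hc s' t').1 hst')
  · intro p p' q q' r r'
    obtain ⟨p, rfl⟩ := hex p
    obtain ⟨p', rfl⟩ := hex p'
    obtain ⟨q, rfl⟩ := hex q
    obtain ⟨q', rfl⟩ := hex q'
    obtain ⟨r, rfl⟩ := hex r
    obtain ⟨r', rfl⟩ := hex r'
    rw [hmem, hmem, hmem, h, h, h, adj_image_iff, adj_image_iff, adj_image_iff, ρ.injective.ne_iff,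
      ρ.injective.ne_iff, ρ.injective.ne_iff]
    exact hM.no_layered_triangle p p' q q' r r'
  · intro S hS hne hcl hj
    obtain ⟨S, rfl⟩ := ρ.surjective.image_surjective S
    rw [image_subset_image_iff ρ.injective] at hS
    rw [hM.connected S hS (by simpa using hne)]
    · intro s t hst hs
      have := hcl (ρ s) (ρ t) ((hc s t).2 hst)
      rw [hmem, hmem] at this
      exact this hs
    · intro a a' b b' ha hb haS hbM hbS
      have := hj (ρ a) (ρ a') (ρ b) (ρ b') ((hc _ _).2 ha) ((hc _ _).2 hb)
      rw [hmem, hmem, hmem, joined_image_iff] at this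
      exact this haS hbM hbS

theorem Diagram.finite_setOf_rigid (D : Diagram) : {M | Rigid D.isOver M}.Finite := by
  refine ((D.finite_double.image Prod.fst).finite_subsets).subset ?_
  intro M hM s hs
  obtain ⟨t, ht⟩ := hM.exists_chord s hs
  exact ⟨(s, t), (D.chord_iff).1 ht, rfl⟩

theorem PlanarIsotopic.ncard_rigid {D D' : Diagram} (h : PlanarIsotopic D D') :
    {M | Rigid D.isOver M}.ncard = {M | Rigid D'.isOver M}.ncard := by
  obtain ⟨H, ρ, -, hρ⟩ := h
  have : {M | Rigid D'.isOver M} = (fun M => ρ '' M) '' {M | Rigid D.isOver M} := by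
    ext M
    constructor
    · intro hM
      refine ⟨ρ.symm '' M, hM.image ρ.symm ?_, ?_⟩
      · intro s t
        rw [← hρ]
        simp
      · simp [image_image]
    · rintro ⟨M, hM, rfl⟩
      exact hM.image ρ hρ
  rw [this, ncard_image_of_injective _ ρ.injective.image_injective]

/-! ### Arcs of the circle -/

theorem btw_coe_of_lt {x y z : ℝ} (hxy : x < y) (hyx : y < x + 1) (hxz : x ≤ z)
    (hzx : z < x + 1) : btw (x : S1) (z : S1) (y : S1) ↔ z ≤ y := by
  rw [QuotientAddGroup.btw_coe_iff]
  rw [(toIcoMod_eq_self _).2 ⟨hxz, hzx⟩, (toIocMod_eq_self _).2 ⟨hxy, hyx.le⟩]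

theorem Arc.exists_coe (I : Arc) : ∃ x y : ℝ, x < y ∧ y < x + 1 ∧ I.a = (x : S1) ∧
    I.b = (y : S1) := by
  obtain ⟨x, hx⟩ := QuotientAddGroup.mk_surjective I.a
  have hb : I.b ∈ ((↑) : ℝ → S1) '' Ioc x (x + 1) := by
    rw [AddCircle.coe_image_Ioc_eq]
    trivial
  obtain ⟨y, ⟨hxy, hyx⟩, hy⟩ := hb
  refine ⟨x, y, hxy, lt_of_le_of_ne hyx ?_, hx.symm, hy.symm⟩
  rintro rfl
  exact I.ne (by rw [← hx, ← hy]; exact (AddCircle.coe_add_period 1 x).symm)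

theorem exists_coe_mem_Ico (x : ℝ) (s : S1) : ∃ z : ℝ, x ≤ z ∧ z < x + 1 ∧ (z : S1) = s := by
  have hb : s ∈ ((↑) : ℝ → S1) '' Ico x (x + 1) := by
    rw [AddCircle.coe_image_Ico_eq]
    trivial
  obtain ⟨y, ⟨hxy, hyx⟩, hy⟩ := hb
  exact ⟨y, hxy, hyx, hy⟩

theorem cIcc_coe {x y : ℝ} (hxy : x < y) (hyx : y < x + 1) :
    Set.cIcc (x : S1) (y : S1) = ((↑) : ℝ → S1) '' Icc x y := by
  ext s
  rw [Set.mem_cIcc]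
  constructor
  · intro h
    obtain ⟨z, hxz, hzx, rfl⟩ := exists_coe_mem_Ico x s
    exact ⟨z, ⟨hxz, (btw_coe_of_lt hxy hyx hxz hzx).1 h⟩, rfl⟩
  · rintro ⟨z, ⟨hxz, hzy⟩, rfl⟩
    exact (btw_coe_of_lt hxy hyx hxz (hzy.trans_lt hyx)).2 hzy

theorem cIoo_coe {x y : ℝ} (hxy : x < y) (hyx : y < x + 1) :
    Set.cIoo (x : S1) (y : S1) = ((↑) : ℝ → S1) '' Ioo x y := by
  have hx1 : ((x + 1 : ℝ) : S1) = x := AddCircle.coe_add_period 1 x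
  have key : Set.cIoo (x : S1) (y : S1) = (((↑) : ℝ → S1) '' Icc y (x + 1))ᶜ := by
    rw [← cIcc_coe hyx (by linarith), ← Set.compl_cIoo, compl_compl, hx1]
  rw [key]
  ext s
  constructor
  · intro h
    obtain ⟨z, hxz, hzx, rfl⟩ := exists_coe_mem_Ico x s
    have hzy : z < y := by
      by_contra hzy
      exact h ⟨z, ⟨not_lt.1 hzy, hzx.le⟩, rfl⟩
    refine ⟨z, ⟨lt_of_le_of_ne hxz ?_, hzy⟩, rfl⟩
    rintro rfl
    exact h ⟨x + 1, ⟨hyx.le, le_rfl⟩, hx1⟩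
  · rintro ⟨z, ⟨hxz, hzy⟩, rfl⟩ ⟨w, ⟨hyw, hwx⟩, hw⟩
    have := (AddCircle.coe_eq_coe_iff_of_mem_Ioc (a := x) (p := (1 : ℝ))
      ⟨by linarith, hwx⟩ ⟨hxz, by linarith⟩).1 hw
    linarith

theorem Arc.isPreconnected_closed (I : Arc) : IsPreconnected I.closed := by
  obtain ⟨x, y, hxy, hyx, ha, hb⟩ := I.exists_coe
  rw [Arc.closed, ha, hb, cIcc_coe hxy hyx]
  exact isPreconnected_Icc.image _ (AddCircle.continuous_mk' 1).continuousOn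

theorem Arc.inner_subset_closed (I : Arc) : I.inner ⊆ I.closed := fun s h => by
  have h' : sbtw I.a s I.b := h
  exact h'.btw

theorem Arc.mem_closed_iff (I : Arc) {s : S1} :
    s ∈ I.closed ↔ s ∈ I.inner ∨ s = I.a ∨ s = I.b := by
  obtain ⟨x, y, hxy, hyx, ha, hb⟩ := I.exists_coe
  rw [Arc.closed, Arc.inner, ha, hb, cIcc_coe hxy hyx, cIoo_coe hxy hyx]
  constructor
  · rintro ⟨z, ⟨hxz, hzy⟩, rfl⟩
    rcases hxz.eq_or_lt with rfl | hxz
    · exact Or.inr (Or.inl rfl)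
    · rcases hzy.eq_or_lt with rfl | hzy
      · exact Or.inr (Or.inr rfl)
      · exact Or.inl ⟨z, ⟨hxz, hzy⟩, rfl⟩
  · rintro (⟨z, ⟨hxz, hzy⟩, rfl⟩ | rfl | rfl)
    · exact ⟨z, ⟨hxz.le, hzy.le⟩, rfl⟩
    · exact ⟨x, ⟨le_rfl, hxy.le⟩, rfl⟩
    · exact ⟨y, ⟨hxy.le, le_rfl⟩, rfl⟩

/-! ### Rigid sets under Reidemeister moves -/

theorem IsClosedDisc.isClosed {B : Set Plane} (hB : IsClosedDisc B) : IsClosed B := by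
  obtain ⟨f, rfl⟩ := hB
  exact f.isClosedMap _ Metric.isClosed_closedBall

theorem MeetsDiscIn.curve_mem {D : Diagram} {B : Set Plane} {k : ℕ} {I : Fin k → Arc}
    (h : MeetsDiscIn D B I) (hB : IsClosed B) {s : S1} (hs : s ∈ arcs I) : D.curve s ∈ B := by
  obtain ⟨i, hi⟩ := mem_iUnion.1 hs
  rcases (I i).mem_closed_iff.1 hi with h' | rfl | rfl
  · exact interior_subset (h.2.1 i s h')
  · exact hB.frontier_subset (h.2.2 i).1
  · exact hB.frontier_subset (h.2.2 i).2

/-- A crossing cannot lie on one strand inside the disc and on another one outside. -/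
theorem MeetsDiscIn.notMem_arcs {D : Diagram} {B : Set Plane} {k : ℕ} {I : Fin k → Arc}
    (h : MeetsDiscIn D B I) (hB : IsClosed B) {s t : S1} (hst : Chord D.isOver s t)
    (hs : s ∉ arcs I) : t ∉ arcs I := by
  intro ht
  refine h.1 s hs ?_
  rw [(D.chord_iff.1 hst).2]
  exact h.curve_mem hB ht

theorem SameOutsideDisc.symm {D D' : Diagram} {k : ℕ} {I : Fin k → Arc}
    (h : SameOutsideDisc D D' I) : SameOutsideDisc D' D I := by
  obtain ⟨h1, ⟨B, hB, h2, h3⟩, h4, h5⟩ := h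
  exact ⟨h1, ⟨B, hB, h3, h2⟩, fun s hs => (h4 s hs).symm, fun s t hs ht => (h5 s t hs ht).symm⟩

theorem SameOutsideDisc.rigid {D D' : Diagram} {k : ℕ} {I : Fin k → Arc}
    (h : SameOutsideDisc D D' I) {M : Set S1} (hM : Rigid D.isOver M) (hMI : Disjoint M (arcs I))
    (hin : ∀ s t, Chord D'.isOver s t → s ∈ arcs I → t ∈ arcs I →
      ∀ m ∈ M, ∀ m' ∈ M, Joined m m' s t) :
    Rigid D'.isOver M := by
  obtain ⟨-, ⟨B, hB, h2, h3⟩, -, h5⟩ := h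
  exact hM.of_eq_outside hMI h5 (fun s t => h2.notMem_arcs hB.isClosed)
    (fun s t => h3.notMem_arcs hB.isClosed) hin

theorem SameOutsideDisc.chord_mem {D D' : Diagram} {k : ℕ} {I : Fin k → Arc}
    (h : SameOutsideDisc D D' I) {s t : S1} (hst : Chord D.isOver s t) (hs : s ∈ arcs I) :
    t ∈ arcs I := by
  obtain ⟨-, ⟨B, hB, h2, h3⟩, -, h5⟩ := h
  by_contra ht
  exact h2.notMem_arcs hB.isClosed hst.symm ht hs

theorem arcs_fin_one (I : Fin 1 → Arc) : arcs I = (I 0).closed := by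
  ext s
  simp only [arcs, mem_iUnion]
  exact ⟨fun ⟨i, hi⟩ => by rwa [Subsingleton.elim i 0] at hi, fun h => ⟨0, h⟩⟩

theorem CreatesKink.rigid {D D' : Diagram} (h : CreatesKink D D') {M : Set S1}
    (hM : Rigid D.isOver M) : Rigid D'.isOver M := by
  obtain ⟨I, hI, hinj, -⟩ := h
  have hd : Disjoint M (arcs I) := by
    rw [Set.disjoint_left]
    intro s hs hsI
    obtain ⟨t, hst⟩ := hM.exists_chord s hs
    have := D.chord_iff.1 hst
    exact this.1 (hinj hsI (hI.chord_mem hst hsI) this.2)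
  refine hI.rigid hM hd ?_
  intro s t _ hs ht m hm m' hm'
  have hd := Set.disjoint_left.1 hd
  rw [arcs_fin_one] at hs ht hd
  exact joined_of_isPreconnected (I 0).isPreconnected_closed hs ht (hd hm) (hd hm')

theorem CreatesKink.rigid_of_rigid {D D' : Diagram} (h : CreatesKink D D') {M : Set S1}
    (hM : Rigid D'.isOver M) : Rigid D.isOver M := by
  obtain ⟨I, hI, hinj, s, hs, t, ht, hst, honly⟩ := h
  have hd : Disjoint M (arcs I) := by
    rw [Set.disjoint_left]
    intro u hu huI
    obtain ⟨v, huv⟩ := hM.exists_chord u hu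
    have hvI := hI.symm.chord_mem huv huI
    obtain ⟨m, hm, m', hm', h1, h2, h3, h4, hj⟩ := hM.not_isolated u v huv hu
    -- the end points of the kink are the only crossing parameters on the arc
    have hnot : ∀ m ∈ M, m ≠ u → m ≠ v → m ∉ arcs I := by
      intro m hm hmu hmv hmI
      obtain ⟨m', hmm'⟩ := hM.exists_chord m hm
      have h1 := honly m hmI m' (hI.symm.chord_mem hmm' hmI) (D'.chord_iff.1 hmm')
      have h2 := honly u huI v hvI (D'.chord_iff.1 huv)
      rcases h1 with ⟨rfl, rfl⟩ | ⟨rfl, rfl⟩ <;> rcases h2 with ⟨rfl, rfl⟩ | ⟨rfl, rfl⟩ <;>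
        simp at hmu hmv
    have n1 := hnot m hm h1 h2
    have n2 := hnot m' hm' h3 h4
    rw [arcs_fin_one] at *
    exact hj (joined_of_isPreconnected (I 0).isPreconnected_closed huI hvI n1 n2)
  refine hI.symm.rigid hM hd ?_
  intro s t hst hs ht
  have := D.chord_iff.1 hst
  exact absurd (hinj hs ht this.2) this.1

section LayeredTriangle

variable {D : Diagram} {I : Fin 3 → Arc} {c : Fin 3 → Fin 3 → S1}

theorem IsLayeredTriangle.chord (h : IsLayeredTriangle D I c) {i j : Fin 3} (hij : i ≠ j) :
    Chord D.isOver (c i j) (c j i) := by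
  rcases lt_or_gt_of_ne hij with hlt | hlt
  · exact Or.inl (h.2.1 i j hlt)
  · exact Or.inr (h.2.1 j i hlt)

theorem IsLayeredTriangle.mem_closed (h : IsLayeredTriangle D I c) {i j : Fin 3} (hij : i ≠ j) :
    c i j ∈ (I i).closed :=
  (I i).inner_subset_closed (h.1 i j hij)

theorem IsLayeredTriangle.index_eq (h : IsLayeredTriangle D I c)
    (hI : ∀ i j, i ≠ j → Disjoint (I i).closed (I j).closed) {i j k : Fin 3} (hij : i ≠ j)
    (hk : c i j ∈ (I k).closed) : i = k := by
  by_contra hne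
  exact Set.disjoint_left.1 (hI i k hne) (h.mem_closed hij) hk

theorem IsLayeredTriangle.ne (h : IsLayeredTriangle D I c)
    (hI : ∀ i j, i ≠ j → Disjoint (I i).closed (I j).closed) {i j k l : Fin 3} (hij : i ≠ j)
    (hkl : k ≠ l) (hne : i ≠ k) : c i j ≠ c k l := by
  intro he
  exact hne (h.index_eq hI hij (he ▸ h.mem_closed hkl))

theorem IsLayeredTriangle.ne' (h : IsLayeredTriangle D I c)
    (hI : ∀ i j, i ≠ j → Disjoint (I i).closed (I j).closed) {i j k : Fin 3} (hij : i ≠ j)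
    (hik : i ≠ k) (hjk : j ≠ k) : c i j ≠ c i k := by
  intro he
  have h1 := (D.chord_iff.1 (h.chord hij)).2
  have h2 := (D.chord_iff.1 (h.chord hik)).2
  rw [← he] at h2
  rcases D.no_triple (c j i) (c i j) (c k i) h1.symm h2 with h3 | h3 | h3
  · exact h.ne hI hij.symm hij hij.symm h3
  · exact h.ne hI hij hik.symm hik h3
  · exact h.ne hI hij.symm hik.symm hjk h3

theorem IsLayeredTriangle.eq_of_mem (h : IsLayeredTriangle D I c)
    (hI : ∀ i j, i ≠ j → Disjoint (I i).closed (I j).closed)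
    (hc : ∀ s t, Chord D.isOver s t → s ∈ arcs I → t ∈ arcs I) {i : Fin 3} {s t : S1}
    (hst : Chord D.isOver s t) (hs : s ∈ (I i).closed) : ∃ j, i ≠ j ∧ s = c i j := by
  have hsI : s ∈ arcs I := mem_iUnion.2 ⟨i, hs⟩
  obtain ⟨i', j, hij, rfl, -⟩ := h.2.2 s hsI t (hc s t hst hsI) (D.chord_iff.1 hst)
  obtain rfl := h.index_eq hI hij hs
  exact ⟨j, hij, rfl⟩

/-- A rigid set contains no crossing of a layered triangle: if it contained one, two or all three
of the crossings of the triangle, it would have an isolated chord, a bigon or a layered triangle. -/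
theorem IsLayeredTriangle.disjoint (h : IsLayeredTriangle D I c)
    (hI : ∀ i j, i ≠ j → Disjoint (I i).closed (I j).closed)
    (hc : ∀ s t, Chord D.isOver s t → s ∈ arcs I → t ∈ arcs I) {M : Set S1}
    (hM : Rigid D.isOver M) : Disjoint M (arcs I) := by
  have hsymm : ∀ i j, i ≠ j → c i j ∈ M → c j i ∈ M := fun i j hij => hM.closed _ _ (h.chord hij)
  have harc : ∀ i j k, i ≠ j → i ≠ k → j ≠ k → ∀ m ∈ M, m ≠ c i j → m ≠ c i k →
      m ∉ (I i).closed := by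
    intro i j k hij hik hjk m hm h1 h2 hmI
    obtain ⟨t, hmt⟩ := hM.exists_chord m hm
    obtain ⟨l, hil, rfl⟩ := h.eq_of_mem hI hc hmt hmI
    have : l = j ∨ l = k := by
      clear * - hij hik hjk hil
      revert i j k l
      decide
    rcases this with rfl | rfl
    · exact h1 rfl
    · exact h2 rfl
  have hjoin : ∀ i j k, i ≠ j → i ≠ k → j ≠ k → ∀ m ∈ M, ∀ m' ∈ M, m ≠ c i j → m ≠ c i k →
      m' ≠ c i j → m' ≠ c i k → Joined m m' (c i j) (c i k) := by
    intro i j k hij hik hjk m hm m' hm' h1 h2 h3 h4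
    exact joined_of_isPreconnected (I i).isPreconnected_closed (h.mem_closed hij) (h.mem_closed hik)
      (harc i j k hij hik hjk m hm h1 h2) (harc i j k hij hik hjk m' hm' h3 h4)
  have hadj : ∀ i j k, i ≠ j → i ≠ k → j ≠ k → Adj M (c i j) (c i k) :=
    fun i j k hij hik hjk m hm m' hm' h1 h2 h3 h4 =>
      hjoin i j k hij hik hjk m hm m' hm' h1 h2 h3 h4
  have hlocal : ∀ i j, i ≠ j → c i j ∉ M → ∀ m ∈ M, ∀ m' ∈ M, Joined m m' (c i j) (c j i) :=
    fun i j hij => hM.joined_of_notMem _ _ (h.chord hij)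
  have one : ∀ i j k, i ≠ j → i ≠ k → j ≠ k → c i j ∈ M → c i k ∉ M → c j k ∉ M → False := by
    intro i j k hij hik hjk h1 h2 h3
    have h2' : c k i ∉ M := fun h' => h2 (hsymm _ _ hik.symm h')
    have h3' : c k j ∉ M := fun h' => h3 (hsymm _ _ hjk.symm h')
    obtain ⟨m, hm, m', hm', n1, n2, n3, n4, hj⟩ := hM.not_isolated _ _ (h.chord hij) h1
    have ne_of : ∀ m ∈ M, ∀ s, s ∉ M → m ≠ s := fun m hm s hs he => hs (he ▸ hm)
    apply hj
    refine (hjoin i j k hij hik hjk m hm m' hm' n1 (ne_of m hm _ h2) n3 (ne_of m' hm' _ h2)).trans ?_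
    refine (hlocal i k hik h2 m hm m' hm').trans ?_
    refine (hjoin k i j hik.symm hjk.symm hij m hm m' hm' (ne_of m hm _ h2') (ne_of m hm _ h3')
      (ne_of m' hm' _ h2') (ne_of m' hm' _ h3')).trans ?_
    refine (hlocal k j hjk.symm h3' m hm m' hm').trans ?_
    exact hjoin j k i hjk hij.symm hik.symm m hm m' hm' (ne_of m hm _ h3) n2 (ne_of m' hm' _ h3) n4
  have two : ∀ i j k, i ≠ j → i ≠ k → j ≠ k → c i j ∈ M → c i k ∈ M → c j k ∉ M → False := by
    intro i j k hij hik hjk h1 h2 h3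
    have h3' : c k j ∉ M := fun h' => h3 (hsymm _ _ hjk.symm h')
    have ne_of : ∀ m ∈ M, ∀ s, s ∉ M → m ≠ s := fun m hm s hs he => hs (he ▸ hm)
    refine hM.no_bigon _ _ _ _ (h.chord hij) (h.chord hik) h1 h2 (h.ne' hI hij hik hjk).symm
      (h.ne hI hik hij.symm hij) (hadj i j k hij hik hjk) ?_
    intro m hm m' hm' n1 n2 n3 n4
    refine (hjoin j i k hij.symm hjk hik m hm m' hm' n1 (ne_of m hm _ h3) n3
      (ne_of m' hm' _ h3)).trans ?_
    refine (hlocal j k hjk h3 m hm m' hm').trans ?_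
    exact hjoin k j i hjk.symm hik.symm hij.symm m hm m' hm' (ne_of m hm _ h3') n2
      (ne_of m' hm' _ h3') n4
  have three : c 0 1 ∈ M → c 0 2 ∈ M → c 1 2 ∈ M → False := by
    intro h1 h2 h3
    exact hM.no_layered_triangle (c 0 1) (c 1 0) (c 0 2) (c 2 0) (c 1 2) (c 2 1)
      (h.2.1 0 1 (by decide)) (h.2.1 0 2 (by decide)) (h.2.1 1 2 (by decide)) h1 h2 h3
      (h.ne' hI (by decide) (by decide) (by decide)) (h.ne hI (by decide) (by decide) (by decide))
      (h.ne hI (by decide) (by decide) (by decide)) (hadj 0 1 2 (by decide) (by decide) (by decide))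
      (hadj 1 0 2 (by decide) (by decide) (by decide))
      (hadj 2 0 1 (by decide) (by decide) (by decide))
  have hs := fun i j hij => Iff.intro (hsymm i j hij) (hsymm j i hij.symm)
  have s01 := hs 0 1 (by decide)
  have s02 := hs 0 2 (by decide)
  have s12 := hs 1 2 (by decide)
  have o0 := one 0 1 2 (by decide) (by decide) (by decide)
  have o1 := one 0 2 1 (by decide) (by decide) (by decide)
  have o2 := one 1 2 0 (by decide) (by decide) (by decide)
  have t0 := two 0 1 2 (by decide) (by decide) (by decide)
  have t1 := two 1 0 2 (by decide) (by decide) (by decide)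
  have t2 := two 2 0 1 (by decide) (by decide) (by decide)
  have none : c 0 1 ∉ M ∧ c 0 2 ∉ M ∧ c 1 2 ∉ M := by
    clear * - s01 s02 s12 o0 o1 o2 t0 t1 t2 three
    by_cases h1 : c 0 1 ∈ M <;> by_cases h2 : c 0 2 ∈ M <;> by_cases h3 : c 1 2 ∈ M <;>
      simp_all
  rw [Set.disjoint_left]
  intro s hsM hsI
  obtain ⟨i, hi⟩ := mem_iUnion.1 hsI
  obtain ⟨t, hst⟩ := hM.exists_chord s hsM
  obtain ⟨j, hij, rfl⟩ := h.eq_of_mem hI hc hst hi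
  have n10 : c 1 0 ∉ M := fun h' => none.1 (s01.2 h')
  have n20 : c 2 0 ∉ M := fun h' => none.2.1 (s02.2 h')
  have n21 : c 2 1 ∉ M := fun h' => none.2.2 (s12.2 h')
  fin_cases i <;> fin_cases j
  · exact hij rfl
  · exact none.1 hsM
  · exact none.2.1 hsM
  · exact n10 hsM
  · exact hij rfl
  · exact none.2.2 hsM
  · exact n20 hsM
  · exact n21 hsM
  · exact hij rfl

end LayeredTriangle

theorem SameOutsideDisc.rigid_of_layered {D D' : Diagram} {I : Fin 3 → Arc}
    {c c' : Fin 3 → Fin 3 → S1} (h : SameOutsideDisc D D' I) (hc : IsLayeredTriangle D I c)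
    (hc' : IsLayeredTriangle D' I c') {M : Set S1} (hM : Rigid D.isOver M) :
    Rigid D'.isOver M := by
  have hd := hc.disjoint h.1 (fun s t => h.chord_mem) hM
  refine h.rigid hM hd ?_
  intro s t hst hs ht m hm m' hm'
  obtain ⟨i, j, hij, rfl, rfl⟩ := hc'.2.2 s hs t ht (D'.chord_iff.1 hst)
  have hnot : ∀ m ∈ M, ∀ k, m ∉ (I k).closed := fun m hm k hk =>
    Set.disjoint_left.1 hd hm (mem_iUnion.2 ⟨k, hk⟩)
  have hcM : c i j ∉ M := fun hm => hnot _ hm i (hc.mem_closed hij)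
  refine (joined_of_isPreconnected (I i).isPreconnected_closed (hc'.mem_closed hij) (hc.mem_closed hij)
    (hnot m hm i) (hnot m' hm' i)).trans ?_
  refine (hM.joined_of_notMem _ _ (hc.chord hij) hcM m hm m' hm').trans ?_
  exact joined_of_isPreconnected (I j).isPreconnected_closed (hc.mem_closed hij.symm) (hc'.mem_closed hij.symm)
    (hnot m hm j) (hnot m' hm' j)

/-- The number of rigid sets is invariant under all moves except those of type `Ω₂`. -/
theorem Step.ncard_rigid {D D' : Diagram} (h : Step {MoveClass.omega2}ᶜ D D') :
    {M | Rigid D.isOver M}.ncard = {M | Rigid D'.isOver M}.ncard := by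
  rcases h with h | ⟨m, hm, h⟩
  · exact h.ncard_rigid
  · congr 1
    ext M
    cases m with
    | omega1 =>
      rcases h with h | h
      · exact ⟨h.rigid, h.rigid_of_rigid⟩
      · exact ⟨h.rigid_of_rigid, h.rigid⟩
    | omega2 => simp at hm
    | omega3 =>
      obtain ⟨I, hI, c, c', hc, hc', -⟩ := h
      exact ⟨hI.rigid_of_layered hc hc', hI.symm.rigid_of_layered hc' hc⟩

theorem Independent.ncard_rigid {D D' : Diagram} (h : Independent MoveClass.omega2 D D') :
    {M | Rigid D.isOver M}.ncard = {M | Rigid D'.isOver M}.ncard := by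
  unfold Independent HasReidemeisterSequence at h
  induction h with
  | refl => rfl
  | tail _ h ih => exact ih.trans h.ncard_rigid

/-! ### Ambient isotopy -/

section AmbientIsotopic

variable {X : Type} [TopologicalSpace X] {A B C : Set X}

theorem AmbientIsotopic.of_family (Φ : unitInterval → X ≃ₜ X)
    (hΦ : Continuous fun p : unitInterval × X => Φ p.1 p.2) (h0 : ∀ x, Φ 0 x = x) (A : Set X) :
    AmbientIsotopic A (Φ 1 '' A) :=
  ⟨⟨fun t => Φ t, hΦ, fun t => (Φ t).isHomeomorph, h0⟩, rfl⟩

theorem AmbientIsotopic.refl (A : Set X) : AmbientIsotopic A A := by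
  simpa using AmbientIsotopic.of_family (fun _ => Homeomorph.refl X) continuous_snd
    (fun _ => rfl) A

/-- Isotopies are composed pointwise in time. -/
theorem AmbientIsotopic.trans (h : AmbientIsotopic A B) (h' : AmbientIsotopic B C) :
    AmbientIsotopic A C := by
  obtain ⟨H, rfl⟩ := h
  obtain ⟨G, rfl⟩ := h'
  refine ⟨⟨fun t x => G.toFun t (H.toFun t x), ?_, ?_, ?_⟩, ?_⟩
  · exact G.continuous_toFun.comp (continuous_fst.prodMk H.continuous_toFun)
  · exact fun t => (G.isHomeomorph t).comp (H.isHomeomorph t)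
  · intro x
    rw [H.map_zero, G.map_zero]
  · exact image_comp (G.toFun 1) (H.toFun 1) A

/-- The reversed isotopy is `t ↦ H (1 - t) ∘ (H 1)⁻¹`. -/
theorem AmbientIsotopic.symm (h : AmbientIsotopic A B) : AmbientIsotopic B A := by
  obtain ⟨H, rfl⟩ := h
  let e : X ≃ₜ X := (H.isHomeomorph 1).homeomorph
  have he : ∀ x, e x = H.toFun 1 x := fun _ => rfl
  refine ⟨⟨fun t x => H.toFun (unitInterval.symm t) (e.symm x), ?_, ?_, ?_⟩, ?_⟩
  · exact H.continuous_toFun.comp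
      ((unitInterval.continuous_symm.comp continuous_fst).prodMk (e.symm.continuous.comp
        continuous_snd))
  · exact fun t => (H.isHomeomorph _).comp e.symm.isHomeomorph
  · intro x
    rw [unitInterval.symm_zero, ← he, e.apply_symm_apply]
  · ext x
    simp only [AmbientIsotopy.final, unitInterval.symm_one, H.map_zero, image_image, ← he,
      e.symm_apply_apply, image_id']

theorem AmbientIsotopic.image (h : AmbientIsotopic A B) (e : X ≃ₜ X) :
    AmbientIsotopic (e '' A) (e '' B) := by
  obtain ⟨H, rfl⟩ := h
  refine ⟨⟨fun t x => e (H.toFun t (e.symm x)), ?_, ?_, ?_⟩, ?_⟩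
  · exact e.continuous.comp (H.continuous_toFun.comp
      (continuous_fst.prodMk (e.symm.continuous.comp continuous_snd)))
  · exact fun t => (e.isHomeomorph.comp (H.isHomeomorph t)).comp e.symm.isHomeomorph
  · intro x
    rw [H.map_zero, e.apply_symm_apply]
  · simp only [AmbientIsotopy.final, image_image, e.symm_apply_apply]

end AmbientIsotopic

/-! ### Moving a corner of a polygon across a triangle -/

/-- A piecewise linear map of the line: slope `a` between `l` and the point where the two
lines cross, slope `b` from there to `r`, and the identity elsewhere (if `l ≤ r`, `a ≤ 1 ≤ b`). -/
noncomputable def squeeze (a b l r y : ℝ) : ℝ := min y (max (l + a * (y - l)) (r + b * (y - r)))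

/-- The inverse map of `squeeze a b l r`. -/
noncomputable def unsqueeze (a b l r y : ℝ) : ℝ :=
  max y (min (l + (y - l) / a) (r + (y - r) / b))

theorem line_le_iff {a l y w : ℝ} (ha : 0 < a) : l + a * (y - l) ≤ w ↔ y ≤ l + (w - l) / a := by
  rw [← sub_le_iff_le_add', le_div_iff₀ ha, ← le_sub_iff_add_le', mul_comm]

theorem le_line_iff {a l y w : ℝ} (ha : 0 < a) : w ≤ l + a * (y - l) ↔ l + (w - l) / a ≤ y := by
  rw [← le_sub_iff_add_le', div_le_iff₀ ha, ← sub_le_iff_le_add', mul_comm]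

theorem unsqueeze_squeeze {a b : ℝ} (ha : 0 < a) (hb : 0 < b) (l r y : ℝ) :
    unsqueeze a b l r (squeeze a b l r y) = y := by
  apply le_antisymm
  · rw [unsqueeze, max_le_iff, min_le_iff, ← le_line_iff ha, ← le_line_iff hb, ← le_max_iff]
    exact ⟨min_le_left _ _, min_le_right _ _⟩
  · rw [unsqueeze, le_max_iff, le_min_iff, ← line_le_iff ha, ← line_le_iff hb, ← max_le_iff,
      squeeze]
    rcases le_total y (max (l + a * (y - l)) (r + b * (y - r))) with h | h
    · left
      rw [min_eq_left h]
    · right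
      rw [min_eq_right h]

theorem squeeze_unsqueeze {a b : ℝ} (ha : 0 < a) (hb : 0 < b) (l r y : ℝ) :
    squeeze a b l r (unsqueeze a b l r y) = y := by
  apply le_antisymm
  · rw [squeeze, min_le_iff, max_le_iff, line_le_iff ha, line_le_iff hb, ← le_min_iff, unsqueeze]
    rcases le_total y (min (l + (y - l) / a) (r + (y - r) / b)) with h | h
    · right
      rw [max_eq_right h]
    · left
      rw [max_eq_left h]
  · rw [squeeze, le_min_iff, le_max_iff, le_line_iff ha, le_line_iff hb, ← min_le_iff]
    exact ⟨le_max_left _ _, le_max_right _ _⟩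

theorem squeeze_eq_self {a b l r y : ℝ} (ha : a ≤ 1) (hb : 1 ≤ b) (h : y ≤ l ∨ r ≤ y) :
    squeeze a b l r y = y := by
  rw [squeeze, min_eq_left]
  rw [le_max_iff]
  rcases h with h | h
  · left
    nlinarith
  · right
    nlinarith

/-- The width at `p` of the region in which the standard corner move takes place. -/
noncomputable def octWidth (ε : ℝ) (p : Space) : ℝ := 1 - |p.1.1| - |p.2| / ε

/-- A thin open neighbourhood, an octahedron, of the standard triangle with corners `(-1, 0, 0)`,
`(0, 1, 0)`, `(1, 0, 0)` without the corners at the ends of its base. -/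
def oct (ε : ℝ) : Set Space :=
  {p | 0 < octWidth ε p ∧ -(ε * octWidth ε p) < p.1.2 ∧ p.1.2 < (1 + ε) * octWidth ε p}

/-- The standard corner move at time `t`: it moves the points of the octahedron parallel to the second
axis, and at time `1` it takes the two upper sides of the standard triangle to its base. -/
noncomputable def cornerMove {ε : ℝ} (hε : 0 < ε) (t : unitInterval) : Space ≃ₜ Space where
  toFun p := ((p.1.1, squeeze ((1 - t + ε) / (1 + ε)) ((ε + t) / ε)
    (-(ε * max (octWidth ε p) 0)) ((1 + ε) * max (octWidth ε p) 0) p.1.2), p.2)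
  invFun p := ((p.1.1, unsqueeze ((1 - t + ε) / (1 + ε)) ((ε + t) / ε)
    (-(ε * max (octWidth ε p) 0)) ((1 + ε) * max (octWidth ε p) 0) p.1.2), p.2)
  left_inv p := by
    have h1 : 0 < (1 - t + ε) / (1 + ε) := div_pos (by linarith [t.2.2]) (by linarith)
    have h2 : 0 < (ε + t) / ε := div_pos (by linarith [t.2.1]) hε
    simp only [octWidth]
    rw [unsqueeze_squeeze h1 h2]
  right_inv p := by
    have h1 : 0 < (1 - t + ε) / (1 + ε) := div_pos (by linarith [t.2.2]) (by linarith)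
    have h2 : 0 < (ε + t) / ε := div_pos (by linarith [t.2.1]) hε
    simp only [octWidth]
    rw [squeeze_unsqueeze h1 h2]
  continuous_toFun := by
    unfold squeeze octWidth
    fun_prop
  continuous_invFun := by
    unfold unsqueeze octWidth
    fun_prop

theorem cornerMove_apply {ε : ℝ} (hε : 0 < ε) (t : unitInterval) (p : Space) :
    cornerMove hε t p = ((p.1.1, squeeze ((1 - t + ε) / (1 + ε)) ((ε + t) / ε)
    (-(ε * max (octWidth ε p) 0)) ((1 + ε) * max (octWidth ε p) 0) p.1.2), p.2) := rfl

theorem cornerMove_of_notMem {ε : ℝ} (hε : 0 < ε) (t : unitInterval) {p : Space}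
    (hp : p ∉ oct ε) : cornerMove hε t p = p := by
  have h1 : (1 - t + ε) / (1 + ε) ≤ 1 := by
    rw [div_le_one (by linarith)]
    linarith [t.2.1]
  have h2 : 1 ≤ (ε + t) / ε := by
    rw [one_le_div hε]
    linarith [t.2.1]
  rw [cornerMove_apply, squeeze_eq_self h1 h2]
  by_cases h0 : 0 < octWidth ε p
  · rw [max_eq_left h0.le]
    by_contra h
    push Not at h
    exact hp ⟨h0, h.1, h.2⟩
  · rw [max_eq_right (not_lt.1 h0)]
    simpa using le_total _ _

theorem continuous_cornerMove {ε : ℝ} (hε : 0 < ε) :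
    Continuous fun p : unitInterval × Space => cornerMove hε p.1 p.2 := by
  simp only [cornerMove_apply]
  unfold squeeze octWidth
  fun_prop

theorem cornerMove_zero {ε : ℝ} (hε : 0 < ε) (p : Space) : cornerMove hε 0 p = p := by
  rw [cornerMove_apply, squeeze]
  have h1 : ((1 - (0 : unitInterval) + ε) / (1 + ε) : ℝ) = 1 := by
    rw [Set.Icc.coe_zero, sub_zero]
    exact div_self (by linarith)
  rw [h1]
  simp

theorem cornerMove_one {ε : ℝ} (hε : 0 < ε) {x : ℝ} (hx : |x| ≤ 1) :
    cornerMove hε 1 ((x, 1 - |x|), 0) = ((x, 0), 0) := by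
  rw [cornerMove_apply]
  have hu : octWidth ε ((x, 1 - |x|), 0) = 1 - |x| := by simp [octWidth]
  have h0 : 0 ≤ 1 - |x| := by linarith
  have h1 : -(ε * (1 - |x|)) + (1 - 1 + ε) / (1 + ε) * (1 - |x| - -(ε * (1 - |x|))) = 0 := by
    field_simp
    ring
  have h2 : (1 + ε) * (1 - |x|) + (ε + 1) / ε * (1 - |x| - (1 + ε) * (1 - |x|)) = 0 := by
    field_simp
    ring
  simp only [hu, max_eq_left h0, squeeze, Set.Icc.coe_one]
  rw [h1, h2, max_self, min_eq_right h0]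

/-- The two upper sides of the standard triangle may be replaced by its base, in the presence of a
set `F` that does not meet the octahedron around the triangle. -/
theorem ambientIsotopic_corner {ε : ℝ} (hε : 0 < ε) {F : Set Space} (hF : Disjoint F (oct ε)) :
    AmbientIsotopic ((fun x : ℝ => (((x, 1 - |x|), 0) : Space)) '' Icc (-1) 1 ∪ F)
      ((fun x : ℝ => (((x, 0), 0) : Space)) '' Icc (-1) 1 ∪ F) := by
  have h := AmbientIsotopic.of_family (cornerMove hε) (continuous_cornerMove hε)
    (cornerMove_zero hε) ((fun x : ℝ => (((x, 1 - |x|), 0) : Space)) '' Icc (-1) 1 ∪ F)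
  convert h using 1
  rw [image_union, image_image]
  congr 1
  · exact image_congr fun x hx => (cornerMove_one hε (abs_le.2 hx)).symm
  · conv_lhs => rw [← image_id F]
    exact image_congr fun x hx =>
      (cornerMove_of_notMem hε 1 (Set.disjoint_left.1 hF hx)).symm

/-- The set `F` stays away from the standard triangle, except that it may touch the ends of the
base: it is disjoint from all sufficiently thin octahedra. -/
def AvoidsTriangle (F : Set Space) : Prop := ∀ᶠ ε in 𝓝[>] (0 : ℝ), Disjoint F (oct ε)

theorem AvoidsTriangle.union {F G : Set Space} (hF : AvoidsTriangle F) (hG : AvoidsTriangle G) :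
    AvoidsTriangle (F ∪ G) := by
  filter_upwards [hF, hG] with ε h1 h2 using h1.union_left h2

theorem AvoidsTriangle.of_isCompact {F : Set Space} (hF : IsCompact F)
    (h : ∀ p ∈ F, ¬ (p.2 = 0 ∧ 0 ≤ p.1.2 ∧ p.1.2 ≤ 1 - |p.1.1|)) : AvoidsTriangle F := by
  rcases F.eq_empty_or_nonempty with rfl | hne
  · exact Filter.Eventually.of_forall fun ε => empty_disjoint _
  let φ : Space → ℝ := fun p => max |p.2| (max (-p.1.2) (p.1.2 - (1 - |p.1.1|)))
  have hφ : Continuous φ := by fun_prop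
  obtain ⟨p, hp, hmin⟩ := hF.exists_isMinOn hne hφ.continuousOn
  have hpos : 0 < φ p := by
    by_contra hle
    rw [not_lt] at hle
    simp only [φ, max_le_iff] at hle
    exact h p hp ⟨abs_nonpos_iff.1 hle.1, by linarith [hle.2.1], by linarith [hle.2.2]⟩
  filter_upwards [Ioo_mem_nhdsGT hpos] with ε hε
  rw [Set.disjoint_left]
  intro q hq ⟨h1, h2, h3⟩
  have hle : φ p ≤ φ q := hmin hq
  have hlt : φ q < ε := by
    have hw : octWidth ε q = 1 - |q.1.1| - |q.2| / ε := rfl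
    have hz : 0 ≤ |q.2| / ε := div_nonneg (abs_nonneg _) hε.1.le
    have hx := abs_nonneg q.1.1
    have hw1 : octWidth ε q ≤ 1 := by linarith
    simp only [φ, max_lt_iff]
    refine ⟨?_, ?_, ?_⟩
    · rw [← div_lt_one hε.1]
      linarith
    · nlinarith [hε.1]
    · nlinarith [hε.1]
  linarith [hε.2]

theorem avoidsTriangle_segment_left {p : Space} (hp : p.1.1 ≤ -1 ∨ p.2 ≠ 0) :
    AvoidsTriangle (segment ℝ ((-1, 0), 0) p) := by
  have key : ∀ᶠ ε in 𝓝[>] (0 : ℝ), 0 < ε ∧ (p.1.1 ≤ -1 ∨ ε * (p.1.1 + 1) ≤ |p.2|) := by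
    rcases hp with hp | hp
    · filter_upwards [self_mem_nhdsWithin] with ε hε using ⟨hε, Or.inl hp⟩
    · have hz : 0 < |p.2| := abs_pos.2 hp
      have hd : 0 < |p.2| / (|p.1.1| + 1) := by positivity
      filter_upwards [Ioo_mem_nhdsGT hd] with ε hε
      refine ⟨hε.1, Or.inr ?_⟩
      have h1 := (lt_div_iff₀ (by positivity : (0 : ℝ) < |p.1.1| + 1)).1 hε.2
      nlinarith [le_abs_self p.1.1, hε.1]
  filter_upwards [key] with ε ⟨hε, hp⟩
  rw [Set.disjoint_left]
  rintro q hq ⟨h1, -, -⟩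
  rw [segment_eq_image'] at hq
  obtain ⟨t, ⟨ht0, ht1⟩, rfl⟩ := hq
  simp only [octWidth, Prod.fst_add, Prod.smul_fst, Prod.fst_sub, Prod.snd_add, Prod.smul_snd,
    Prod.snd_sub, smul_eq_mul, sub_zero, zero_add, sub_neg_eq_add] at h1
  have h2 := neg_abs_le (-1 + t * (p.1.1 + 1))
  rw [abs_mul, abs_of_nonneg ht0] at h1
  have h3 : 0 ≤ t * |p.2| / ε := by positivity
  rcases hp with hp | hp
  · nlinarith
  · have h4 : t * |p.2| / ε < t * (p.1.1 + 1) := by linarith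
    rw [div_lt_iff₀ hε] at h4
    nlinarith

theorem avoidsTriangle_segment_right {p : Space} (hp : 1 ≤ p.1.1 ∨ p.2 ≠ 0) :
    AvoidsTriangle (segment ℝ ((1, 0), 0) p) := by
  have h := avoidsTriangle_segment_left (p := ((-p.1.1, p.1.2), p.2)) (by
    rcases hp with hp | hp
    · exact Or.inl (neg_le_neg hp)
    · exact Or.inr hp)
  filter_upwards [h] with ε h
  rw [Set.disjoint_left] at h ⊢
  intro q hq hqo
  refine h (a := ((-q.1.1, q.1.2), q.2)) ?_ (by simpa [oct, octWidth] using hqo)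
  rw [segment_eq_image'] at hq ⊢
  obtain ⟨t, ht, rfl⟩ := hq
  refine ⟨t, ht, ?_⟩
  ext
  · simp only [Prod.fst_add, Prod.smul_fst, Prod.fst_sub, smul_eq_mul]
    ring
  · simp
  · simp

/-! ### Triangles in general position in space -/

/-- The cross product. -/
def cross {R : Type*} [CommRing R] (u v : (R × R) × R) : (R × R) × R :=
  ((u.1.2 * v.2 - u.2 * v.1.2, u.2 * v.1.1 - u.1.1 * v.2), u.1.1 * v.1.2 - u.1.2 * v.1.1)

/-- The scalar product. -/
def dot {R : Type*} [CommRing R] (u v : (R × R) × R) : R :=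
  u.1.1 * v.1.1 + u.1.2 * v.1.2 + u.2 * v.2

/-- The normal vector of the triangle `a`, `b`, `c`. -/
def normal {R : Type*} [CommRing R] (a b c : (R × R) × R) : (R × R) × R :=
  cross (b - a) (c - a)

/-- The signed volume (up to a factor) of the tetrahedron `a`, `b`, `c`, `d`. -/
def vol {R : Type*} [CommRing R] (a b c d : (R × R) × R) : R := dot (normal a b c) (d - a)

theorem dot_self_pos {u : Space} (hu : u ≠ 0) : 0 < dot u u := by
  by_contra h
  simp only [dot] at h
  have h1 := mul_self_nonneg u.1.1
  have h2 := mul_self_nonneg u.1.2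
  have h3 := mul_self_nonneg u.2
  apply hu
  ext
  · exact mul_self_eq_zero.1 (by linarith)
  · exact mul_self_eq_zero.1 (by linarith)
  · exact mul_self_eq_zero.1 (by linarith)

/-- The linear part of the affine frame of a triangle. -/
noncomputable def frameLin (a b c : Space) : Space →ₗ[ℝ] Space where
  toFun p := p.1.1 • ((1 / 2 : ℝ) • (c - a)) + p.1.2 • (b - (1 / 2 : ℝ) • (a + c)) +
    p.2 • normal a b c
  map_add' p q := by
    simp only [Prod.fst_add, Prod.snd_add]
    module
  map_smul' r p := by
    simp only [Prod.smul_fst, Prod.smul_snd, RingHom.id_apply, smul_eq_mul]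
    module

theorem frameLin_apply (a b c p : Space) : frameLin a b c p =
    p.1.1 • ((1 / 2 : ℝ) • (c - a)) + p.1.2 • (b - (1 / 2 : ℝ) • (a + c)) + p.2 • normal a b c :=
  rfl

theorem dot_normal_frameLin (a b c p : Space) :
    dot (normal a b c) (frameLin a b c p) = p.2 * dot (normal a b c) (normal a b c) := by
  simp only [frameLin_apply, dot, normal, cross, Prod.fst_add, Prod.snd_add, Prod.smul_fst,
    Prod.smul_snd, Prod.fst_sub, Prod.snd_sub, smul_eq_mul]
  ring

theorem frameLin_injective {a b c : Space} (h : normal a b c ≠ 0) :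
    Function.Injective (frameLin a b c) := by
  rw [injective_iff_map_eq_zero]
  intro p hp
  have hz : p.2 = 0 := by
    have := dot_normal_frameLin a b c p
    rw [hp] at this
    have h0 : dot (normal a b c) (0 : Space) = 0 := by simp [dot]
    rw [h0] at this
    exact (mul_eq_zero.1 this.symm).resolve_right (dot_self_pos h).ne'
  have hp' := hp
  rw [frameLin_apply, hz, zero_smul, add_zero] at hp'
  have e1 := congrArg (fun q : Space => q.1.1) hp'
  have e2 := congrArg (fun q : Space => q.1.2) hp'
  have e3 := congrArg (fun q : Space => q.2) hp'
  simp only [Prod.fst_add, Prod.snd_add, Prod.smul_fst,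
    Prod.smul_snd, Prod.fst_sub, Prod.snd_sub, smul_eq_mul, Prod.fst_zero, Prod.snd_zero] at e1 e2 e3
  have hy : p.1.2 • normal a b c = 0 := by
    ext
    · simp only [normal, cross, Prod.smul_fst, Prod.fst_sub, Prod.snd_sub, smul_eq_mul,
        Prod.fst_zero]
      linear_combination (c.2 - a.2) * e2 - (c.1.2 - a.1.2) * e3
    · simp only [normal, cross, Prod.smul_fst, Prod.smul_snd, Prod.fst_sub, Prod.snd_sub,
        smul_eq_mul, Prod.fst_zero, Prod.snd_zero]
      linear_combination (c.1.1 - a.1.1) * e3 - (c.2 - a.2) * e1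
    · simp only [normal, cross, Prod.smul_snd, Prod.fst_sub, Prod.snd_sub,
        smul_eq_mul, Prod.snd_zero]
      linear_combination (c.1.2 - a.1.2) * e1 - (c.1.1 - a.1.1) * e2
  have hy0 : p.1.2 = 0 := (smul_eq_zero.1 hy).resolve_right h
  have hx : p.1.1 • ((1 / 2 : ℝ) • (c - a)) = 0 := by
    rw [hy0, zero_smul, add_zero] at hp'
    exact hp'
  have hca : c - a ≠ 0 := by
    intro h0
    apply h
    simp [normal, h0, cross]
  have hx0 : p.1.1 = 0 :=
    (smul_eq_zero.1 hx).resolve_right (smul_ne_zero (by norm_num) hca)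
  exact Prod.ext (Prod.ext hx0 hy0) hz

/-- The affine coordinates of space which take the standard triangle with corners `(-1, 0, 0)`,
`(0, 1, 0)`, `(1, 0, 0)` to the triangle `a`, `b`, `c`. -/
noncomputable def frame {a b c : Space} (h : normal a b c ≠ 0) : Space ≃ₜ Space :=
  (LinearEquiv.ofInjectiveEndo (frameLin a b c)
    (frameLin_injective h)).toContinuousLinearEquiv.toHomeomorph.trans
    (Homeomorph.addLeft ((1 / 2 : ℝ) • (a + c)))

theorem frame_apply {a b c : Space} (h : normal a b c ≠ 0) (p : Space) :
    frame h p = (1 / 2 : ℝ) • (a + c) + frameLin a b c p := rfl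

theorem frame_image_segment {a b c : Space} (h : normal a b c ≠ 0) (p q : Space) :
    frame h '' segment ℝ p q = segment ℝ (frame h p) (frame h q) := by
  have h1 : (frame h : Space → Space) =
      (fun x => (1 / 2 : ℝ) • (a + c) + x) ∘ (frameLin a b c).toAffineMap := rfl
  rw [h1, image_comp, image_segment, segment_translate_image]
  rfl

theorem frame_left {a b c : Space} (h : normal a b c ≠ 0) : frame h ((-1, 0), 0) = a := by
  rw [frame_apply, frameLin_apply]
  module

theorem frame_top {a b c : Space} (h : normal a b c ≠ 0) : frame h ((0, 1), 0) = b := by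
  rw [frame_apply, frameLin_apply]
  module

theorem frame_right {a b c : Space} (h : normal a b c ≠ 0) : frame h ((1, 0), 0) = c := by
  rw [frame_apply, frameLin_apply]
  module

theorem vol_frame {a b c : Space} (h : normal a b c ≠ 0) (p : Space) :
    vol a b c (frame h p) = p.2 * dot (normal a b c) (normal a b c) := by
  rw [← dot_normal_frameLin, frame_apply, vol]
  simp only [frameLin_apply, dot, normal, cross, Prod.fst_add, Prod.snd_add, Prod.smul_fst,
    Prod.smul_snd, Prod.fst_sub, Prod.snd_sub, smul_eq_mul]
  ring

theorem base_eq_segment : (fun x : ℝ => (((x, 0), 0) : Space)) '' Icc (-1) 1 =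
    segment ℝ (((-1, 0), 0) : Space) ((1, 0), 0) := by
  rw [segment_eq_image']
  ext p
  constructor
  · rintro ⟨x, ⟨h1, h2⟩, rfl⟩
    refine ⟨(x + 1) / 2, ⟨by linarith, by linarith⟩, ?_⟩
    ext
    · simp; ring
    · simp
    · simp
  · rintro ⟨t, ⟨h1, h2⟩, rfl⟩
    refine ⟨-1 + 2 * t, ⟨by linarith, by linarith⟩, ?_⟩
    ext
    · simp; ring
    · simp
    · simp

theorem roof_eq_segments : (fun x : ℝ => (((x, 1 - |x|), 0) : Space)) '' Icc (-1) 1 =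
    segment ℝ (((-1, 0), 0) : Space) ((0, 1), 0) ∪ segment ℝ (((0, 1), 0) : Space) ((1, 0), 0) := by
  rw [segment_eq_image', segment_eq_image']
  ext p
  constructor
  · rintro ⟨x, ⟨h1, h2⟩, rfl⟩
    rcases le_total x 0 with h | h
    · refine Or.inl ⟨x + 1, ⟨by linarith, by linarith⟩, ?_⟩
      ext <;> simp [abs_of_nonpos h]
      ring
    · refine Or.inr ⟨x, ⟨by linarith, by linarith⟩, ?_⟩
      ext <;> simp [abs_of_nonneg h]
      ring
  · rintro (⟨t, ⟨h1, h2⟩, rfl⟩ | ⟨t, ⟨h1, h2⟩, rfl⟩)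
    · refine ⟨-1 + t, ⟨by linarith, by linarith⟩, ?_⟩
      have : |(-1 + t)| = 1 - t := by rw [abs_of_nonpos (by linarith)]; ring
      ext <;> simp [this]
    · refine ⟨t, ⟨by linarith, by linarith⟩, ?_⟩
      ext <;> simp [abs_of_nonneg h1]
      ring

/-- Two sides of a triangle may be replaced by the third one. -/
theorem ambientIsotopic_triangle {a b c : Space} (h : normal a b c ≠ 0) {F : Set Space}
    (hF : AvoidsTriangle ((frame h).symm '' F)) :
    AmbientIsotopic (segment ℝ a b ∪ segment ℝ b c ∪ F) (segment ℝ a c ∪ F) := by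
  obtain ⟨ε, hd, hε⟩ := (hF.and self_mem_nhdsWithin).exists
  have := (ambientIsotopic_corner hε hd).image (frame h)
  rw [image_union, image_union, roof_eq_segments, base_eq_segment, image_union] at this
  simpa only [frame_image_segment, frame_left, frame_top, frame_right, image_image,
    Homeomorph.apply_symm_apply, image_id'] using this

theorem AvoidsTriangle.frame_of_isCompact {a b c : Space} (h : normal a b c ≠ 0) {F : Set Space}
    (hF : IsCompact F) (hd : ∀ α β γ : ℝ, 0 ≤ α → 0 ≤ β → 0 ≤ γ → α + β + γ = 1 →
      α • a + β • b + γ • c ∉ F) : AvoidsTriangle ((frame h).symm '' F) := by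
  refine AvoidsTriangle.of_isCompact (hF.image (frame h).symm.continuous) ?_
  rintro _ ⟨p, hp, rfl⟩ ⟨h1, h2, h3⟩
  set q := (frame h).symm p with hq
  have h4 := neg_abs_le q.1.1
  have h5 := le_abs_self q.1.1
  refine hd ((1 - q.1.1 - q.1.2) / 2) q.1.2 ((1 + q.1.1 - q.1.2) / 2) (by linarith) h2
    (by linarith) (by ring) ?_
  have : p = frame h q := by rw [hq, Homeomorph.apply_symm_apply]
  rw [this, frame_apply, frameLin_apply, h1] at hp
  convert hp using 1
  module

theorem AvoidsTriangle.frame_segment_left {a b c p : Space} (h : normal a b c ≠ 0)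
    (hp : vol a b c p ≠ 0 ∨ ∃ r : ℝ, 0 ≤ r ∧ p = a - r • (c - a)) :
    AvoidsTriangle ((frame h).symm '' segment ℝ a p) := by
  obtain ⟨q, rfl⟩ := (frame h).surjective p
  have hs : (frame h).symm '' segment ℝ a (frame h q) = segment ℝ ((-1, 0), 0) q := by
    have : segment ℝ a (frame h q) = frame h '' segment ℝ ((-1, 0), 0) q := by
      rw [frame_image_segment, frame_left]
    rw [this, image_image]
    simp
  rw [hs]
  apply avoidsTriangle_segment_left
  rcases hp with hp | ⟨r, hr, hp⟩
  · right
    rw [vol_frame] at hp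
    exact left_ne_zero_of_mul hp
  · left
    have : q = ((-1 - 2 * r, 0), 0) := by
      apply (frame h).injective
      rw [hp, frame_apply, frameLin_apply]
      module
    rw [this]
    simp
    linarith

theorem AvoidsTriangle.frame_segment_right {a b c p : Space} (h : normal a b c ≠ 0)
    (hp : vol a b c p ≠ 0 ∨ ∃ r : ℝ, 0 ≤ r ∧ p = c + r • (c - a)) :
    AvoidsTriangle ((frame h).symm '' segment ℝ c p) := by
  obtain ⟨q, rfl⟩ := (frame h).surjective p
  have hs : (frame h).symm '' segment ℝ c (frame h q) = segment ℝ ((1, 0), 0) q := by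
    have : segment ℝ c (frame h q) = frame h '' segment ℝ ((1, 0), 0) q := by
      rw [frame_image_segment, frame_right]
    rw [this, image_image]
    simp
  rw [hs]
  apply avoidsTriangle_segment_right
  rcases hp with hp | ⟨r, hr, hp⟩
  · right
    rw [vol_frame] at hp
    exact left_ne_zero_of_mul hp
  · left
    have : q = ((1 + 2 * r, 0), 0) := by
      apply (frame h).injective
      rw [hp, frame_apply, frameLin_apply]
      module
    rw [this]
    simp
    linarith

/-- A segment misses a triangle if its ends lie on one side of the plane of the triangle, or if two
edges of the triangle wind around the line of the segment in different directions. -/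
def MissesTriangle {R : Type*} [CommRing R] [LinearOrder R] (a b c p q : (R × R) × R) : Prop :=
  (0 < vol a b c p ∧ 0 < vol a b c q) ∨ (vol a b c p < 0 ∧ vol a b c q < 0) ∨
  (0 < vol p q a b ∧ vol p q b c < 0) ∨ (vol p q a b < 0 ∧ 0 < vol p q b c) ∨
  (0 < vol p q b c ∧ vol p q c a < 0) ∨ (vol p q b c < 0 ∧ 0 < vol p q c a) ∨
  (0 < vol p q c a ∧ vol p q a b < 0) ∨ (vol p q c a < 0 ∧ 0 < vol p q a b)

theorem MissesTriangle.notMem_segment {a b c p q : Space} (h : MissesTriangle a b c p q)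
    {α β γ : ℝ} (hα : 0 ≤ α) (hβ : 0 ≤ β) (hγ : 0 ≤ γ) (hs : α + β + γ = 1) :
    α • a + β • b + γ • c ∉ segment ℝ p q := by
  intro hm
  rw [segment_eq_image'] at hm
  obtain ⟨t, ⟨ht0, ht1⟩, ht⟩ := hm
  obtain rfl : α = 1 - β - γ := by linarith
  have e1 := congrArg (fun q : Space => q.1.1) ht
  have e2 := congrArg (fun q : Space => q.1.2) ht
  have e3 := congrArg (fun q : Space => q.2) ht
  simp only [Prod.fst_add, Prod.snd_add, Prod.smul_fst,
    Prod.smul_snd, Prod.fst_sub, Prod.snd_sub, smul_eq_mul] at e1 e2 e3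
  have hv : (1 - t) * vol a b c p + t * vol a b c q = 0 := by
    simp only [vol, dot, normal, cross, Prod.fst_sub, Prod.snd_sub]
    linear_combination ((b.1.2 - a.1.2) * (c.2 - a.2) - (b.2 - a.2) * (c.1.2 - a.1.2)) * e1 +
      ((b.2 - a.2) * (c.1.1 - a.1.1) - (b.1.1 - a.1.1) * (c.2 - a.2)) * e2 +
      ((b.1.1 - a.1.1) * (c.1.2 - a.1.2) - (b.1.2 - a.1.2) * (c.1.1 - a.1.1)) * e3
  obtain ⟨α, hα'⟩ : ∃ α, α = 1 - β - γ := ⟨_, rfl⟩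
  rw [← hα'] at hα
  have ha : γ * vol p q c a - β * vol p q a b = 0 := by
    simp only [vol, dot, normal, cross, Prod.fst_sub, Prod.snd_sub]
    linear_combination -((a.1.2 - p.1.2) * (q.2 - p.2) - (a.2 - p.2) * (q.1.2 - p.1.2)) * e1 -
      ((a.2 - p.2) * (q.1.1 - p.1.1) - (a.1.1 - p.1.1) * (q.2 - p.2)) * e2 -
      ((a.1.1 - p.1.1) * (q.1.2 - p.1.2) - (a.1.2 - p.1.2) * (q.1.1 - p.1.1)) * e3
  have hb : (1 - β - γ) * vol p q a b - γ * vol p q b c = 0 := by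
    simp only [vol, dot, normal, cross, Prod.fst_sub, Prod.snd_sub]
    linear_combination -((b.1.2 - p.1.2) * (q.2 - p.2) - (b.2 - p.2) * (q.1.2 - p.1.2)) * e1 -
      ((b.2 - p.2) * (q.1.1 - p.1.1) - (b.1.1 - p.1.1) * (q.2 - p.2)) * e2 -
      ((b.1.1 - p.1.1) * (q.1.2 - p.1.2) - (b.1.2 - p.1.2) * (q.1.1 - p.1.1)) * e3
  have hc : β * vol p q b c - (1 - β - γ) * vol p q c a = 0 := by
    simp only [vol, dot, normal, cross, Prod.fst_sub, Prod.snd_sub]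
    linear_combination -((c.1.2 - p.1.2) * (q.2 - p.2) - (c.2 - p.2) * (q.1.2 - p.1.2)) * e1 -
      ((c.2 - p.2) * (q.1.1 - p.1.1) - (c.1.1 - p.1.1) * (q.2 - p.2)) * e2 -
      ((c.1.1 - p.1.1) * (q.1.2 - p.1.2) - (c.1.2 - p.1.2) * (q.1.1 - p.1.1)) * e3
  rw [← hα'] at hb hc
  have hsum : α + β + γ = 1 := by linarith
  clear hα' e1 e2 e3 ht hs
  have opp : ∀ {x y u w : ℝ}, 0 ≤ x → 0 ≤ y → x * u - y * w = 0 → 0 < u → w < 0 →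
      x = 0 ∧ y = 0 := by
    intro x y u w hx hy he hu hw
    have h1 : 0 ≤ x * u := mul_nonneg hx hu.le
    have h2 : y * w ≤ 0 := mul_nonpos_of_nonneg_of_nonpos hy hw.le
    have h3 : x * u = 0 := by linarith
    have h4 : y * w = 0 := by linarith
    exact ⟨(mul_eq_zero.1 h3).resolve_right hu.ne', (mul_eq_zero.1 h4).resolve_right hw.ne⟩
  have neg : ∀ {x y u w : ℝ}, x * u - y * w = 0 → y * w - x * u = 0 := fun h => by linarith
  unfold MissesTriangle at h
  generalize vol p q a b = u at *
  generalize vol p q b c = v at *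
  generalize vol p q c a = w at *
  rcases h with h | h | h | h | h | h | h | h
  · nlinarith [mul_nonneg (sub_nonneg.2 ht1) h.1.le, mul_nonneg ht0 h.2.le]
  · nlinarith [mul_nonneg (sub_nonneg.2 ht1) (neg_nonneg.2 h.1.le),
      mul_nonneg ht0 (neg_nonneg.2 h.2.le)]
  · obtain ⟨rfl, rfl⟩ := opp hα hγ hb h.1 h.2
    obtain rfl : β = 1 := by linarith
    linarith [h.1]
  · obtain ⟨rfl, rfl⟩ := opp hγ hα (neg hb) h.2 h.1
    obtain rfl : β = 1 := by linarith
    linarith [h.1]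
  · obtain ⟨rfl, rfl⟩ := opp hβ hα hc h.1 h.2
    obtain rfl : γ = 1 := by linarith
    linarith [h.1]
  · obtain ⟨rfl, rfl⟩ := opp hα hβ (neg hc) h.2 h.1
    obtain rfl : γ = 1 := by linarith
    linarith [h.1]
  · obtain ⟨rfl, rfl⟩ := opp hγ hβ ha h.1 h.2
    obtain rfl : α = 1 := by linarith
    linarith [h.1]
  · obtain ⟨rfl, rfl⟩ := opp hβ hγ (neg ha) h.2 h.1
    obtain rfl : α = 1 := by linarith
    linarith [h.1]

/-! ### Certified sequences of triangle moves -/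

/-- A point of the integer lattice, as a point of space. -/
def toSpace (v : (ℤ × ℤ) × ℤ) : Space := ((v.1.1, v.1.2), v.2)

theorem normal_toSpace (a b c : (ℤ × ℤ) × ℤ) :
    normal (toSpace a) (toSpace b) (toSpace c) = toSpace (normal a b c) := by
  simp [normal, cross, toSpace]

theorem vol_toSpace (a b c d : (ℤ × ℤ) × ℤ) :
    vol (toSpace a) (toSpace b) (toSpace c) (toSpace d) = (vol a b c d : ℤ) := by
  simp [vol, dot, normal, cross, toSpace]

theorem MissesTriangle.toSpace {a b c p q : (ℤ × ℤ) × ℤ} (h : MissesTriangle a b c p q) :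
    MissesTriangle (toSpace a) (toSpace b) (toSpace c) (toSpace p) (toSpace q) := by
  unfold MissesTriangle at *
  simp only [vol_toSpace]
  exact_mod_cast h

instance (a b c p q : (ℤ × ℤ) × ℤ) : Decidable (MissesTriangle a b c p q) := by
  unfold MissesTriangle
  infer_instance

/-- The polygonal path with the given vertices. -/
def polyPath : List ((ℤ × ℤ) × ℤ) → Set Space
  | [] => ∅
  | [_] => ∅
  | a :: b :: L => segment ℝ (toSpace a) (toSpace b) ∪ polyPath (b :: L)

/-- The edges of the polygonal path with the given vertices. -/
def edges {α : Type*} (L : List α) : List (α × α) := L.zip L.tail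

theorem polyPath_eq_biUnion (L : List ((ℤ × ℤ) × ℤ)) :
    polyPath L = ⋃ e ∈ edges L, segment ℝ (toSpace e.1) (toSpace e.2) := by
  induction L with
  | nil => simp [polyPath, edges]
  | cons a L ih =>
    cases L with
    | nil => simp [polyPath, edges]
    | cons b L =>
      rw [polyPath, ih]
      simp [edges]

theorem isCompact_polyPath (L : List ((ℤ × ℤ) × ℤ)) : IsCompact (polyPath L) := by
  rw [polyPath_eq_biUnion]
  exact (List.finite_toSet _).isCompact_biUnion fun e _ => by
    rw [segment_eq_image']
    exact isCompact_Icc.image (by fun_prop)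

theorem polyPath_append (A : List ((ℤ × ℤ) × ℤ)) (p a : (ℤ × ℤ) × ℤ) (B : List ((ℤ × ℤ) × ℤ)) :
    polyPath (A ++ p :: a :: B) =
      polyPath (A ++ [p]) ∪ segment ℝ (toSpace p) (toSpace a) ∪ polyPath (a :: B) := by
  induction A with
  | nil => simp [polyPath]
  | cons x A ih =>
    cases A with
    | nil => simp [polyPath, union_assoc]
    | cons y A =>
      simp only [List.cons_append, polyPath] at ih ⊢
      rw [ih]
      simp only [union_assoc]

/-- The open cylinder over the rectangle `|x| < R`, `|y| < W`. -/
def cylinder (R W : ℤ) : Set Space := {p | |p.1.1| < R ∧ |p.1.2| < W}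

/-- In the polygonal path `… A … p a b c q … B …` the corner `b` can be cut off, or created, inside the
cylinder `|x| < R`, `|y| < W`, by a move across the triangle `a b c`, which the other edges of the
path do not meet. -/
def CanCut (R W : ℤ) (A : List ((ℤ × ℤ) × ℤ)) (p a b c q : (ℤ × ℤ) × ℤ)
    (B : List ((ℤ × ℤ) × ℤ)) : Prop :=
  normal a b c ≠ 0 ∧ (∀ v ∈ [a, b, c], |v.1.1| < R ∧ |v.1.2| < W) ∧
  (vol a b c p ≠ 0 ∨ p.1.1 ≤ a.1.1 ∧ a.1.1 < c.1.1 ∧ p.1.2 = a.1.2 ∧ p.2 = a.2 ∧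
    c.1.2 = a.1.2 ∧ c.2 = a.2) ∧
  (vol a b c q ≠ 0 ∨ c.1.1 ≤ q.1.1 ∧ a.1.1 < c.1.1 ∧ q.1.2 = c.1.2 ∧ q.2 = c.2 ∧
    c.1.2 = a.1.2 ∧ c.2 = a.2) ∧
  (∀ e ∈ edges (A ++ [p]), MissesTriangle a b c e.1 e.2) ∧
  ∀ e ∈ edges (q :: B), MissesTriangle a b c e.1 e.2

instance (R W : ℤ) (A : List ((ℤ × ℤ) × ℤ)) (p a b c q : (ℤ × ℤ) × ℤ)
    (B : List ((ℤ × ℤ) × ℤ)) : Decidable (CanCut R W A p a b c q B) := by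
  unfold CanCut
  infer_instance

theorem convex_cylinder (R W : ℤ) : Convex ℝ (cylinder R W) := by
  have : cylinder R W = (fun p : Space => p.1.1) ⁻¹' Ioo (-(R : ℝ)) R ∩
      (fun p : Space => p.1.2) ⁻¹' Ioo (-(W : ℝ)) W := by
    ext p
    simp [cylinder, abs_lt]
  rw [this]
  exact ((convex_Ioo _ _).linear_preimage (LinearMap.fst ℝ ℝ ℝ ∘ₗ LinearMap.fst ℝ Plane ℝ)).inter
    ((convex_Ioo _ _).linear_preimage (LinearMap.snd ℝ ℝ ℝ ∘ₗ LinearMap.fst ℝ Plane ℝ))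

theorem toSpace_mem_cylinder {R W : ℤ} {v : (ℤ × ℤ) × ℤ} (h : |v.1.1| < R ∧ |v.1.2| < W) :
    toSpace v ∈ cylinder R W := by
  unfold toSpace cylinder
  simp only [Set.mem_ofPred_eq]
  exact_mod_cast h

theorem polyPath_avoids {a b c : (ℤ × ℤ) × ℤ} {L : List ((ℤ × ℤ) × ℤ)}
    (h : ∀ e ∈ edges L, MissesTriangle a b c e.1 e.2) {α β γ : ℝ} (hα : 0 ≤ α) (hβ : 0 ≤ β)
    (hγ : 0 ≤ γ) (hs : α + β + γ = 1) :
    α • toSpace a + β • toSpace b + γ • toSpace c ∉ polyPath L := by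
  rw [polyPath_eq_biUnion]
  simp only [mem_iUnion, not_exists]
  exact fun e he => (h e he).toSpace.notMem_segment hα hβ hγ hs

theorem CanCut.ambientIsotopic {R W : ℤ} {A B : List ((ℤ × ℤ) × ℤ)} {p a b c q : (ℤ × ℤ) × ℤ}
    (h : CanCut R W A p a b c q B) {X : Set Space} (hX : IsCompact X)
    (hd : Disjoint X (cylinder R W)) :
    AmbientIsotopic (polyPath (A ++ p :: a :: b :: c :: q :: B) ∪ X)
      (polyPath (A ++ p :: a :: c :: q :: B) ∪ X) := by
  obtain ⟨hn, hbox, hp, hq, hA, hB⟩ := h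
  have hn' : normal (toSpace a) (toSpace b) (toSpace c) ≠ 0 := by
    rw [normal_toSpace]
    intro h0
    apply hn
    simp only [toSpace, Prod.ext_iff, Prod.fst_zero, Prod.snd_zero] at h0
    exact Prod.ext (Prod.ext (by exact_mod_cast h0.1.1) (by exact_mod_cast h0.1.2))
      (by exact_mod_cast h0.2)
  have hcyl : ∀ α β γ : ℝ, 0 ≤ α → 0 ≤ β → 0 ≤ γ → α + β + γ = 1 →
      α • toSpace a + β • toSpace b + γ • toSpace c ∈ cylinder R W := by
    intro α β γ hα hβ hγ hs
    have := (convex_cylinder R W).sum_mem (t := Finset.univ) (w := ![α, β, γ])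
      (z := ![toSpace a, toSpace b, toSpace c])
      (by intro i _; fin_cases i <;> assumption) (by simp [Fin.sum_univ_three, hs])
      (by intro i _; fin_cases i <;> exact toSpace_mem_cylinder (hbox _ (by simp)))
    simpa [Fin.sum_univ_three] using this
  have key := ambientIsotopic_triangle hn' (F := polyPath (A ++ [p]) ∪
    segment ℝ (toSpace a) (toSpace p) ∪ (segment ℝ (toSpace c) (toSpace q) ∪
    polyPath (q :: B) ∪ X)) (by
      simp only [image_union]
      refine ((AvoidsTriangle.frame_of_isCompact hn' (isCompact_polyPath _) ?_).union ?_).union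
        ((AvoidsTriangle.union ?_ (AvoidsTriangle.frame_of_isCompact hn' (isCompact_polyPath _)
          ?_)).union (AvoidsTriangle.frame_of_isCompact hn' hX ?_))
      · exact fun α β γ hα hβ hγ hs => polyPath_avoids hA hα hβ hγ hs
      · apply AvoidsTriangle.frame_segment_left
        rw [vol_toSpace]
        refine hp.imp (by exact_mod_cast id) ?_
        rintro ⟨h1, h2, h3, h4, h5, h6⟩
        have h1' : (p.1.1 : ℝ) ≤ a.1.1 := by exact_mod_cast h1
        have h2' : (0 : ℝ) < c.1.1 - a.1.1 := by
          rw [sub_pos]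
          exact_mod_cast h2
        refine ⟨(a.1.1 - p.1.1) / (c.1.1 - a.1.1), div_nonneg (by linarith) h2'.le, ?_⟩
        simp only [toSpace, h3, h4, h5, h6, Prod.mk_sub_mk, Prod.smul_mk, Prod.mk.injEq,
          smul_eq_mul, div_mul_cancel₀ _ h2'.ne']
        simp
      · apply AvoidsTriangle.frame_segment_right
        rw [vol_toSpace]
        refine hq.imp (by exact_mod_cast id) ?_
        rintro ⟨h1, h2, h3, h4, h5, h6⟩
        have h1' : (c.1.1 : ℝ) ≤ q.1.1 := by exact_mod_cast h1
        have h2' : (0 : ℝ) < c.1.1 - a.1.1 := by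
          rw [sub_pos]
          exact_mod_cast h2
        refine ⟨(q.1.1 - c.1.1) / (c.1.1 - a.1.1), div_nonneg (by linarith) h2'.le, ?_⟩
        simp only [toSpace, h3, h4, h5, h6, Prod.mk_sub_mk, Prod.smul_mk, Prod.mk.injEq,
          Prod.mk_add_mk, smul_eq_mul, div_mul_cancel₀ _ h2'.ne']
        simp
      · exact fun α β γ hα hβ hγ hs => polyPath_avoids hB hα hβ hγ hs
      · exact fun α β γ hα hβ hγ hs hm => hd.le_bot ⟨hm, hcyl α β γ hα hβ hγ hs⟩)
  convert key using 1
  · rw [polyPath_append]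
    simp only [polyPath, segment_symm ℝ (toSpace p)]
    ac_rfl
  · rw [polyPath_append]
    simp only [polyPath, segment_symm ℝ (toSpace p)]
    ac_rfl

/-- A list of instructions that change the vertex list of a path: `(n, none)` deletes the third
vertex after the first `n` ones, `(n, some b)` inserts `b` before it. -/
abbrev Script : Type := List (ℕ × Option ((ℤ × ℤ) × ℤ))

/-- The effect of a script on a vertex list, `none` if one of its moves is not admissible. -/
def Script.run (R W : ℤ) : Script → List ((ℤ × ℤ) × ℤ) → Option (List ((ℤ × ℤ) × ℤ))
  | [], L => some L
  | (n, none) :: s, L =>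
    match L.drop n with
    | p :: a :: b :: c :: q :: B =>
      if CanCut R W (L.take n) p a b c q B then
        Script.run R W s (L.take n ++ p :: a :: c :: q :: B) else none
    | _ => none
  | (n, some b) :: s, L =>
    match L.drop n with
    | p :: a :: c :: q :: B =>
      if CanCut R W (L.take n) p a b c q B then
        Script.run R W s (L.take n ++ p :: a :: b :: c :: q :: B) else none
    | _ => none

theorem Script.ambientIsotopic {R W : ℤ} {X : Set Space} (hX : IsCompact X)
    (hd : Disjoint X (cylinder R W)) (s : Script) {L L' : List ((ℤ × ℤ) × ℤ)}
    (h : s.run R W L = some L') : AmbientIsotopic (polyPath L ∪ X) (polyPath L' ∪ X) := by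
  induction s generalizing L with
  | nil =>
    simp only [Script.run, Option.some.injEq] at h
    exact h ▸ AmbientIsotopic.refl _
  | cons o s ih =>
    obtain ⟨n, _ | b⟩ := o
    · rw [Script.run] at h
      split at h
      · next p a b c q B hL =>
        split at h
        · next hc =>
          have := hc.ambientIsotopic hX hd
          rw [← hL, List.take_append_drop] at this
          exact this.trans (ih h)
        · cases h
      · cases h
    · rw [Script.run] at h
      split at h
      · next p a c q B hL =>
        split at h
        · next hc =>
          have := (hc.ambientIsotopic hX hd).symm
          rw [← hL, List.take_append_drop] at this
          exact this.trans (ih h)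
        · cases h
      · cases h

/-! ### The tangle -/

/-- The vertices of an unknotted path with a complicated projection whose sixth vertex is `m`. The
choice of `m` decides whether the two edges that meet in `m` pass across the edge from
`((-4, -33), -38)` to `((16, -32), -43)` in the projection. The first and the last edge lie in one
line, so that the path can take the place of a straight segment. -/
def tangle (m : (ℤ × ℤ) × ℤ) : List ((ℤ × ℤ) × ℤ) :=
  [((-124, 0), 0), ((-120, 0), 0), ((24, -28), -48), ((36, -40), 40), ((16, -41), 22), m,
   ((-4, -42), 3), ((-44, -44), -36), ((24, 12), -20), ((36, -32), -36), ((-40, -16), -28),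
   ((36, 4), -24), ((48, 44), -36), ((-48, -32), -28), ((-4, -33), -38), ((16, -32), -43),
   ((20, -32), -44), ((24, 24), -12), ((-12, -8), -28), ((120, 0), 0), ((124, 0), 0)]

/-- A script that straightens the tangle for both choices of the vertex `m`; the edges at `m` are
removed by its first moves. The vertices that it inserts make room for later deletions. -/
def straightening : Script :=
  [(2, none), (2, none), (2, none), (9, none), (9, none), (9, some ((-1, -83), -59)),
   (3, some ((4, -36), -31)), (9, some ((17, -44), -48)), (8, none), (8, some ((-2, 1), -23)),
   (7, none), (14, some ((34, 175), 112)), (7, some ((13, 115), -141)),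
   (7, some ((-83, -12), -11)), (9, some ((86, 44), 298)), (9, some ((39, -244), -266)),
   (6, none), (7, none), (7, none), (7, none), (7, none), (6, none), (11, none), (10, none),
   (9, none), (6, none), (7, none), (2, none), (2, none), (1, none), (0, none), (0, none),
   (0, none), (0, none), (0, none)]

theorem run_straightening (m : (ℤ × ℤ) × ℤ) (hm : m = ((6, -42), 12) ∨ m = ((6, -30), 12)) :
    straightening.run 124 512 (tangle m) =
      some [((-124, 0), 0), ((-120, 0), 0), ((120, 0), 0), ((124, 0), 0)] := by
  rcases hm with rfl | rfl <;> decide +kernel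

/-- The tangle can be straightened inside its box. -/
theorem ambientIsotopic_tangle {m : (ℤ × ℤ) × ℤ} (hm : m = ((6, -42), 12) ∨ m = ((6, -30), 12))
    {X : Set Space} (hX : IsCompact X) (hd : Disjoint X (cylinder 124 512)) :
    AmbientIsotopic (polyPath (tangle m) ∪ X) (segment ℝ ((-124, 0), 0) ((124, 0), 0) ∪ X) := by
  convert straightening.ambientIsotopic hX hd (run_straightening m hm) using 2
  simp only [polyPath, toSpace, union_empty]
  have hseg : ∀ x y : ℝ, segment ℝ (((x, 0), 0) : Space) ((y, 0), 0) =
      (fun s : ℝ => (((s, 0), 0) : Space)) '' segment ℝ x y := fun x y => by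
    have := image_segment ℝ ((LinearMap.inl ℝ Plane ℝ ∘ₗ LinearMap.inl ℝ ℝ ℝ).toAffineMap) x y
    exact this.symm
  push_cast
  simp only [hseg, ← image_union]
  congr 1
  rw [segment_eq_Icc (by norm_num), segment_eq_Icc (by norm_num), segment_eq_Icc (by norm_num),
    segment_eq_Icc (by norm_num), Icc_union_Icc_eq_Icc (by norm_num) (by norm_num),
    Icc_union_Icc_eq_Icc (by norm_num) (by norm_num)]

/-! ### Gauss words -/

theorem compl_coe_Icc {a b : ℝ} (hab : a < b) (hba : b < a + 1) :
    (((↑) : ℝ → S1) '' Icc a b)ᶜ = ((↑) : ℝ → S1) '' Ioo b (a + 1) := by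
  have ha : ((a + 1 : ℝ) : S1) = a := AddCircle.coe_add_period 1 a
  rw [← cIcc_coe hab hba, ← cIoo_coe hba (by linarith), ha, Set.compl_cIcc]

theorem isPreconnected_compl_coe_Icc {a b : ℝ} (hab : a < b) (hba : b < a + 1) :
    IsPreconnected (((↑) : ℝ → S1) '' Icc a b)ᶜ := by
  rw [compl_coe_Icc hab hba]
  exact isPreconnected_Ioo.image _ (AddCircle.continuous_mk' 1).continuousOn

theorem coe_injOn : InjOn ((↑) : ℝ → S1) (Ico 0 1) := by
  intro x hx y hy h
  have := AddCircle.coe_eq_coe_iff_of_mem_Ico (p := (1 : ℝ)) (a := 0) (x := x) (y := y)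
    (by simpa using hx) (by simpa using hy)
  exact this.1 h

/-- A point strictly between `u` and `v` and a point outside `[u, v]` are separated by `u`, `v`. -/
theorem not_joined_of_lt {u v x y : ℝ} (hu : 0 ≤ u) (hv : v < 1) (hy : y ∈ Ico (0 : ℝ) 1)
    (hux : u < x) (hxv : x < v) (hyuv : y < u ∨ v < y) :
    ¬ Joined (u : S1) (v : S1) (x : S1) (y : S1) := by
  rintro ⟨C, hC, hxC, hyC, huC, hvC⟩
  have ho : IsOpenMap ((↑) : ℝ → S1) := QuotientAddGroup.isOpenMap_coe
  have huv : u < v := hux.trans hxv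
  obtain ⟨w, hwC, hw1, hw2⟩ := hC (((↑) : ℝ → S1) '' Ioo u v) ((((↑) : ℝ → S1) '' Icc u v)ᶜ)
    (ho _ isOpen_Ioo) (by
      rw [compl_coe_Icc huv (by linarith)]
      exact ho _ isOpen_Ioo) (by
      intro w hw
      by_cases hwI : w ∈ ((↑) : ℝ → S1) '' Icc u v
      · obtain ⟨z, hz, rfl⟩ := hwI
        left
        refine ⟨z, ⟨lt_of_le_of_ne hz.1 ?_, lt_of_le_of_ne hz.2 ?_⟩, rfl⟩
        · rintro rfl
          exact huC hw
        · rintro rfl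
          exact hvC hw
      · exact Or.inr hwI) ⟨x, hxC, x, ⟨hux, hxv⟩, rfl⟩ (by
      refine ⟨y, hyC, ?_⟩
      rintro ⟨z, hz, hzy⟩
      obtain rfl := coe_injOn ⟨hu.trans hz.1, hz.2.trans_lt hv⟩ hy hzy
      rcases hyuv with h | h
      · exact absurd hz.1 (not_le.2 h)
      · exact absurd hz.2 (not_le.2 h))
  exact hw2 (image_mono Ioo_subset_Icc_self hw1)

theorem Joined.swap {m m' a b : S1} (h : Joined m m' a b) : Joined m' m a b := by
  obtain ⟨C, hC, ha, hb, hm, hm'⟩ := h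
  exact ⟨C, hC, ha, hb, hm', hm⟩

/-- The position `x` lies strictly between `i` and `j`, and `y` lies outside. -/
def Separated (i j x y : ℕ) : Prop :=
  (i < x ∧ x < j ∧ (y < i ∨ j < y)) ∨ (j < x ∧ x < i ∧ (y < j ∨ i < y))

instance (i j x y : ℕ) : Decidable (Separated i j x y) := by
  unfold Separated
  infer_instance

/-- In a word whose letters are paired by `τ`, the pairs of the positions `i` and `j` interlace. -/
def Linked (τ : ℕ → ℕ) (i j : ℕ) : Prop :=
  Separated i (τ i) j (τ j) ∨ Separated i (τ i) (τ j) j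

instance (τ : ℕ → ℕ) (i j : ℕ) : Decidable (Linked τ i j) := by
  unfold Linked
  infer_instance

theorem Separated.symm {i j x y : ℕ} (h : Separated i j x y) :
    Separated x y i j ∨ Separated x y j i := by
  unfold Separated at *
  omega

theorem Linked.symm {τ : ℕ → ℕ} {i j : ℕ} (h : Linked τ i j) : Linked τ j i := by
  unfold Linked Separated at *
  omega

/-- Two positions of a cyclic word of length `n` are equal or consecutive. -/
def CyclicAdj (n i j : ℕ) : Prop :=
  i = j ∨ i + 1 = j ∨ j + 1 = i ∨ (i = 0 ∧ j + 1 = n) ∨ (j = 0 ∧ i + 1 = n)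

instance (n i j : ℕ) : Decidable (CyclicAdj n i j) := by
  unfold CyclicAdj
  infer_instance

theorem exists_separated {n i j : ℕ} (hi : i < n) (hj : j < n) (h : ¬ CyclicAdj n i j) :
    ∃ x < n, ∃ y < n, Separated i j x y := by
  unfold CyclicAdj at h
  unfold Separated
  rcases lt_or_gt_of_ne (fun hij : i = j => h (Or.inl hij)) with hij | hij
  · by_cases hn : j + 1 = n
    · exact ⟨i + 1, by omega, 0, by omega, by omega⟩
    · exact ⟨i + 1, by omega, j + 1, by omega, by omega⟩
  · by_cases hn : i + 1 = n
    · exact ⟨j + 1, by omega, 0, by omega, by omega⟩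
    · exact ⟨j + 1, by omega, i + 1, by omega, by omega⟩

/-- The positions that are paired or linked with a position of the list `L`. -/
def grow (n : ℕ) (τ : ℕ → ℕ) (L : List ℕ) : List ℕ :=
  (List.range n).filter fun k => ∃ j ∈ L, k = τ j ∨ Linked τ j k

/-- The interlacement graph of the word is connected. -/
def WordConnected (n : ℕ) (τ : ℕ → ℕ) : Prop :=
  (∀ i < n, τ i < n ∧ τ i ≠ i ∧ τ (τ i) = i) ∧ ∃ r < 10, (grow n τ)^[r] [0] = List.range n

instance (n : ℕ) (τ : ℕ → ℕ) : Decidable (WordConnected n τ) := by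
  unfold WordConnected
  infer_instance

/-- In a connected word, a set of positions that is closed under linking and pairing is everything. -/
theorem WordConnected.forall_of_exists {n : ℕ} {τ : ℕ → ℕ} (h : WordConnected n τ) {P : ℕ → Prop}
    (hτ : ∀ i < n, P i → P (τ i)) (hP : ∀ i < n, ∀ j < n, P i → Linked τ i j → P j)
    (hne : ∃ k < n, P k) : ∀ k < n, P k := by
  obtain ⟨hinv, r, -, hr⟩ := h
  have key : ∀ Q : ℕ → Prop, (∀ i < n, Q i → Q (τ i)) →
      (∀ i < n, ∀ j < n, Q i → Linked τ i j → Q j) → Q 0 → ∀ k < n, Q k := by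
    intro Q h1 h2 h0 k hk
    have : ∀ r, ∀ k ∈ (grow n τ)^[r] [0], k < n ∧ Q k := by
      intro r
      induction r with
      | zero =>
        intro k hk0
        rw [Function.iterate_zero, id, List.mem_singleton] at hk0
        subst hk0
        exact ⟨by omega, h0⟩
      | succ r ih =>
        intro k hk'
        rw [Function.iterate_succ_apply', grow, List.mem_filter] at hk'
        obtain ⟨hkn, hk'⟩ := hk'
        have hkn' := List.mem_range.1 hkn
        obtain ⟨j, hj, hkj⟩ := of_decide_eq_true hk'
        obtain ⟨hjn, hj⟩ := ih j hj
        rcases hkj with rfl | hkj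
        · exact ⟨hkn', h1 _ hjn hj⟩
        · exact ⟨hkn', h2 _ hjn _ hkn' hj hkj⟩
    exact (this r k (hr ▸ List.mem_range.2 hk)).2
  by_cases h0 : P 0
  · exact key P hτ hP h0
  · obtain ⟨k, hk, hPk⟩ := hne
    refine absurd hPk (key (fun k => ¬ P k) ?_ ?_ h0 k hk)
    · intro i hi hPi h'
      have := hτ _ (hinv i hi).1 h'
      rw [(hinv i hi).2.2] at this
      exact hPi this
    · exact fun i hi j hj hPi hl h' => hPi (hP j hj i hi h' hl.symm)

/-- The word with pairing `τ` and over letters `up` has no isolated pair, no bigon, and no layered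
triangle. -/
def WordReduced (n : ℕ) (τ : ℕ → ℕ) (up : ℕ → Bool) : Prop :=
  (∀ i < n, ∃ x < n, ∃ y < n, Separated i (τ i) x y) ∧
  (∀ i < n, ∀ j < n, CyclicAdj n i j ∧ j ≠ i ∧ j ≠ τ i → ¬ CyclicAdj n (τ i) (τ j)) ∧
  ∀ i < n, ∀ j < n, CyclicAdj n i j ∧ i ≠ j ∧ up i = true ∧ up j = true →
    ∀ k < n, CyclicAdj n (τ i) k ∧ up k = true ∧ i ≠ k ∧ j ≠ k → ¬ CyclicAdj n (τ j) (τ k)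

set_option synthInstance.maxSize 1000 in
instance (n : ℕ) (τ : ℕ → ℕ) (up : ℕ → Bool) : Decidable (WordReduced n τ up) := by
  unfold WordReduced
  infer_instance

/-- The chords of a Gauss diagram that meet the interval `[a, b]` are read off from a word: its letters
are at the parameters `pos i`, and the letters `i` and `τ i` are the ends of a chord. -/
structure HasWord (ov : S1 → S1 → Prop) (a b : ℝ) (n : ℕ) (τ : ℕ → ℕ) (up : ℕ → Bool)
    (pos : ℕ → ℝ) : Prop where
  nonneg : 0 ≤ a
  lt : a < b
  lt_one : b < 1
  pos_mem : ∀ i < n, pos i ∈ Icc a b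
  pos_lt : ∀ i < n, ∀ j < n, i < j → pos i < pos j
  chord : ∀ i < n, Chord ov (pos i) (pos (τ i))
  exists_of_chord : ∀ s t, Chord ov s t → s ∈ ((↑) : ℝ → S1) '' Icc a b →
    ∃ i < n, s = pos i ∧ t = pos (τ i)
  over_of : ∀ i < n, ov (pos i) (pos (τ i)) → up i = true

section HasWord

variable {ov : S1 → S1 → Prop} {a b : ℝ} {n : ℕ} {τ : ℕ → ℕ} {up : ℕ → Bool} {pos : ℕ → ℝ}

/-- The set of the parameters of the letters. -/
def letterSet (n : ℕ) (pos : ℕ → ℝ) : Set S1 := {s | ∃ i < n, s = pos i}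

theorem HasWord.pos_mem_Ico (h : HasWord ov a b n τ up pos) {i : ℕ} (hi : i < n) :
    pos i ∈ Ico (0 : ℝ) 1 :=
  ⟨h.nonneg.trans (h.pos_mem i hi).1, (h.pos_mem i hi).2.trans_lt h.lt_one⟩

theorem HasWord.pos_inj (h : HasWord ov a b n τ up pos) {i j : ℕ} (hi : i < n) (hj : j < n)
    (hij : (pos i : S1) = pos j) : i = j := by
  have := coe_injOn (h.pos_mem_Ico hi) (h.pos_mem_Ico hj) hij
  rcases lt_trichotomy i j with h' | h' | h'
  · exact absurd this (h.pos_lt i hi j hj h').ne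
  · exact h'
  · exact absurd this (h.pos_lt j hj i hi h').ne'

theorem HasWord.not_joined (h : HasWord ov a b n τ up pos) {i j x y : ℕ} (hi : i < n)
    (hj : j < n) (hx : x < n) (hy : y < n) (hs : Separated i j x y) :
    ¬ Joined (pos i : S1) (pos j) (pos x) (pos y) := by
  have hl := h.pos_lt
  rcases hs with ⟨h1, h2, h3⟩ | ⟨h1, h2, h3⟩
  · exact not_joined_of_lt (h.pos_mem_Ico hi).1 (h.pos_mem_Ico hj).2 (h.pos_mem_Ico hy)
      (hl _ hi _ hx h1) (hl _ hx _ hj h2) (h3.imp (hl _ hy _ hi) (hl _ hj _ hy))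
  · exact fun h' => not_joined_of_lt (h.pos_mem_Ico hj).1 (h.pos_mem_Ico hi).2 (h.pos_mem_Ico hy)
      (hl _ hj _ hx h1) (hl _ hx _ hi h2) (h3.imp (hl _ hy _ hj) (hl _ hi _ hy)) h'.swap

theorem HasWord.not_joined' (h : HasWord ov a b n τ up pos) {i j x y : ℕ} (hi : i < n)
    (hj : j < n) (hx : x < n) (hy : y < n) (hs : Separated i j x y) :
    ¬ Joined (pos x : S1) (pos y) (pos i) (pos j) := by
  rcases hs.symm with hs | hs
  · exact h.not_joined hx hy hi hj hs
  · exact fun h' => h.not_joined hx hy hj hi hs h'.symm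

theorem HasWord.cyclicAdj (h : HasWord ov a b n τ up pos) {i j : ℕ} (hi : i < n) (hj : j < n)
    (hij : Adj (letterSet n pos) (pos i) (pos j)) : CyclicAdj n i j := by
  by_contra hc
  obtain ⟨x, hx, y, hy, hs⟩ := exists_separated hi hj hc
  have hne : x ≠ i ∧ x ≠ j ∧ y ≠ i ∧ y ≠ j := by
    unfold Separated at hs
    omega
  exact h.not_joined' hi hj hx hy hs (hij _ ⟨x, hx, rfl⟩ _ ⟨y, hy, rfl⟩
    (fun e => hne.1 (h.pos_inj hx hi e)) (fun e => hne.2.1 (h.pos_inj hx hj e))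
    (fun e => hne.2.2.1 (h.pos_inj hy hi e)) (fun e => hne.2.2.2 (h.pos_inj hy hj e)))

theorem HasWord.adj_succ (h : HasWord ov a b n τ up pos) {i : ℕ} (hi : i + 1 < n) :
    Adj (letterSet n pos) (pos i) (pos (i + 1)) := by
  have hl := h.pos_lt
  have hlt := hl i (by omega) (i + 1) hi (by omega)
  have key : ∀ m ∈ letterSet n pos, m ≠ pos i → m ≠ pos (i + 1) →
      m ∉ ((↑) : ℝ → S1) '' Icc (pos i) (pos (i + 1)) := by
    rintro _ ⟨j, hj, rfl⟩ h1 h2 ⟨z, hz, hzj⟩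
    have hi0 := h.pos_mem_Ico (i := i) (by omega)
    have hi1 := h.pos_mem_Ico hi
    obtain rfl := coe_injOn ⟨hi0.1.trans hz.1, hz.2.trans_lt hi1.2⟩ (h.pos_mem_Ico hj) hzj
    rcases lt_trichotomy j i with hji | rfl | hji
    · exact absurd hz.1 (not_le.2 (hl j hj i (by omega) hji))
    · exact h1 rfl
    · rcases Nat.lt_or_ge (i + 1) j with hij | hij
      · exact absurd hz.2 (not_le.2 (hl (i + 1) hi j hj hij))
      · obtain rfl : j = i + 1 := by omega
        exact h2 rfl
  intro m hm m' hm' h1 h2 h3 h4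
  exact joined_of_isPreconnected
    (isPreconnected_Icc.image _ (AddCircle.continuous_mk' 1).continuousOn)
    ⟨_, ⟨le_rfl, hlt.le⟩, rfl⟩ ⟨_, ⟨hlt.le, le_rfl⟩, rfl⟩ (key m hm h1 h2) (key m' hm' h3 h4)

theorem HasWord.letter_mem (h : HasWord ov a b n τ up pos) {s : S1} (hs : s ∈ letterSet n pos) :
    s ∈ ((↑) : ℝ → S1) '' Icc a b := by
  obtain ⟨i, hi, rfl⟩ := hs
  exact ⟨_, h.pos_mem i hi, rfl⟩

theorem HasWord.notMem_of_chord (h : HasWord ov a b n τ up pos) (hw : WordConnected n τ)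
    {s t : S1} (hst : Chord ov s t) (hs : s ∉ ((↑) : ℝ → S1) '' Icc a b) :
    t ∉ ((↑) : ℝ → S1) '' Icc a b := by
  intro ht
  obtain ⟨i, hi, rfl, rfl⟩ := h.exists_of_chord t s hst.symm ht
  exact hs ⟨_, h.pos_mem _ (hw.1 i hi).1, rfl⟩

theorem HasWord.eq_of_chord (h : HasWord ov a b n τ up pos) {i : ℕ} (hi : i < n) {t : S1}
    (hc : Chord ov (pos i) t) : t = pos (τ i) := by
  obtain ⟨j, hj, h1, h2⟩ := h.exists_of_chord _ _ hc ⟨_, h.pos_mem i hi, rfl⟩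
  rw [h.pos_inj hi hj h1, h2]

/-- A set of letters that is closed under chords and not linked with its complement is everything. -/
theorem HasWord.eq_letterSet (h : HasWord ov a b n τ up pos) (hw : WordConnected n τ) {S : Set S1}
    (hS : S ⊆ letterSet n pos) (hne : S.Nonempty) (hc : ∀ s t, Chord ov s t → s ∈ S → t ∈ S)
    (hj : ∀ i < n, ∀ j < n, (pos i : S1) ∈ S → (pos j : S1) ∉ S →
      Joined (pos i : S1) (pos (τ i)) (pos j) (pos (τ j))) : S = letterSet n pos := by
  refine hS.antisymm ?_
  have := hw.forall_of_exists (P := fun i => (pos i : S1) ∈ S)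
    (fun i hi hi' => hc _ _ (h.chord i hi) hi') ?_ ?_
  · rintro _ ⟨i, hi, rfl⟩
    exact this i hi
  · intro i hi j hj' hi' hl
    by_contra hjS
    have hJ := hj i hi j hj' hi' hjS
    have h1 := (hw.1 i hi).1
    have h2 := (hw.1 j hj').1
    rcases hl with hl | hl
    · exact h.not_joined hi h1 hj' h2 hl hJ
    · exact h.not_joined hi h1 h2 hj' hl hJ.symm
  · obtain ⟨s, hs⟩ := hne
    obtain ⟨i, hi, rfl⟩ := hS hs
    exact ⟨i, hi, hs⟩

/-- The letters of a reduced connected word form a rigid set. -/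
theorem HasWord.rigid (h : HasWord ov a b n τ up pos) (hn : 0 < n) (hw : WordConnected n τ)
    (hr : WordReduced n τ up) : Rigid ov (letterSet n pos) := by
  have hτ := fun i hi => (hw.1 i hi).1
  obtain ⟨hr1, hr2, hr3⟩ := hr
  refine ⟨⟨_, 0, hn, rfl⟩, ?_, ?_, ?_, ?_, ?_, ?_, ?_⟩
  · rintro _ ⟨i, hi, rfl⟩
    exact ⟨_, h.chord i hi⟩
  · rintro _ t hc ⟨i, hi, rfl⟩
    exact ⟨_, hτ i hi, h.eq_of_chord hi hc⟩
  · intro s t hc hs m hm m' hm'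
    have hsJ : s ∉ ((↑) : ℝ → S1) '' Icc a b := fun hsJ => by
      obtain ⟨i, hi, rfl, -⟩ := h.exists_of_chord s t hc hsJ
      exact hs ⟨i, hi, rfl⟩
    exact joined_of_isPreconnected
      (isPreconnected_compl_coe_Icc h.lt (by linarith [h.lt_one, h.nonneg])) hsJ
      (h.notMem_of_chord hw hc hsJ) (fun hm' => hm' (h.letter_mem hm))
      (fun hm'' => hm'' (h.letter_mem hm'))
  · rintro _ t hc ⟨i, hi, rfl⟩
    obtain rfl := h.eq_of_chord hi hc
    obtain ⟨x, hx, y, hy, hs⟩ := hr1 i hi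
    have hne : x ≠ i ∧ x ≠ τ i ∧ y ≠ i ∧ y ≠ τ i := by
      unfold Separated at hs
      omega
    exact ⟨_, ⟨x, hx, rfl⟩, _, ⟨y, hy, rfl⟩, fun e => hne.1 (h.pos_inj hx hi e),
      fun e => hne.2.1 (h.pos_inj hx (hτ i hi) e), fun e => hne.2.2.1 (h.pos_inj hy hi e),
      fun e => hne.2.2.2 (h.pos_inj hy (hτ i hi) e), h.not_joined' hi (hτ i hi) hx hy hs⟩
  · rintro _ t _ t' hc hc' ⟨i, hi, rfl⟩ ⟨j, hj, rfl⟩ h1 h2 hA hA'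
    obtain rfl := h.eq_of_chord hi hc
    obtain rfl := h.eq_of_chord hj hc'
    exact hr2 i hi j hj ⟨h.cyclicAdj hi hj hA, fun e => h1 (by rw [e]), fun e => h2 (by rw [e])⟩
      (h.cyclicAdj (hτ i hi) (hτ j hj) hA')
  · rintro _ p' _ q' _ r' hp hq hr ⟨i, hi, rfl⟩ ⟨j, hj, rfl⟩ ⟨k, hk, rfl⟩ h1 h2 h3 hA hB hC
    obtain rfl := h.eq_of_chord hi (Or.inl hp)
    obtain rfl := h.eq_of_chord hj (Or.inl hq)
    obtain rfl := h.eq_of_chord hk (Or.inl hr)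
    exact hr3 i hi j hj ⟨h.cyclicAdj hi hj hA, fun e => h1 (by rw [e]), h.over_of i hi hp,
      h.over_of j hj hq⟩ k hk ⟨h.cyclicAdj (hτ i hi) hk hB, h.over_of k hk hr,
      fun e => h2 (by rw [e]), fun e => h3 (by rw [e])⟩ (h.cyclicAdj (hτ j hj) (hτ k hk) hC)
  · intro S hS hne hc hj
    exact h.eq_letterSet hw hS hne hc fun i hi j hj' hiS hjS =>
      hj _ _ _ _ (h.chord i hi) (h.chord j hj') hiS ⟨j, hj', rfl⟩ hjS

/-- A rigid set does not meet an interval whose word is connected and contains a bigon. -/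
theorem HasWord.disjoint_of_rigid (h : HasWord ov a b n τ up pos) (hw : WordConnected n τ)
    {i : ℕ} (hi : i + 1 < n) (hτi : τ i = τ (i + 1) + 1) (hne : τ i ≠ i + 1) {M : Set S1}
    (hM : Rigid ov M) : Disjoint M (((↑) : ℝ → S1) '' Icc a b) := by
  set J := ((↑) : ℝ → S1) '' Icc a b with hJ
  have hpre : IsPreconnected Jᶜ :=
    isPreconnected_compl_coe_Icc h.lt (by linarith [h.lt_one, h.nonneg])
  by_contra hd
  obtain ⟨s, hsM, hsJ⟩ := Set.not_disjoint_iff.1 hd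
  have hMJ : M ∩ J = M := by
    refine hM.connected _ inter_subset_left ⟨s, hsM, hsJ⟩ ?_ ?_
    · rintro s t hst ⟨hs, hs'⟩
      refine ⟨hM.closed s t hst hs, ?_⟩
      by_contra ht
      exact h.notMem_of_chord hw hst.symm ht hs'
    · rintro s s' t t' hss htt ⟨hs, hs'⟩ ht ht'
      have htJ : t ∉ J := fun htJ => ht' ⟨ht, htJ⟩
      refine joined_of_isPreconnected hpre htJ (h.notMem_of_chord hw htt htJ) (fun h' => h' hs') ?_
      exact fun h' => h.notMem_of_chord hw hss.symm h' hs'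
  have hML : M = letterSet n pos := by
    refine h.eq_letterSet hw ?_ hM.nonempty hM.closed ?_
    · intro s hs
      obtain ⟨t, hst⟩ := hM.exists_chord s hs
      rw [← hMJ] at hs
      obtain ⟨i, hi, rfl, -⟩ := h.exists_of_chord s t hst hs.2
      exact ⟨i, hi, rfl⟩
    · intro i hi j hj hiM hjM
      exact hM.joined_of_notMem _ _ (h.chord j hj) hjM _ hiM _ (hM.closed _ _ (h.chord i hi) hiM)
  subst hML
  have hi' : i < n := by omega
  refine hM.no_bigon _ _ _ _ (h.chord i hi') (h.chord (i + 1) hi) ⟨i, hi', rfl⟩ ⟨i + 1, hi, rfl⟩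
    (fun e => by have := h.pos_inj hi hi' e; omega)
    (fun e => by have := h.pos_inj hi (hw.1 i hi').1 e; omega) (h.adj_succ hi) ?_
  have h1 := (hw.1 i hi').1
  rw [hτi] at h1 ⊢
  intro m hm m' hm' e1 e2 e3 e4
  exact (h.adj_succ h1 m hm m' hm' e2 e1 e4 e3).symm

/-- A bigon move inside a tangle which destroys the rigidity of its word changes the number of rigid
sets. -/
theorem HasWord.ncard_rigid_ne {D D' : Diagram} {n' : ℕ} {τ' : ℕ → ℕ} {up' : ℕ → Bool}
    {pos' : ℕ → ℝ} (h : HasWord D.isOver a b n τ up pos) (hn : 0 < n) (hw : WordConnected n τ)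
    (hr : WordReduced n τ up)
    (h' : HasWord D'.isOver a b n' τ' up' pos') (hw' : WordConnected n' τ')
    {i : ℕ} (hi : i + 1 < n') (hτi : τ' i = τ' (i + 1) + 1) (hne : τ' i ≠ i + 1)
    (heq : ∀ s t, s ∉ ((↑) : ℝ → S1) '' Icc a b → t ∉ ((↑) : ℝ → S1) '' Icc a b →
      (D'.isOver s t ↔ D.isOver s t)) :
    {M | Rigid D.isOver M}.ncard ≠ {M | Rigid D'.isOver M}.ncard := by
  refine (ncard_lt_ncard ?_ D.finite_setOf_rigid).ne'
  rw [Set.ssubset_iff_of_subset]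
  · refine ⟨letterSet n pos, h.rigid hn hw hr, fun hR => ?_⟩
    exact Set.disjoint_left.1 (h'.disjoint_of_rigid hw' hi hτi hne hR) ⟨0, hn, rfl⟩
      ⟨_, h.pos_mem 0 hn, rfl⟩
  · intro M hM
    have hd := h'.disjoint_of_rigid hw' hi hτi hne hM
    refine hM.of_eq_outside hd heq (fun s t => h'.notMem_of_chord hw')
      (fun s t => h.notMem_of_chord hw) ?_
    intro s t hst hs ht m hm m' hm'
    exact joined_of_isPreconnected (isPreconnected_Icc.image _
      (AddCircle.continuous_mk' 1).continuousOn) hs ht (Set.disjoint_left.1 hd hm)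
      (Set.disjoint_left.1 hd hm')

end HasWord

/-! ### Diagrams as projections of space curves -/

/-- The determinant of two vectors of the plane. -/
def det {R : Type*} [CommRing R] (u v : R × R) : R := u.1 * v.2 - u.2 * v.1

/-- Near the parameter `s`, the curve `φ` runs in the line through `φ s` in the direction `d`. -/
def LocallyInLine (φ : S1 → Plane) (s : S1) (d : Plane) : Prop :=
  ∀ᶠ u in 𝓝 s, ∃ c : ℝ, φ u = φ s + c • d

/-- The linear coordinates of the plane with respect to the vectors `d` and `d'`. -/
noncomputable def coordinates {d d' : Plane} (h : det d d' ≠ 0) : Plane ≃ₜ Plane where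
  toFun p := (det p d' / det d d', det d p / det d d')
  invFun q := q.1 • d + q.2 • d'
  left_inv p := by
    ext
    · simp only [Prod.fst_add, Prod.smul_fst, smul_eq_mul]
      field_simp
      simp only [det]
      ring
    · simp only [Prod.snd_add, Prod.smul_snd, smul_eq_mul]
      field_simp
      simp only [det]
      ring
  right_inv q := by
    simp only [det, Prod.fst_add, Prod.smul_fst, smul_eq_mul, Prod.snd_add, Prod.smul_snd]
    unfold det at h
    ext
    · rw [div_eq_iff h]
      ring
    · rw [div_eq_iff h]
      ring
  continuous_toFun := by
    unfold det
    fun_prop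
  continuous_invFun := by fun_prop

theorem coordinates_apply {d d' : Plane} (h : det d d' ≠ 0) (p : Plane) :
    coordinates h p = (det p d' / det d d', det d p / det d d') := rfl

theorem LocallyInLine.crossTransversally {φ : S1 → Plane} {s t : S1} {d d' : Plane}
    (hs : LocallyInLine φ s d) (ht : LocallyInLine φ t d') (h : det d d' ≠ 0) (hst : φ s = φ t) :
    CrossTransversally φ s t := by
  refine ⟨((Homeomorph.subRight (φ s)).trans (coordinates h)).toOpenPartialHomeomorph,
    mem_univ _, ?_, ?_, ?_⟩
  · simp [coordinates_apply, det]
  · filter_upwards [hs] with u hu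
    obtain ⟨c, hc⟩ := hu
    simp only [Homeomorph.toOpenPartialHomeomorph_apply, Homeomorph.trans_apply,
      Homeomorph.subRight_apply, coordinates_apply, hc, add_sub_cancel_left]
    rw [div_eq_zero_iff]
    left
    simp only [det, Prod.smul_fst, Prod.smul_snd, smul_eq_mul]
    ring
  · filter_upwards [ht] with u hu
    obtain ⟨c, hc⟩ := hu
    simp only [Homeomorph.toOpenPartialHomeomorph_apply, Homeomorph.trans_apply,
      Homeomorph.subRight_apply, coordinates_apply, hc, hst, add_sub_cancel_left]
    rw [div_eq_zero_iff]
    left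
    simp only [det, Prod.smul_fst, Prod.smul_snd, smul_eq_mul]
    ring

theorem CrossTransversally.congr {φ ψ : S1 → Plane} {s t : S1} (h : CrossTransversally φ s t)
    (hs : φ =ᶠ[𝓝 s] ψ) (ht : φ =ᶠ[𝓝 t] ψ) : CrossTransversally ψ s t := by
  obtain ⟨e, h1, h2, h3, h4⟩ := h
  refine ⟨e, by rwa [← hs.eq_of_nhds], by rwa [← hs.eq_of_nhds], ?_, ?_⟩
  · filter_upwards [h3, hs] with u hu hu'
    rwa [← hu']
  · filter_upwards [h4, ht] with u hu hu'
    rwa [← hu']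

theorem CrossTransversally.image {φ : S1 → Plane} {s t : S1} (h : CrossTransversally φ s t)
    (Ψ : Plane ≃ₜ Plane) : CrossTransversally (fun u => Ψ (φ u)) s t := by
  obtain ⟨e, h1, h2, h3, h4⟩ := h
  exact ⟨Ψ.symm.toOpenPartialHomeomorph.trans e, by simpa using h1, by simpa using h2,
    by simpa using h3, by simpa using h4⟩

/-- A simple closed curve in space whose projection to the plane is in general position. -/
structure GeneralPosition (N : S1 → Space) : Prop where
  continuous : Continuous N
  injective : Function.Injective N
  finite_double : {p : S1 × S1 | IsDoublePoint (fun s => (N s).1) p.1 p.2}.Finite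
  no_triple : ∀ s t u, (N s).1 = (N t).1 → (N t).1 = (N u).1 → s = t ∨ t = u ∨ s = u
  transverse : ∀ s t, IsDoublePoint (fun s => (N s).1) s t →
    CrossTransversally (fun s => (N s).1) s t

/-- The diagram of a space curve in general position. -/
def GeneralPosition.diagram {N : S1 → Space} (hN : GeneralPosition N) : Diagram where
  curve s := (N s).1
  continuous_curve := continuous_fst.comp hN.continuous
  finite_double := hN.finite_double
  no_triple := hN.no_triple
  transverse := hN.transverse
  isOver s t := IsDoublePoint (fun s => (N s).1) s t ∧ (N t).2 < (N s).2
  isOver_or s t := by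
    constructor
    · rintro (h | h)
      · exact h.1
      · exact ⟨h.1.1.symm, h.1.2.symm⟩
    · intro h
      rcases lt_trichotomy (N s).2 (N t).2 with h' | h' | h'
      · exact Or.inr ⟨⟨h.1.symm, h.2.symm⟩, h'⟩
      · exact absurd (hN.injective (Prod.ext h.2 h')) h.1
      · exact Or.inl ⟨h, h'⟩
  isOver_asymm s t h h' := absurd h.2 (not_lt.2 h'.2.le)

theorem GeneralPosition.represents {N : S1 → Space} (hN : GeneralPosition N) {K : Knot}
    (h : AmbientIsotopic (range N) (range K.toFun)) : hN.diagram.Represents K :=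
  ⟨fun s => (N s).2, continuous_snd.comp hN.continuous, fun _ _ h => h.2, h⟩

/-! ### Polygonal paths and their crossings -/

/-- The parametrized polygonal path with vertices `T 0, …, T m`, at unit speed in the index. -/
noncomputable def polyLine (T : ℕ → Space) (m : ℕ) (y : ℝ) : Space :=
  T 0 + ∑ i ∈ Finset.range m, max 0 (min 1 (y - i)) • (T (i + 1) - T i)

theorem continuous_polyLine (T : ℕ → Space) (m : ℕ) : Continuous (polyLine T m) := by
  unfold polyLine
  fun_prop

theorem polyLine_apply (T : ℕ → Space) {m i : ℕ} (hi : i < m) {r : ℝ} (h0 : 0 ≤ r) (h1 : r ≤ 1) :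
    polyLine T m (i + r) = T i + r • (T (i + 1) - T i) := by
  rw [polyLine, ← Finset.sum_subset (s₁ := Finset.range (i + 1)), Finset.sum_range_succ,
    Finset.sum_congr rfl (g := fun k => T (k + 1) - T k), Finset.sum_range_sub]
  · rw [add_sub_cancel_left, min_eq_right h1, max_eq_right h0]
    abel
  · intro k hk
    have : (k : ℝ) + 1 ≤ i := by exact_mod_cast Finset.mem_range.1 hk
    rw [min_eq_left (by linarith), max_eq_right zero_le_one, one_smul]
  · exact Finset.range_subset_range.2 hi
  · intro k _ hk
    have : (i : ℝ) + 1 ≤ k := by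
      rw [Finset.mem_range, not_lt] at hk
      exact_mod_cast hk
    rw [min_eq_right (by linarith), max_eq_left (by linarith), zero_smul]

/-- A point of `[0, m]` lies on one of the unit intervals. -/
theorem exists_nat_add {m : ℕ} (hm : 0 < m) {y : ℝ} (hy : y ∈ Icc (0 : ℝ) m) :
    ∃ i < m, ∃ r, 0 ≤ r ∧ r ≤ 1 ∧ y = i + r := by
  rcases hy.2.eq_or_lt with h | h
  · refine ⟨m - 1, by omega, 1, zero_le_one, le_rfl, ?_⟩
    rw [Nat.cast_sub hm, h]
    simp
  · have h1 := Nat.floor_le hy.1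
    have h2 := Nat.lt_floor_add_one y
    exact ⟨⌊y⌋₊, (Nat.floor_lt hy.1).2 h, y - ⌊y⌋₊, by linarith, by linarith, by ring⟩

/-- The direction of the projection of the `i`-th edge. -/
def dir (T : ℕ → (ℤ × ℤ) × ℤ) (i : ℕ) : ℤ × ℤ := (T (i + 1)).1 - (T i).1

/-- The parameter on the `i`-th edge of the intersection of the lines of the `i`-th and the `j`-th
edge of the projection. -/
def crossParam (T : ℕ → (ℤ × ℤ) × ℤ) (i j : ℕ) : ℚ :=
  det ((T j).1 - (T i).1) (dir T j) / det (dir T i) (dir T j)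

/-- The height of the `i`-th edge at its crossing with the `j`-th edge. -/
def crossHeight (T : ℕ → (ℤ × ℤ) × ℤ) (i j : ℕ) : ℚ :=
  (T i).2 + crossParam T i j * ((T (i + 1)).2 - (T i).2)

/-- Both ends of the `j`-th edge lie on one side of the line of the `i`-th edge. -/
def OneSide (T : ℕ → (ℤ × ℤ) × ℤ) (i j : ℕ) : Prop :=
  0 < det (dir T i) ((T j).1 - (T i).1) * det (dir T i) ((T (j + 1)).1 - (T i).1)

/-- The `i`-th edge lies to the left of the `j`-th edge. -/
def LeftOf (T : ℕ → (ℤ × ℤ) × ℤ) (i j : ℕ) : Prop :=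
  (T i).1.1 < (T j).1.1 ∧ (T i).1.1 < (T (j + 1)).1.1 ∧
    (T (i + 1)).1.1 < (T j).1.1 ∧ (T (i + 1)).1.1 < (T (j + 1)).1.1

/-- Certificate for the edges `i`, `j` to have disjoint projections. -/
def EdgesApart (T : ℕ → (ℤ × ℤ) × ℤ) (i j : ℕ) : Prop :=
  OneSide T i j ∨ OneSide T j i ∨ LeftOf T i j ∨ LeftOf T j i

instance (T : ℕ → (ℤ × ℤ) × ℤ) (i j : ℕ) : Decidable (EdgesApart T i j) := by
  unfold EdgesApart OneSide LeftOf
  infer_instance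

/-- Reading the projection of the path `T 0, …, T m` one meets crossings in the order of the word
`W`, where the letter `(i, j)` stands for a crossing of the `i`-th with the `j`-th edge. -/
structure ReadsWord (T : ℕ → (ℤ × ℤ) × ℤ) (m : ℕ) (W : List (ℕ × ℕ)) : Prop where
  dir_ne : ∀ i < m, dir T i ≠ 0
  apart : ∀ i < m, ∀ j < m, i < j →
    ((i, j) ∈ W ∨ j = i + 1) ∧ det (dir T i) (dir T j) ≠ 0 ∨ EdgesApart T i j
  lt : ∀ w ∈ W, w.1 < m ∧ w.2 < m ∧ w.swap ∈ W ∧ w.1 ≠ w.2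
  det_ne : ∀ w ∈ W, det (dir T w.1) (dir T w.2) ≠ 0
  pos : ∀ w ∈ W, 0 < crossParam T w.1 w.2 ∧ crossParam T w.1 w.2 < 1
  height : ∀ w ∈ W, crossHeight T w.1 w.2 ≠ crossHeight T w.2 w.1
  sorted : W.Pairwise fun v w => v.1 + crossParam T v.1 v.2 < w.1 + crossParam T w.1 w.2

/-- The point with parameter `r` on the projection of the `i`-th edge. -/
noncomputable def edgePoint (T : ℕ → (ℤ × ℤ) × ℤ) (i : ℕ) (r : ℝ) : Plane :=
  (toSpace (T i)).1 + r • ((toSpace (T (i + 1))).1 - (toSpace (T i)).1)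

theorem edgePoint_eq {T : ℕ → (ℤ × ℤ) × ℤ} {i j : ℕ} {r q : ℝ} :
    edgePoint T i r = edgePoint T j q ↔
      (T i).1.1 + r * (dir T i).1 = (T j).1.1 + q * (dir T j).1 ∧
      (T i).1.2 + r * (dir T i).2 = ((T j).1.2 + q * (dir T j).2 : ℝ) := by
  simp [edgePoint, toSpace, dir, Prod.ext_iff]

theorem edgePoint_eq_iff {T : ℕ → (ℤ × ℤ) × ℤ} {i j : ℕ} {r q : ℝ}
    (h : det (dir T i) (dir T j) ≠ 0) :
    edgePoint T i r = edgePoint T j q ↔ r = crossParam T i j ∧ q = crossParam T j i := by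
  have h' : ((dir T i).1 * (dir T j).2 - (dir T i).2 * (dir T j).1 : ℝ) ≠ 0 := by
    unfold det at h
    exact_mod_cast h
  have h'' : ((dir T j).1 * (dir T i).2 - (dir T j).2 * (dir T i).1 : ℝ) ≠ 0 := fun e =>
    h' (by linarith)
  have e1 : ((crossParam T i j : ℚ) : ℝ) = (((T j).1.1 - (T i).1.1) * (dir T j).2 -
      ((T j).1.2 - (T i).1.2) * (dir T j).1) /
      ((dir T i).1 * (dir T j).2 - (dir T i).2 * (dir T j).1) := by
    simp [crossParam, det]
  have e2 : ((crossParam T j i : ℚ) : ℝ) = (((T i).1.1 - (T j).1.1) * (dir T i).2 -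
      ((T i).1.2 - (T j).1.2) * (dir T i).1) /
      ((dir T j).1 * (dir T i).2 - (dir T j).2 * (dir T i).1) := by
    simp [crossParam, det]
  rw [edgePoint_eq, e1, e2, eq_div_iff h', eq_div_iff h'']
  constructor
  · rintro ⟨h1, h2⟩
    constructor
    · linear_combination (dir T j).2 * h1 - (dir T j).1 * h2
    · linear_combination -(dir T i).2 * h1 + (dir T i).1 * h2
  · rintro ⟨h1, h2⟩
    constructor
    · apply mul_right_cancel₀ h'
      linear_combination (dir T i).1 * h1 + (dir T j).1 * h2
    · apply mul_right_cancel₀ h'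
      linear_combination (dir T i).2 * h1 + (dir T j).2 * h2

theorem OneSide.ne {T : ℕ → (ℤ × ℤ) × ℤ} {i j : ℕ} (h : OneSide T i j) {r q : ℝ} (h0 : 0 ≤ q)
    (h1 : q ≤ 1) : edgePoint T i r ≠ edgePoint T j q := by
  intro he
  rw [edgePoint_eq] at he
  obtain ⟨e1, e2⟩ := he
  have h' : (0 : ℝ) < (((dir T i).1 * ((T j).1.2 - (T i).1.2) - (dir T i).2 * ((T j).1.1 - (T i).1.1)) *
      ((dir T i).1 * ((T (j + 1)).1.2 - (T i).1.2) - (dir T i).2 * ((T (j + 1)).1.1 - (T i).1.1))) := by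
    unfold OneSide det at h
    exact_mod_cast h
  have hd1 : ((dir T j).1 : ℝ) = (T (j + 1)).1.1 - (T j).1.1 := by simp [dir]
  have hd2 : ((dir T j).2 : ℝ) = (T (j + 1)).1.2 - (T j).1.2 := by simp [dir]
  set A : ℝ := (dir T i).1 * ((T j).1.2 - (T i).1.2) - (dir T i).2 * ((T j).1.1 - (T i).1.1)
  set B : ℝ := (dir T i).1 * ((T (j + 1)).1.2 - (T i).1.2) -
    (dir T i).2 * ((T (j + 1)).1.1 - (T i).1.1)
  have hs : (1 - q) * A + q * B = 0 := by
    rw [hd1] at e1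
    rw [hd2] at e2
    simp only [A, B]
    linear_combination (dir T i).2 * e1 - (dir T i).1 * e2
  rcases pos_and_pos_or_neg_and_neg_of_mul_pos h' with ⟨hA, hB⟩ | ⟨hA, hB⟩
  · nlinarith [mul_nonneg (sub_nonneg.2 h1) hA.le, mul_nonneg h0 hB.le]
  · nlinarith [mul_nonneg (sub_nonneg.2 h1) (neg_nonneg.2 hA.le),
      mul_nonneg h0 (neg_nonneg.2 hB.le)]

theorem LeftOf.ne {T : ℕ → (ℤ × ℤ) × ℤ} {i j : ℕ} (h : LeftOf T i j) {r q : ℝ}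
    (hr0 : 0 ≤ r) (hr1 : r ≤ 1) (hq0 : 0 ≤ q) (hq1 : q ≤ 1) : edgePoint T i r ≠ edgePoint T j q := by
  obtain ⟨h1, h2, h3, h4⟩ := h
  intro he
  rw [edgePoint_eq] at he
  have he := he.1
  have hd1 : ((dir T j).1 : ℝ) = (T (j + 1)).1.1 - (T j).1.1 := by simp [dir]
  have hd2 : ((dir T i).1 : ℝ) = (T (i + 1)).1.1 - (T i).1.1 := by simp [dir]
  rw [hd1, hd2] at he
  have h1' : ((T i).1.1 : ℝ) < (T j).1.1 := by exact_mod_cast h1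
  have h2' : ((T i).1.1 : ℝ) < (T (j + 1)).1.1 := by exact_mod_cast h2
  have h3' : ((T (i + 1)).1.1 : ℝ) < (T j).1.1 := by exact_mod_cast h3
  have h4' : ((T (i + 1)).1.1 : ℝ) < (T (j + 1)).1.1 := by exact_mod_cast h4
  have hM : max ((T i).1.1 : ℝ) (T (i + 1)).1.1 < min ((T j).1.1 : ℝ) (T (j + 1)).1.1 :=
    lt_min (max_lt h1' h3') (max_lt h2' h4')
  have m1 := le_max_left ((T i).1.1 : ℝ) (T (i + 1)).1.1
  have m2 := le_max_right ((T i).1.1 : ℝ) (T (i + 1)).1.1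
  have m3 := min_le_left ((T j).1.1 : ℝ) (T (j + 1)).1.1
  have m4 := min_le_right ((T j).1.1 : ℝ) (T (j + 1)).1.1
  set M := max ((T i).1.1 : ℝ) (T (i + 1)).1.1
  set M' := min ((T j).1.1 : ℝ) (T (j + 1)).1.1
  nlinarith [mul_nonneg (sub_nonneg.2 hr1) (sub_nonneg.2 m1), mul_nonneg hr0 (sub_nonneg.2 m2),
    mul_nonneg (sub_nonneg.2 hq1) (sub_nonneg.2 m3), mul_nonneg hq0 (sub_nonneg.2 m4)]

theorem EdgesApart.ne {T : ℕ → (ℤ × ℤ) × ℤ} {i j : ℕ} (h : EdgesApart T i j) {r q : ℝ}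
    (hr0 : 0 ≤ r) (hr1 : r ≤ 1) (hq0 : 0 ≤ q) (hq1 : q ≤ 1) : edgePoint T i r ≠ edgePoint T j q := by
  rcases h with h | h | h | h
  · exact h.ne hq0 hq1
  · exact (h.ne hr0 hr1).symm
  · exact h.ne hr0 hr1 hq0 hq1
  · exact (h.ne hq0 hq1 hr0 hr1).symm

/-- The self-intersections of the projection are the crossings listed in the word. -/
theorem ReadsWord.eq_or {T : ℕ → (ℤ × ℤ) × ℤ} {m : ℕ} {W : List (ℕ × ℕ)} (h : ReadsWord T m W)
    {i j : ℕ} (hi : i < m) (hj : j < m) {r q : ℝ} (hr0 : 0 ≤ r) (hr1 : r ≤ 1) (hq0 : 0 ≤ q)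
    (hq1 : q ≤ 1) (he : edgePoint T i r = edgePoint T j q) :
    (i + r = j + q) ∨ (i, j) ∈ W ∧ r = crossParam T i j ∧ q = crossParam T j i := by
  wlog hij : i ≤ j generalizing i j r q
  · refine (this hj hi hq0 hq1 hr0 hr1 he.symm (by omega)).imp Eq.symm ?_
    rintro ⟨h1, h2, h3⟩
    exact ⟨(h.lt _ h1).2.2.1, h3, h2⟩
  rcases hij.eq_or_lt with rfl | hij
  · left
    rw [edgePoint_eq] at he
    have hd := h.dir_ne i hi
    by_contra hne
    have hrq : r - q ≠ 0 := fun e => hne (by linarith)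
    apply hd
    have h1 : ((dir T i).1 : ℝ) = 0 := by
      apply mul_left_cancel₀ hrq
      linear_combination he.1
    have h2 : ((dir T i).2 : ℝ) = 0 := by
      apply mul_left_cancel₀ hrq
      linear_combination he.2
    exact Prod.ext (by exact_mod_cast h1) (by exact_mod_cast h2)
  · rcases h.apart i hi j hj hij with ⟨hW | rfl, hd⟩ | ha
    · exact Or.inr ⟨hW, (edgePoint_eq_iff hd).1 he⟩
    · left
      -- consecutive edges meet in their common vertex only
      have hv : edgePoint T i 1 = edgePoint T (i + 1) 0 := by
        rw [edgePoint, edgePoint]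
        module
      obtain ⟨h1, h2⟩ := (edgePoint_eq_iff hd).1 he
      obtain ⟨h3, h4⟩ := (edgePoint_eq_iff hd).1 hv
      rw [h1, h2, ← h3, ← h4]
      push_cast
      ring
    · exact absurd he (ha.ne hr0 hr1 hq0 hq1)

/-! ### The words of the tangles -/

/-- The letter of the word at the position `k`. -/
def letter (W : List (ℕ × ℕ)) (k : ℕ) : ℕ × ℕ := W.getD k (0, 0)

/-- The position of the letter that belongs to the same crossing as the letter at the position `k`. -/
def partner (W : List (ℕ × ℕ)) (k : ℕ) : ℕ := W.idxOf (letter W k).swap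

/-- Whether the letter at the position `k` is an overcrossing. -/
def isUp (T : ℕ → (ℤ × ℤ) × ℤ) (W : List (ℕ × ℕ)) (k : ℕ) : Bool :=
  decide (crossHeight T (letter W k).2 (letter W k).1 < crossHeight T (letter W k).1 (letter W k).2)

/-- The vertices of the tangle, indexed by the natural numbers. -/
def tangleVertex (m : (ℤ × ℤ) × ℤ) (i : ℕ) : (ℤ × ℤ) × ℤ := (tangle m).getD i 0

/-- The word of the tangle without the bigon. -/
def shortWord : List (ℕ × ℕ) :=
  [(1, 10), (1, 12), (1, 7), (1, 16), (2, 9), (7, 13), (7, 9), (7, 1), (7, 18), (7, 10), (7, 16),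
   (8, 10), (8, 18), (9, 2), (9, 16), (9, 7), (9, 12), (10, 1), (10, 12), (10, 18), (10, 7),
   (10, 16), (10, 8), (12, 10), (12, 1), (12, 9), (13, 7), (16, 9), (16, 1), (16, 18), (16, 10),
   (16, 7), (18, 10), (18, 7), (18, 16), (18, 8)]

/-- The word of the tangle with the bigon, whose corners are the crossings of the edges `4` and `5`
with the edge `14`. -/
def longWord : List (ℕ × ℕ) :=
  [(1, 10), (1, 12), (1, 7), (1, 16), (2, 9), (4, 14), (5, 14), (7, 13), (7, 9), (7, 1), (7, 18),
   (7, 10), (7, 16), (8, 10), (8, 18), (9, 2), (9, 16), (9, 7), (9, 12), (10, 1), (10, 12),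
   (10, 18), (10, 7), (10, 16), (10, 8), (12, 10), (12, 1), (12, 9), (13, 7), (14, 5), (14, 4),
   (16, 9), (16, 1), (16, 18), (16, 10), (16, 7), (18, 10), (18, 7), (18, 16), (18, 8)]

set_option synthInstance.maxSize 1000 in
theorem readsWord_short : ReadsWord (tangleVertex ((6, -42), 12)) 20 shortWord := by
  constructor <;> decide +kernel

set_option synthInstance.maxSize 1000 in
theorem readsWord_long : ReadsWord (tangleVertex ((6, -30), 12)) 20 longWord := by
  constructor <;> decide +kernel

theorem wordConnected_short : WordConnected 36 (partner shortWord) := by decide +kernel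

theorem wordConnected_long : WordConnected 40 (partner longWord) := by decide +kernel

theorem wordReduced_short :
    WordReduced 36 (partner shortWord) (isUp (tangleVertex ((6, -42), 12)) shortWord) := by
  decide +kernel

/-! ### Inserting a path into a straight piece of a knot -/

/-- The curve `N` is in general position, runs straight from `(-124, 0, 0)` to `(124, 0, 0)` in the
parameter interval `[a, b]`, and the rest of its projection lies outside the rectangle `|x| ≤ 124`,
`|y| ≤ 512`. -/
structure HasStraightPiece (N : S1 → Space) (a b : ℝ) : Prop where
  general : GeneralPosition N
  pos : 0 < a
  lt : a < b
  lt_one : b < 1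
  straight : ∀ x ∈ Icc a b, N (x : S1) = ((-124 + 248 * ((x - a) / (b - a)), 0), 0)
  outside : ∀ s ∉ ((↑) : ℝ → S1) '' Icc a b, 124 < |(N s).1.1| ∨ 512 < |(N s).1.2|

/-- The path through `T 0, …, T n`, the projection of which is read as the word `W`, has the ends of
the straight piece and stays in its rectangle. -/
structure FitsBox (T : ℕ → (ℤ × ℤ) × ℤ) (n : ℕ) (W : List (ℕ × ℕ)) : Prop where
  reads : ReadsWord T n W
  pos : 0 < n
  first : T 0 = ((-124, 0), 0)
  last : T n = ((124, 0), 0)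
  box : ∀ i < n + 1, |(T i).1.1| ≤ 124 ∧ |(T i).1.2| ≤ 512

/-- The curve `N` with its piece over the interval `[a, b]` replaced by the path `T 0, …, T n`. -/
noncomputable def insertPath (N : S1 → Space) (a b : ℝ) (T : ℕ → (ℤ × ℤ) × ℤ) (n : ℕ) :
    S1 → Space :=
  AddCircle.liftIco 1 0 fun x => if x ∈ Icc a b then
    polyLine (fun i => toSpace (T i)) n (n * ((x - a) / (b - a))) else N (x : S1)

/-- The parameter in `[a, b]` that corresponds to `y ∈ [0, n]`. -/
noncomputable def rescale (a b : ℝ) (n : ℕ) (y : ℝ) : ℝ := a + (b - a) * (y / n)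

section Insert

variable {N : S1 → Space} {a b : ℝ} {T : ℕ → (ℤ × ℤ) × ℤ} {n : ℕ} {W : List (ℕ × ℕ)}

theorem insertPath_coe (hN : HasStraightPiece N a b) {x : ℝ} (hx : x ∈ Icc a b) :
    insertPath N a b T n (x : S1) =
      polyLine (fun i => toSpace (T i)) n (n * ((x - a) / (b - a))) := by
  rw [insertPath, AddCircle.liftIco_coe_apply, if_pos hx]
  exact ⟨hN.pos.le.trans hx.1, by linarith [hx.2, hN.lt_one]⟩

theorem insertPath_of_notMem {s : S1} (hs : s ∉ ((↑) : ℝ → S1) '' Icc a b) :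
    insertPath N a b T n s = N s := by
  obtain ⟨x, h0, h1, rfl⟩ := exists_coe_mem_Ico 0 s
  rw [insertPath, AddCircle.liftIco_coe_apply ⟨h0, h1⟩, if_neg]
  exact fun hx => hs ⟨x, hx, rfl⟩

theorem rescale_mem (hab : a < b) (hn : 0 < n) {y : ℝ} (hy : y ∈ Icc (0 : ℝ) n) :
    rescale a b n y ∈ Icc a b := by
  have hn' : (0 : ℝ) < n := by exact_mod_cast hn
  have h0 : 0 ≤ y / n := div_nonneg hy.1 hn'.le
  have h1 : y / n ≤ 1 := (div_le_one hn').2 hy.2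
  unfold rescale
  constructor <;> nlinarith

theorem rescale_strictMono (hab : a < b) (hn : 0 < n) : StrictMono (rescale a b n) := by
  intro y z hyz
  have hn' : (0 : ℝ) < n := by exact_mod_cast hn
  have := mul_lt_mul_of_pos_left (div_lt_div_of_pos_right hyz hn') (sub_pos.2 hab)
  unfold rescale
  linarith

theorem exists_rescale (hab : a < b) (hn : 0 < n) {x : ℝ} (hx : x ∈ Icc a b) :
    ∃ i < n, ∃ r, 0 ≤ r ∧ r ≤ 1 ∧ x = rescale a b n (i + r) := by
  have hn' : (0 : ℝ) < n := by exact_mod_cast hn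
  have hba : 0 < b - a := sub_pos.2 hab
  obtain ⟨i, hi, r, h0, h1, h⟩ := exists_nat_add hn (y := n * ((x - a) / (b - a)))
    ⟨by have := hx.1; have : 0 ≤ x - a := by linarith
        positivity, by
      have : (x - a) / (b - a) ≤ 1 := (div_le_one hba).2 (by linarith [hx.2])
      nlinarith⟩
  refine ⟨i, hi, r, h0, h1, ?_⟩
  rw [rescale, ← h]
  field_simp
  ring

theorem insertPath_rescale (hN : HasStraightPiece N a b) {i : ℕ} (hi : i < n) {r : ℝ} (h0 : 0 ≤ r)
    (h1 : r ≤ 1) : insertPath N a b T n (rescale a b n (i + r) : ℝ) =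
      toSpace (T i) + r • (toSpace (T (i + 1)) - toSpace (T i)) := by
  have hn : (0 : ℝ) < n := by exact_mod_cast (Nat.zero_le i).trans_lt hi
  have hi' : (i : ℝ) + 1 ≤ n := by exact_mod_cast hi
  have hba : b - a ≠ 0 := (sub_pos.2 hN.lt).ne'
  rw [insertPath_coe hN, ← polyLine_apply (fun i => toSpace (T i)) hi h0 h1]
  · congr 1
    rw [rescale]
    field_simp
    ring
  · exact rescale_mem hN.lt (by exact_mod_cast hn) ⟨by positivity, by linarith⟩

theorem insertPath_fst (hN : HasStraightPiece N a b) {i : ℕ} (hi : i < n) {r : ℝ} (h0 : 0 ≤ r)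
    (h1 : r ≤ 1) : (insertPath N a b T n (rescale a b n (i + r) : ℝ)).1 = edgePoint T i r := by
  rw [insertPath_rescale hN hi h0 h1]
  rfl

theorem rescale_zero : rescale a b n 0 = a := by
  simp [rescale]

theorem rescale_self (hn : 0 < n) : rescale a b n n = b := by
  have hn' : (n : ℝ) ≠ 0 := by exact_mod_cast hn.ne'
  simp [rescale, hn']

theorem insertPath_left (hN : HasStraightPiece N a b) (hT : FitsBox T n W) :
    insertPath N a b T n (a : S1) = N (a : S1) := by
  have := insertPath_rescale (T := T) hN hT.pos le_rfl zero_le_one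
  rw [Nat.cast_zero, zero_add, rescale_zero] at this
  rw [this, hN.straight a ⟨le_rfl, hN.lt.le⟩, hT.first]
  simp [toSpace]

theorem insertPath_right (hN : HasStraightPiece N a b) (hT : FitsBox T n W) :
    insertPath N a b T n (b : S1) = N (b : S1) := by
  obtain ⟨k, rfl⟩ : ∃ k, n = k + 1 := ⟨n - 1, by have := hT.pos; omega⟩
  have := insertPath_rescale (T := T) hN (Nat.lt_succ_self k) zero_le_one le_rfl
  have hc : (k : ℝ) + 1 = (k + 1 : ℕ) := by push_cast; rfl
  rw [hc, rescale_self hT.pos] at this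
  rw [this, hN.straight b ⟨hN.lt.le, le_rfl⟩, hT.last, div_self (sub_pos.2 hN.lt).ne']
  simp [toSpace]
  norm_num

theorem continuous_insertPath (hN : HasStraightPiece N a b) (hT : FitsBox T n W) :
    Continuous (insertPath N a b T n) := by
  have hc : Continuous fun x : ℝ => N (x : S1) :=
    hN.general.continuous.comp (AddCircle.continuous_mk' 1)
  have h0 := hN.pos
  have h1 := hN.lt_one
  have hp : Continuous fun x : ℝ =>
      polyLine (fun i => toSpace (T i)) n (n * ((x - a) / (b - a))) :=
    (continuous_polyLine _ n).comp (by fun_prop)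
  refine AddCircle.liftIco_continuous ?_ (Continuous.continuousOn ?_)
  · rw [if_neg (fun h => absurd h.1 (by linarith)), if_neg (fun h => absurd h.2 (by linarith))]
    congr 1
    simpa using (AddCircle.coe_add_period (1 : ℝ) 0).symm
  · refine continuous_if ?_ hp.continuousOn hc.continuousOn
    intro x hx
    have hx' : x = a ∨ x = b := by
      have := frontier_Icc hN.lt.le ▸ hx
      simpa using this
    have hab := hN.lt.le
    rcases hx' with rfl | rfl
    · rw [← insertPath_coe hN ⟨le_rfl, hab⟩]
      exact insertPath_left hN hT
    · rw [← insertPath_coe hN ⟨hab, le_rfl⟩]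
      exact insertPath_right hN hT

theorem abs_add_mul_le {u v r M : ℝ} (hu : |u| ≤ M) (hv : |v| ≤ M) (h0 : 0 ≤ r) (h1 : r ≤ 1) :
    |u + r * (v - u)| ≤ M := by
  rw [abs_le] at *
  constructor <;> nlinarith

theorem FitsBox.edgePoint_mem (hT : FitsBox T n W) {i : ℕ} (hi : i < n) {r : ℝ} (h0 : 0 ≤ r)
    (h1 : r ≤ 1) : |(edgePoint T i r).1| ≤ 124 ∧ |(edgePoint T i r).2| ≤ 512 := by
  obtain ⟨b1, b2⟩ := hT.box i (by omega)
  obtain ⟨b3, b4⟩ := hT.box (i + 1) (by omega)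
  have key : ∀ {z : ℤ} {M : ℕ}, |z| ≤ M → |(z : ℝ)| ≤ M := fun h => by exact_mod_cast h
  exact ⟨abs_add_mul_le (key b1) (key b3) h0 h1, abs_add_mul_le (key b2) (key b4) h0 h1⟩

/-- The position of a letter on the path. -/
def letterPos (T : ℕ → (ℤ × ℤ) × ℤ) (w : ℕ × ℕ) : ℚ := w.1 + crossParam T w.1 w.2

theorem ReadsWord.letterPos_inj (h : ReadsWord T n W) {v w : ℕ × ℕ} (hv : v ∈ W) (hw : w ∈ W)
    (he : letterPos T v = letterPos T w) : v = w := by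
  obtain ⟨i, hi, rfl⟩ := List.mem_iff_getElem.1 hv
  obtain ⟨j, hj, rfl⟩ := List.mem_iff_getElem.1 hw
  have hs := List.pairwise_iff_getElem.1 h.sorted
  rcases lt_trichotomy i j with hij | rfl | hij
  · exact absurd he (hs i j hi hj hij).ne
  · rfl
  · exact absurd he (hs j i hj hi hij).ne'

/-- The parameter of a letter on the circle. -/
noncomputable def letterParam (T : ℕ → (ℤ × ℤ) × ℤ) (n : ℕ) (a b : ℝ) (w : ℕ × ℕ) : ℝ :=
  rescale a b n (letterPos T w : ℚ)

theorem letterParam_eq (w : ℕ × ℕ) :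
    letterParam T n a b w = rescale a b n (w.1 + (crossParam T w.1 w.2 : ℚ)) := by
  simp [letterParam, letterPos]

theorem ReadsWord.pos' (h : ReadsWord T n W) {w : ℕ × ℕ} (hw : w ∈ W) :
    (0 : ℝ) < (crossParam T w.1 w.2 : ℚ) ∧ ((crossParam T w.1 w.2 : ℚ) : ℝ) < 1 := by
  exact_mod_cast h.pos w hw

theorem FitsBox.letterParam_mem (hT : FitsBox T n W) (hN : HasStraightPiece N a b) {w : ℕ × ℕ}
    (hw : w ∈ W) : letterParam T n a b w ∈ Icc a b := by
  rw [letterParam_eq]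
  obtain ⟨h0, h1⟩ := hT.reads.pos' hw
  have hi : (w.1 : ℝ) + 1 ≤ n := by exact_mod_cast (hT.reads.lt w hw).1
  exact rescale_mem hN.lt hT.pos ⟨by positivity, by linarith⟩

theorem HasStraightPiece.coe_inj (hN : HasStraightPiece N a b) {x y : ℝ} (hx : x ∈ Icc a b)
    (hy : y ∈ Icc a b) (h : (x : S1) = y) : x = y :=
  coe_injOn ⟨hN.pos.le.trans hx.1, hx.2.trans_lt hN.lt_one⟩
    ⟨hN.pos.le.trans hy.1, hy.2.trans_lt hN.lt_one⟩ h

theorem FitsBox.letterParam_inj (hT : FitsBox T n W) (hN : HasStraightPiece N a b) {v w : ℕ × ℕ}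
    (hv : v ∈ W) (hw : w ∈ W) (h : (letterParam T n a b v : S1) = letterParam T n a b w) :
    v = w := by
  have := hN.coe_inj (hT.letterParam_mem hN hv) (hT.letterParam_mem hN hw) h
  have := (rescale_strictMono hN.lt hT.pos).injective this
  exact hT.reads.letterPos_inj hv hw (by exact_mod_cast this)

theorem insertPath_letter_fst (hN : HasStraightPiece N a b) (hT : FitsBox T n W) {w : ℕ × ℕ}
    (hw : w ∈ W) : (insertPath N a b T n (letterParam T n a b w)).1 =
      edgePoint T w.1 (crossParam T w.1 w.2 : ℚ) := by
  obtain ⟨h0, h1⟩ := hT.reads.pos' hw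
  rw [letterParam_eq, insertPath_fst hN (hT.reads.lt w hw).1 h0.le h1.le]

theorem insertPath_letter_snd (hN : HasStraightPiece N a b) (hT : FitsBox T n W) {w : ℕ × ℕ}
    (hw : w ∈ W) : (insertPath N a b T n (letterParam T n a b w)).2 =
      (crossHeight T w.1 w.2 : ℚ) := by
  obtain ⟨h0, h1⟩ := hT.reads.pos' hw
  rw [letterParam_eq, insertPath_rescale hN (hT.reads.lt w hw).1 h0.le h1.le]
  simp [toSpace, crossHeight]

theorem insertPath_letter_eq (hN : HasStraightPiece N a b) (hT : FitsBox T n W) {w : ℕ × ℕ}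
    (hw : w ∈ W) : (insertPath N a b T n (letterParam T n a b w)).1 =
      (insertPath N a b T n (letterParam T n a b w.swap)).1 := by
  rw [insertPath_letter_fst hN hT hw, insertPath_letter_fst hN hT (hT.reads.lt w hw).2.2.1]
  exact (edgePoint_eq_iff (hT.reads.det_ne w hw)).2 ⟨rfl, rfl⟩

/-- Inside the interval, the double points of the inserted path are the letters of the word. -/
theorem insertPath_eq_or (hN : HasStraightPiece N a b) (hT : FitsBox T n W) {s t : S1}
    (hs : s ∈ ((↑) : ℝ → S1) '' Icc a b)
    (h : (insertPath N a b T n s).1 = (insertPath N a b T n t).1) :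
    s = t ∨ ∃ w ∈ W, s = letterParam T n a b w ∧ t = letterParam T n a b w.swap := by
  obtain ⟨x, hx, rfl⟩ := hs
  obtain ⟨i, hi, r, hr0, hr1, rfl⟩ := exists_rescale hN.lt hT.pos hx
  rw [insertPath_fst hN hi hr0 hr1] at h
  by_cases ht : t ∈ ((↑) : ℝ → S1) '' Icc a b
  · obtain ⟨y, hy, rfl⟩ := ht
    obtain ⟨j, hj, q, hq0, hq1, rfl⟩ := exists_rescale hN.lt hT.pos hy
    rw [insertPath_fst hN hj hq0 hq1] at h
    rcases hT.reads.eq_or hi hj hr0 hr1 hq0 hq1 h with h | ⟨hw, rfl, rfl⟩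
    · left
      rw [h]
    · right
      refine ⟨_, hw, ?_, ?_⟩
      · rw [letterParam_eq]
      · rw [letterParam_eq]
        rfl
  · exfalso
    have h1 := hT.edgePoint_mem hi hr0 hr1
    rw [insertPath_of_notMem ht] at h
    rw [h] at h1
    rcases hN.outside t ht with h2 | h2
    · exact absurd h1.1 (not_le.2 h2)
    · exact absurd h1.2 (not_le.2 h2)

theorem isClosed_coe_Icc (a b : ℝ) : IsClosed (((↑) : ℝ → S1) '' Icc a b) :=
  (isCompact_Icc.image (AddCircle.continuous_mk' 1)).isClosed

theorem insertPath_eventuallyEq {s : S1} (hs : s ∉ ((↑) : ℝ → S1) '' Icc a b) :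
    N =ᶠ[𝓝 s] insertPath N a b T n := by
  filter_upwards [(isClosed_coe_Icc a b).isOpen_compl.mem_nhds hs] with u hu
  exact (insertPath_of_notMem hu).symm

theorem nhds_coe (x : ℝ) : 𝓝 (x : S1) = Filter.map ((↑) : ℝ → S1) (𝓝 x) :=
  (QuotientAddGroup.nhds_eq _ x)

theorem insertPath_locallyInLine (hN : HasStraightPiece N a b) (hT : FitsBox T n W) {w : ℕ × ℕ}
    (hw : w ∈ W) : LocallyInLine (fun s => (insertPath N a b T n s).1) (letterParam T n a b w)
      ((dir T w.1).1, (dir T w.1).2) := by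
  obtain ⟨h0, h1⟩ := hT.reads.pos' hw
  have hi := (hT.reads.lt w hw).1
  have hn' : (0 : ℝ) < n := by exact_mod_cast hT.pos
  have hba := sub_pos.2 hN.lt
  rw [LocallyInLine, nhds_coe, Filter.eventually_map]
  have hm := rescale_strictMono (a := a) (b := b) hN.lt hT.pos
  have hmem : Ioo (rescale a b n w.1) (rescale a b n (w.1 + 1)) ∈ 𝓝 (letterParam T n a b w) := by
    rw [letterParam_eq]
    exact Ioo_mem_nhds (hm (by linarith)) (hm (by linarith))
  filter_upwards [hmem] with x hx
  obtain ⟨r, rfl⟩ : ∃ r, x = rescale a b n (w.1 + r) :=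
    ⟨n * ((x - a) / (b - a)) - w.1, by
      rw [rescale]
      field_simp
      ring⟩
  have hr0 := hm.lt_iff_lt.1 hx.1
  have hr1 := hm.lt_iff_lt.1 hx.2
  rw [insertPath_fst hN hi (by linarith) (by linarith), insertPath_letter_fst hN hT hw]
  refine ⟨r - (crossParam T w.1 w.2 : ℚ), ?_⟩
  simp only [edgePoint, toSpace, dir, Prod.ext_iff]
  constructor
  · simp
    ring
  · simp
    ring

/-- Inserting a path that fits into the box keeps a curve in general position. -/
theorem generalPosition_insertPath (hN : HasStraightPiece N a b) (hT : FitsBox T n W) :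
    GeneralPosition (insertPath N a b T n) := by
  have hout : ∀ {s t : S1}, s ∉ ((↑) : ℝ → S1) '' Icc a b →
      (insertPath N a b T n s).1 = (insertPath N a b T n t).1 →
      t ∉ ((↑) : ℝ → S1) '' Icc a b := by
    intro s t hs h ht
    rcases insertPath_eq_or hN hT ht h.symm with rfl | ⟨w, hw, -, rfl⟩
    · exact hs ht
    · exact hs ⟨_, hT.letterParam_mem hN (hT.reads.lt w hw).2.2.1, rfl⟩
  refine ⟨continuous_insertPath hN hT, ?_, ?_, ?_, ?_⟩
  · intro s t h
    by_cases hs : s ∈ ((↑) : ℝ → S1) '' Icc a b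
    · rcases insertPath_eq_or hN hT hs (congrArg Prod.fst h) with h' | ⟨w, hw, rfl, rfl⟩
      · exact h'
      · have hh := congrArg Prod.snd h
        rw [insertPath_letter_snd hN hT hw,
          insertPath_letter_snd hN hT (hT.reads.lt w hw).2.2.1] at hh
        exact absurd (by exact_mod_cast hh) (hT.reads.height w hw)
    · have ht := hout hs (congrArg Prod.fst h)
      rw [insertPath_of_notMem hs, insertPath_of_notMem ht] at h
      exact hN.general.injective h
  · refine (hN.general.finite_double.union ((W.finite_toSet).image fun w =>
      ((letterParam T n a b w : S1), (letterParam T n a b w.swap : S1)))).subset ?_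
    rintro ⟨s, t⟩ ⟨hne, h⟩
    by_cases hs : s ∈ ((↑) : ℝ → S1) '' Icc a b
    · rcases insertPath_eq_or hN hT hs h with h' | ⟨w, hw, rfl, rfl⟩
      · exact absurd h' hne
      · exact Or.inr ⟨w, hw, rfl⟩
    · have ht := hout hs h
      left
      simp only [insertPath_of_notMem hs, insertPath_of_notMem ht] at h
      exact ⟨hne, h⟩
  · intro s t u hst htu
    by_cases hs : s ∈ ((↑) : ℝ → S1) '' Icc a b
    · rcases insertPath_eq_or hN hT hs hst with h | ⟨w, hw, rfl, rfl⟩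
      · exact Or.inl h
      · have hw' := (hT.reads.lt w hw).2.2.1
        rcases insertPath_eq_or hN hT ⟨_, hT.letterParam_mem hN hw', rfl⟩ htu with
          h | ⟨v, hv, h1, rfl⟩
        · exact Or.inr (Or.inl h)
        · rw [← hT.letterParam_inj hN hw' hv h1, Prod.swap_swap]
          exact Or.inr (Or.inr rfl)
    · have ht := hout hs hst
      have hu := hout ht htu
      rw [insertPath_of_notMem hs, insertPath_of_notMem ht] at hst
      rw [insertPath_of_notMem hu, insertPath_of_notMem ht] at htu
      exact hN.general.no_triple s t u hst htu
  · rintro s t ⟨hne, h⟩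
    by_cases hs : s ∈ ((↑) : ℝ → S1) '' Icc a b
    · rcases insertPath_eq_or hN hT hs h with h' | ⟨w, hw, rfl, rfl⟩
      · exact absurd h' hne
      · refine (insertPath_locallyInLine hN hT hw).crossTransversally
          (insertPath_locallyInLine hN hT (hT.reads.lt w hw).2.2.1) ?_ h
        have := hT.reads.det_ne w hw
        unfold det at this
        rw [det, Prod.fst_swap]
        dsimp only
        exact_mod_cast this
    · have ht := hout hs h
      simp only [insertPath_of_notMem hs, insertPath_of_notMem ht] at h
      exact (hN.general.transverse s t ⟨hne, h⟩).congr
        ((insertPath_eventuallyEq hs).fun_comp Prod.fst)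
        ((insertPath_eventuallyEq ht).fun_comp Prod.fst)

theorem letter_eq_getElem {k : ℕ} (hk : k < W.length) : letter W k = W[k] := by
  simp [letter, hk]

theorem letter_mem {k : ℕ} (hk : k < W.length) : letter W k ∈ W := by
  rw [letter_eq_getElem hk]
  exact List.getElem_mem hk

theorem letter_idxOf {w : ℕ × ℕ} (hw : w ∈ W) : letter W (W.idxOf w) = w := by
  rw [letter_eq_getElem (List.idxOf_lt_length_iff.2 hw)]
  exact List.getElem_idxOf _

/-- The chords of the diagram that meet the interval of the inserted path are those of its word. -/
theorem hasWord_insertPath (hN : HasStraightPiece N a b) (hT : FitsBox T n W) :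
    HasWord (generalPosition_insertPath hN hT).diagram.isOver a b W.length (partner W) (isUp T W)
      fun k => letterParam T n a b (letter W k) := by
  have hsw : ∀ {k}, k < W.length → (letter W k).swap ∈ W := fun hk =>
    (hT.reads.lt _ (letter_mem hk)).2.2.1
  have hp : ∀ {k}, k < W.length → letter W (partner W k) = (letter W k).swap := fun hk =>
    letter_idxOf (hsw hk)
  refine ⟨hN.pos.le, hN.lt, hN.lt_one, ?_, ?_, ?_, ?_, ?_⟩
  · exact fun k hk => hT.letterParam_mem hN (letter_mem hk)
  · intro i hi j hj hij
    apply rescale_strictMono hN.lt hT.pos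
    have := List.pairwise_iff_getElem.1 hT.reads.sorted i j hi hj hij
    rw [letter_eq_getElem hi, letter_eq_getElem hj, Rat.cast_lt]
    exact this
  · intro k hk
    rw [Diagram.chord_iff, hp hk]
    refine ⟨fun h => ?_, insertPath_letter_eq hN hT (letter_mem hk)⟩
    have := hT.letterParam_inj hN (letter_mem hk) (hsw hk) h
    exact (hT.reads.lt _ (letter_mem hk)).2.2.2 (congrArg Prod.fst this)
  · intro s t hst hs
    rw [Diagram.chord_iff] at hst
    rcases insertPath_eq_or hN hT hs hst.2 with h | ⟨w, hw, rfl, rfl⟩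
    · exact absurd h hst.1
    · have hk := List.idxOf_lt_length_iff.2 hw
      refine ⟨W.idxOf w, hk, ?_, ?_⟩
      · rw [letter_idxOf hw]
      · rw [hp hk, letter_idxOf hw]
  · intro k hk h
    have h' : (insertPath N a b T n (letterParam T n a b (letter W (partner W k)))).2 <
      (insertPath N a b T n (letterParam T n a b (letter W k))).2 := h.2
    rw [hp hk, insertPath_letter_snd hN hT (hsw hk),
      insertPath_letter_snd hN hT (letter_mem hk)] at h'
    rw [isUp, decide_eq_true_iff]
    exact_mod_cast h'

end Insert

/-! ### The knot type after an insertion -/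

theorem mem_polyPath_iff {L : List ((ℤ × ℤ) × ℤ)} {p : Space} : p ∈ polyPath L ↔
    ∃ i, i + 1 < L.length ∧ ∃ r : ℝ, 0 ≤ r ∧ r ≤ 1 ∧
      p = toSpace (L.getD i 0) + r • (toSpace (L.getD (i + 1) 0) - toSpace (L.getD i 0)) := by
  rw [polyPath_eq_biUnion]
  simp only [mem_iUnion, exists_prop, segment_eq_image']
  constructor
  · rintro ⟨e, he, r, ⟨h0, h1⟩, rfl⟩
    obtain ⟨i, hi, rfl⟩ := List.mem_iff_getElem.1 he
    have hi' : i < L.length - 1 := by simpa [edges] using hi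
    have h2 : i < L.length := by omega
    have h3 : i + 1 < L.length := by omega
    refine ⟨i, h3, r, h0, h1, ?_⟩
    simp [edges, h2, h3]
  · rintro ⟨i, hi, r, h0, h1, rfl⟩
    have h2 : i < L.length := by omega
    have hi' : i < (edges L).length := by
      simp [edges]
      omega
    refine ⟨_, List.getElem_mem hi', r, ⟨h0, h1⟩, ?_⟩
    simp [edges, hi, h2]

section Insert

variable {N : S1 → Space} {a b : ℝ}

theorem univ_eq_union (hab : a < b) (hba : b < a + 1) : (univ : Set S1) =
    ((↑) : ℝ → S1) '' Icc a b ∪ ((↑) : ℝ → S1) '' Icc b (a + 1) := by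
  refine (eq_univ_of_forall fun s => ?_).symm
  by_cases hs : s ∈ ((↑) : ℝ → S1) '' Icc a b
  · exact Or.inl hs
  · right
    have : s ∈ (((↑) : ℝ → S1) '' Icc a b)ᶜ := hs
    rw [compl_coe_Icc hab hba] at this
    exact image_mono Ioo_subset_Icc_self this

/-- On the closed complementary interval the points are outside, or ends of the interval. -/
theorem notMem_or_of_mem_compl {s : S1} (hab : a < b) (hba : b < a + 1)
    (hs : s ∈ ((↑) : ℝ → S1) '' Icc b (a + 1)) :
    s ∉ ((↑) : ℝ → S1) '' Icc a b ∨ s = a ∨ s = b := by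
  obtain ⟨x, hx, rfl⟩ := hs
  rcases hx.1.eq_or_lt with rfl | h1
  · exact Or.inr (Or.inr rfl)
  · rcases hx.2.eq_or_lt with rfl | h2
    · exact Or.inr (Or.inl (AddCircle.coe_add_period 1 a))
    · left
      rw [← mem_compl_iff, compl_coe_Icc hab hba]
      exact ⟨x, ⟨h1, h2⟩, rfl⟩

theorem HasStraightPiece.lt_add_one (hN : HasStraightPiece N a b) : b < a + 1 := by
  linarith [hN.pos, hN.lt_one]

theorem range_straight (hN : HasStraightPiece N a b) : range N =
    segment ℝ (((-124, 0), 0) : Space) ((124, 0), 0) ∪ N '' (((↑) : ℝ → S1) '' Icc b (a + 1)) := by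
  rw [← image_univ, univ_eq_union hN.lt hN.lt_add_one, image_union]
  congr 1
  have hba := sub_pos.2 hN.lt
  rw [segment_eq_image']
  ext p
  constructor
  · rintro ⟨_, ⟨x, hx, rfl⟩, rfl⟩
    refine ⟨(x - a) / (b - a), ⟨div_nonneg (by linarith [hx.1]) hba.le,
      (div_le_one hba).2 (by linarith [hx.2])⟩, ?_⟩
    rw [hN.straight x hx]
    ext <;> simp
    ring
  · rintro ⟨r, ⟨h0, h1⟩, rfl⟩
    have hx : a + r * (b - a) ∈ Icc a b := ⟨by nlinarith, by nlinarith⟩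
    refine ⟨_, ⟨_, hx, rfl⟩, ?_⟩
    rw [hN.straight _ hx, add_sub_cancel_left, mul_div_cancel_right₀ _ hba.ne']
    ext <;> simp
    ring

theorem range_insertPath {W : List (ℕ × ℕ)} {m : (ℤ × ℤ) × ℤ} (hN : HasStraightPiece N a b)
    (hT : FitsBox (tangleVertex m) 20 W) : range (insertPath N a b (tangleVertex m) 20) =
      polyPath (tangle m) ∪ N '' (((↑) : ℝ → S1) '' Icc b (a + 1)) := by
  rw [← image_univ, univ_eq_union hN.lt hN.lt_add_one, image_union]
  congr 1
  · ext p
    rw [mem_polyPath_iff]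
    constructor
    · rintro ⟨_, ⟨x, hx, rfl⟩, rfl⟩
      obtain ⟨i, hi, r, h0, h1, rfl⟩ := exists_rescale hN.lt (n := 20) (by norm_num) hx
      exact ⟨i, Nat.succ_lt_succ hi, r, h0, h1, insertPath_rescale hN hi h0 h1⟩
    · rintro ⟨i, hi, r, h0, h1, rfl⟩
      have hi : i < 20 := Nat.lt_of_succ_lt_succ hi
      have hi' : (i : ℝ) + 1 ≤ (20 : ℕ) := by exact_mod_cast hi
      exact ⟨_, ⟨_, rescale_mem hN.lt (by norm_num) ⟨by positivity, by linarith⟩, rfl⟩,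
        insertPath_rescale hN hi h0 h1⟩
  · refine image_congr fun s hs => ?_
    rcases notMem_or_of_mem_compl hN.lt hN.lt_add_one hs with h | rfl | rfl
    · exact insertPath_of_notMem h
    · exact insertPath_left hN hT
    · exact insertPath_right hN hT

/-- Inserting the tangle does not change the knot type. -/
theorem ambientIsotopic_insertPath {W : List (ℕ × ℕ)} {m : (ℤ × ℤ) × ℤ}
    (hN : HasStraightPiece N a b) (hT : FitsBox (tangleVertex m) 20 W)
    (hm : m = ((6, -42), 12) ∨ m = ((6, -30), 12)) :
    AmbientIsotopic (range (insertPath N a b (tangleVertex m) 20)) (range N) := by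
  rw [range_insertPath hN hT, range_straight hN]
  refine ambientIsotopic_tangle hm ?_ ?_
  · exact (isCompact_Icc.image (AddCircle.continuous_mk' 1)).image hN.general.continuous
  · rw [Set.disjoint_left]
    rintro _ ⟨s, hs, rfl⟩ ⟨h1, h2⟩
    push_cast at h1 h2
    rcases notMem_or_of_mem_compl hN.lt hN.lt_add_one hs with h | rfl | rfl
    · rcases hN.outside s h with h | h
      · exact absurd h1 (not_lt.2 h.le)
      · exact absurd h2 (not_lt.2 h.le)
    · rw [hN.straight a ⟨le_rfl, hN.lt.le⟩] at h1
      norm_num at h1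
    · rw [hN.straight b ⟨hN.lt.le, le_rfl⟩, div_self (sub_pos.2 hN.lt).ne'] at h1
      norm_num at h1

end Insert

theorem fitsBox_short : FitsBox (tangleVertex ((6, -42), 12)) 20 shortWord :=
  ⟨readsWord_short, by norm_num, rfl, rfl, by decide +kernel⟩

theorem fitsBox_long : FitsBox (tangleVertex ((6, -30), 12)) 20 longWord :=
  ⟨readsWord_long, by norm_num, rfl, rfl, by decide +kernel⟩

/-! ### The bigon -/

/-- The disc in which the two tangles differ. -/
def bigonDisc : Set Plane := Icc (-4) 16 ×ˢ Icc (-45) (-29)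

theorem isClosedDisc_bigonDisc : IsClosedDisc bigonDisc := by
  let f : Plane ≃ₜ Plane := ((Homeomorph.mulLeft₀ (10 : ℝ) (by norm_num)).trans
    (Homeomorph.addLeft 6)).prodCongr ((Homeomorph.mulLeft₀ (8 : ℝ) (by norm_num)).trans
    (Homeomorph.addLeft (-37)))
  have hf : ∀ p, f p = (6 + 10 * p.1, -37 + 8 * p.2) := fun _ => rfl
  have hfs : ∀ p, f.symm p = ((p.1 - 6) / 10, (p.2 + 37) / 8) := fun p => by
    rw [Homeomorph.symm_apply_eq, hf]
    ext <;> simp <;> ring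
  refine ⟨f, ?_⟩
  ext p
  have him : f '' Metric.closedBall 0 1 = f.symm ⁻¹' Metric.closedBall 0 1 :=
    f.toEquiv.image_eq_preimage_symm _
  rw [him, mem_preimage, hfs, ← Prod.mk_zero_zero, ← closedBall_prod_same, Real.closedBall_eq_Icc, bigonDisc]
  simp only [mem_prod, mem_Icc]
  constructor
  · rintro ⟨⟨h1, h2⟩, h3, h4⟩
    exact ⟨⟨by linarith, by linarith⟩, by linarith, by linarith⟩
  · rintro ⟨⟨h1, h2⟩, h3, h4⟩
    exact ⟨⟨by linarith, by linarith⟩, by linarith, by linarith⟩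

theorem interior_bigonDisc : interior bigonDisc = Ioo (-4) 16 ×ˢ Ioo (-45) (-29) := by
  rw [bigonDisc, interior_prod_eq, interior_Icc, interior_Icc]

theorem mem_frontier_bigonDisc {p : Plane} (h1 : p.1 = -4 ∨ p.1 = 16)
    (h2 : p.2 ∈ Icc (-45 : ℝ) (-29)) : p ∈ frontier bigonDisc := by
  rw [frontier, interior_bigonDisc, isClosedDisc_bigonDisc.isClosed.closure_eq]
  refine ⟨⟨?_, h2⟩, fun h => ?_⟩
  · rcases h1 with h1 | h1 <;> rw [h1] <;> norm_num
  · have h3 := h.1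
    rcases h1 with h1 | h1 <;> rw [h1] at h3 <;> norm_num at h3

/-- The value at a point `p` of an affine function that vanishes on the line of the `i`-th edge. -/
def lineFun {R : Type*} [CommRing R] (T : ℕ → (ℤ × ℤ) × ℤ) (i : ℕ) (p : R × R) : R :=
  (dir T i).1 * (p.2 - (T i).1.2) - (dir T i).2 * (p.1 - (T i).1.1)

theorem lineFun_edgePoint (T : ℕ → (ℤ × ℤ) × ℤ) (i : ℕ) (r : ℝ) :
    lineFun T i (edgePoint T i r) = 0 := by
  simp [lineFun, edgePoint, dir, toSpace]
  ring

/-- The disc lies on one side of the line of the `i`-th edge. -/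
def DiscOneSide (T : ℕ → (ℤ × ℤ) × ℤ) (i : ℕ) : Prop :=
  (0 < lineFun T i ((-4, -45) : ℤ × ℤ) ∧ 0 < lineFun T i ((-4, -29) : ℤ × ℤ) ∧
    0 < lineFun T i ((16, -45) : ℤ × ℤ) ∧ 0 < lineFun T i ((16, -29) : ℤ × ℤ)) ∨
  (lineFun T i ((-4, -45) : ℤ × ℤ) < 0 ∧ lineFun T i ((-4, -29) : ℤ × ℤ) < 0 ∧
    lineFun T i ((16, -45) : ℤ × ℤ) < 0 ∧ lineFun T i ((16, -29) : ℤ × ℤ) < 0)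

instance (T : ℕ → (ℤ × ℤ) × ℤ) (i : ℕ) : Decidable (DiscOneSide T i) := by
  unfold DiscOneSide
  infer_instance

theorem DiscOneSide.notMem {T : ℕ → (ℤ × ℤ) × ℤ} {i : ℕ} (h : DiscOneSide T i) (r : ℝ) :
    edgePoint T i r ∉ bigonDisc := by
  intro hp
  have h0 := lineFun_edgePoint T i r
  generalize edgePoint T i r = p at *
  obtain ⟨⟨h1, h2⟩, h3, h4⟩ := hp
  -- the value at a point of the rectangle is a convex combination of the values at the corners
  have key : 320 * lineFun T i p =
      (16 - p.1) * (-29 - p.2) * (lineFun T i ((-4, -45) : ℤ × ℤ) : ℤ) +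
      (16 - p.1) * (p.2 + 45) * (lineFun T i ((-4, -29) : ℤ × ℤ) : ℤ) +
      (p.1 + 4) * (-29 - p.2) * (lineFun T i ((16, -45) : ℤ × ℤ) : ℤ) +
      (p.1 + 4) * (p.2 + 45) * (lineFun T i ((16, -29) : ℤ × ℤ) : ℤ) := by
    simp only [lineFun]
    push_cast
    ring
  rw [h0, mul_zero] at key
  have a1 : 0 ≤ (16 - p.1) * (-29 - p.2) := mul_nonneg (by linarith) (by linarith)
  have a2 : 0 ≤ (16 - p.1) * (p.2 + 45) := mul_nonneg (by linarith) (by linarith)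
  have a3 : 0 ≤ (p.1 + 4) * (-29 - p.2) := mul_nonneg (by linarith) (by linarith)
  have a4 : 0 ≤ (p.1 + 4) * (p.2 + 45) := mul_nonneg (by linarith) (by linarith)
  have a5 : (16 - p.1) * (-29 - p.2) + (16 - p.1) * (p.2 + 45) + (p.1 + 4) * (-29 - p.2) +
      (p.1 + 4) * (p.2 + 45) = 320 := by ring
  generalize (16 - p.1) * (-29 - p.2) = c1 at *
  generalize (16 - p.1) * (p.2 + 45) = c2 at *
  generalize (p.1 + 4) * (-29 - p.2) = c3 at *
  generalize (p.1 + 4) * (p.2 + 45) = c4 at *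
  rcases h with ⟨b1, b2, b3, b4⟩ | ⟨b1, b2, b3, b4⟩
  · have d1 : (1 : ℝ) ≤ (lineFun T i ((-4, -45) : ℤ × ℤ) : ℤ) := by exact_mod_cast b1
    have d2 : (1 : ℝ) ≤ (lineFun T i ((-4, -29) : ℤ × ℤ) : ℤ) := by exact_mod_cast b2
    have d3 : (1 : ℝ) ≤ (lineFun T i ((16, -45) : ℤ × ℤ) : ℤ) := by exact_mod_cast b3
    have d4 : (1 : ℝ) ≤ (lineFun T i ((16, -29) : ℤ × ℤ) : ℤ) := by exact_mod_cast b4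
    nlinarith
  · have d1 : ((lineFun T i ((-4, -45) : ℤ × ℤ) : ℤ) : ℝ) ≤ -1 := by
      exact_mod_cast Int.le_sub_one_of_lt b1
    have d2 : ((lineFun T i ((-4, -29) : ℤ × ℤ) : ℤ) : ℝ) ≤ -1 := by
      exact_mod_cast Int.le_sub_one_of_lt b2
    have d3 : ((lineFun T i ((16, -45) : ℤ × ℤ) : ℤ) : ℝ) ≤ -1 := by
      exact_mod_cast Int.le_sub_one_of_lt b3
    have d4 : ((lineFun T i ((16, -29) : ℤ × ℤ) : ℤ) : ℝ) ≤ -1 := by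
      exact_mod_cast Int.le_sub_one_of_lt b4
    nlinarith

section Bigon

variable {N : S1 → Space} {a b : ℝ}

theorem HasStraightPiece.rescale_lt (hN : HasStraightPiece N a b) {y z : ℝ} (h : y < z) :
    rescale a b 20 y < rescale a b 20 z :=
  rescale_strictMono hN.lt (by norm_num) h

theorem HasStraightPiece.rescale_mem (hN : HasStraightPiece N a b) {y : ℝ}
    (hy : y ∈ Icc (0 : ℝ) 20) : rescale a b 20 y ∈ Icc a b :=
  KnotDiagrams.rescale_mem hN.lt (by norm_num) (by exact_mod_cast hy)

theorem HasStraightPiece.rescale_lt_add_one (hN : HasStraightPiece N a b) {y z : ℝ}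
    (hy : y ∈ Icc (0 : ℝ) 20) (hz : z ∈ Icc (0 : ℝ) 20) :
    rescale a b 20 y < rescale a b 20 z + 1 := by
  have h1 := hN.rescale_mem hy
  have h2 := hN.rescale_mem hz
  linarith [h1.2, h2.1, hN.lt_add_one]

/-- The arc of the circle that corresponds to the interval `[y, z]` of the inserted path. -/
noncomputable def pathArc (hN : HasStraightPiece N a b) (y z : ℝ) (h : y < z) (h0 : 0 ≤ y)
    (h1 : z ≤ 20) : Arc where
  a := rescale a b 20 y
  b := rescale a b 20 z
  ne e := (hN.rescale_lt h).ne (hN.coe_inj (hN.rescale_mem ⟨h0, h.le.trans h1⟩)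
    (hN.rescale_mem ⟨h0.trans h.le, h1⟩) e)

theorem mem_pathArc_closed (hN : HasStraightPiece N a b) {x y z : ℝ} (h : y < z) (h0 : 0 ≤ y)
    (h1 : z ≤ 20) (hx : x ∈ Icc (0 : ℝ) 20) :
    (rescale a b 20 x : S1) ∈ (pathArc hN y z h h0 h1).closed ↔ x ∈ Icc y z := by
  have hy : y ∈ Icc (0 : ℝ) 20 := ⟨h0, h.le.trans h1⟩
  have hz : z ∈ Icc (0 : ℝ) 20 := ⟨h0.trans h.le, h1⟩
  have hm := rescale_strictMono (n := 20) hN.lt (by norm_num)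
  rw [Arc.closed, pathArc, cIcc_coe (hN.rescale_lt h) (hN.rescale_lt_add_one hz hy)]
  constructor
  · rintro ⟨w, hw, hwx⟩
    obtain rfl := hN.coe_inj ⟨(hN.rescale_mem hy).1.trans hw.1, hw.2.trans (hN.rescale_mem hz).2⟩
      (hN.rescale_mem hx) hwx
    exact ⟨hm.le_iff_le.1 hw.1, hm.le_iff_le.1 hw.2⟩
  · exact fun hx' => ⟨_, ⟨hm.monotone hx'.1, hm.monotone hx'.2⟩, rfl⟩

theorem exists_of_mem_pathArc (hN : HasStraightPiece N a b) {y z : ℝ} (h : y < z) (h0 : 0 ≤ y)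
    (h1 : z ≤ 20) {s : S1} (hs : s ∈ (pathArc hN y z h h0 h1).closed) :
    ∃ x ∈ Icc y z, s = rescale a b 20 x := by
  have hy : y ∈ Icc (0 : ℝ) 20 := ⟨h0, h.le.trans h1⟩
  have hz : z ∈ Icc (0 : ℝ) 20 := ⟨h0.trans h.le, h1⟩
  have hm := rescale_strictMono (n := 20) hN.lt (by norm_num)
  rw [Arc.closed, pathArc, cIcc_coe (hN.rescale_lt h) (hN.rescale_lt_add_one hz hy)] at hs
  obtain ⟨w, hw, rfl⟩ := hs
  obtain ⟨i, hi, r, hr0, hr1, rfl⟩ := exists_rescale (n := 20) hN.lt (by norm_num)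
    ⟨(hN.rescale_mem hy).1.trans hw.1, hw.2.trans (hN.rescale_mem hz).2⟩
  exact ⟨_, ⟨hm.le_iff_le.1 hw.1, hm.le_iff_le.1 hw.2⟩, rfl⟩

theorem mem_pathArc_inner (hN : HasStraightPiece N a b) {x y z : ℝ} (h : y < z) (h0 : 0 ≤ y)
    (h1 : z ≤ 20) (hx : x ∈ Icc (0 : ℝ) 20) :
    (rescale a b 20 x : S1) ∈ (pathArc hN y z h h0 h1).inner ↔ x ∈ Ioo y z := by
  have hy : y ∈ Icc (0 : ℝ) 20 := ⟨h0, h.le.trans h1⟩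
  have hz : z ∈ Icc (0 : ℝ) 20 := ⟨h0.trans h.le, h1⟩
  have hm := rescale_strictMono (n := 20) hN.lt (by norm_num)
  rw [Arc.inner, pathArc, cIoo_coe (hN.rescale_lt h) (hN.rescale_lt_add_one hz hy)]
  constructor
  · rintro ⟨w, hw, hwx⟩
    obtain rfl := hN.coe_inj ⟨(hN.rescale_mem hy).1.trans hw.1.le,
      hw.2.le.trans (hN.rescale_mem hz).2⟩ (hN.rescale_mem hx) hwx
    exact ⟨hm.lt_iff_lt.1 hw.1, hm.lt_iff_lt.1 hw.2⟩
  · exact fun hx' => ⟨_, ⟨hm hx'.1, hm hx'.2⟩, rfl⟩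

/-- The two arcs of the bigon: the edges `4` and `5`, and the edge `14`. -/
noncomputable def bigonArcs (hN : HasStraightPiece N a b) : Fin 2 → Arc :=
  ![pathArc hN 4 6 (by norm_num) (by norm_num) (by norm_num),
    pathArc hN 14 15 (by norm_num) (by norm_num) (by norm_num)]

theorem mem_arcs_bigonArcs {hN : HasStraightPiece N a b} {s : S1} : s ∈ arcs (bigonArcs hN) ↔
    s ∈ (bigonArcs hN 0).closed ∨ s ∈ (bigonArcs hN 1).closed := by
  simp [arcs, Fin.exists_fin_two]

theorem rescale_mem_arcs {hN : HasStraightPiece N a b} {x : ℝ} (hx : x ∈ Icc (0 : ℝ) 20) :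
    (rescale a b 20 x : S1) ∈ arcs (bigonArcs hN) ↔ x ∈ Icc 4 6 ∨ x ∈ Icc 14 15 := by
  rw [mem_arcs_bigonArcs]
  exact or_congr (mem_pathArc_closed hN (by norm_num) (by norm_num) (by norm_num) hx)
    (mem_pathArc_closed hN (by norm_num) (by norm_num) (by norm_num) hx)

theorem coe_mem_of_mem_arcs {hN : HasStraightPiece N a b} {s : S1}
    (hs : s ∈ arcs (bigonArcs hN)) : s ∈ ((↑) : ℝ → S1) '' Icc a b := by
  rcases mem_arcs_bigonArcs.1 hs with hs | hs
  · obtain ⟨x, hx, rfl⟩ := exists_of_mem_pathArc hN (by norm_num) (by norm_num) (by norm_num) hs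
    exact ⟨_, hN.rescale_mem ⟨by linarith [hx.1], by linarith [hx.2]⟩, rfl⟩
  · obtain ⟨x, hx, rfl⟩ := exists_of_mem_pathArc hN (by norm_num) (by norm_num) (by norm_num) hs
    exact ⟨_, hN.rescale_mem ⟨by linarith [hx.1], by linarith [hx.2]⟩, rfl⟩

theorem add_mem_Icc {i : ℕ} (hi : i < 20) {r : ℝ} (h0 : 0 ≤ r) (h1 : r ≤ 1) :
    (i : ℝ) + r ∈ Icc (0 : ℝ) 20 := by
  have : (i : ℝ) + 1 ≤ 20 := by exact_mod_cast hi
  exact ⟨by positivity, by linarith⟩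

/-- The edges of which the interior lies in the disc. -/
theorem mem_arcs_iff_of_pos {hN : HasStraightPiece N a b} {i : ℕ} (hi : i < 20) {r : ℝ}
    (h0 : 0 < r) (h1 : r < 1) : (rescale a b 20 (i + r) : S1) ∈ arcs (bigonArcs hN) ↔
      i = 4 ∨ i = 5 ∨ i = 14 := by
  rw [rescale_mem_arcs (add_mem_Icc hi h0.le h1.le)]
  constructor
  · rintro (⟨h2, h3⟩ | ⟨h2, h3⟩)
    · have h4 : 3 < i := by
        have : (3 : ℝ) < i := by linarith
        exact_mod_cast this
      have h5 : i < 6 := by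
        have : (i : ℝ) < 6 := by linarith
        exact_mod_cast this
      omega
    · have h4 : 13 < i := by
        have : (13 : ℝ) < i := by linarith
        exact_mod_cast this
      have h5 : i < 15 := by
        have : (i : ℝ) < 15 := by linarith
        exact_mod_cast this
      omega
  · rintro (rfl | rfl | rfl)
    · left
      constructor <;> push_cast <;> linarith
    · left
      constructor <;> push_cast <;> linarith
    · right
      constructor <;> push_cast <;> linarith

theorem mem_arcs_of_eq {hN : HasStraightPiece N a b} {i : ℕ} (hi : i = 4 ∨ i = 5 ∨ i = 14) {r : ℝ}
    (h0 : 0 ≤ r) (h1 : r ≤ 1) : (rescale a b 20 (i + r) : S1) ∈ arcs (bigonArcs hN) := by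
  rw [rescale_mem_arcs (add_mem_Icc (by omega) h0 h1)]
  rcases hi with rfl | rfl | rfl
  · left
    constructor <;> push_cast <;> linarith
  · left
    constructor <;> push_cast <;> linarith
  · right
    constructor <;> push_cast <;> linarith

theorem letterParam_mem_arcs {hN : HasStraightPiece N a b} {T : ℕ → (ℤ × ℤ) × ℤ}
    {W : List (ℕ × ℕ)} (hT : FitsBox T 20 W) {w : ℕ × ℕ} (hw : w ∈ W) :
    (letterParam T 20 a b w : S1) ∈ arcs (bigonArcs hN) ↔ w.1 = 4 ∨ w.1 = 5 ∨ w.1 = 14 := by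
  obtain ⟨h0, h1⟩ := hT.reads.pos' hw
  rw [letterParam_eq]
  exact mem_arcs_iff_of_pos (hT.reads.lt w hw).1 h0 h1

theorem exists_edge_of_mem {hN : HasStraightPiece N a b} {s : S1}
    (hs : s ∈ ((↑) : ℝ → S1) '' Icc a b) : ∃ i : ℕ, i < 20 ∧ ∃ r : ℝ, 0 ≤ r ∧ r ≤ 1 ∧
      s = rescale a b 20 (i + r) := by
  obtain ⟨x, hx, rfl⟩ := hs
  obtain ⟨i, hi, r, h0, h1, rfl⟩ := exists_rescale (n := 20) hN.lt (by norm_num) hx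
  exact ⟨i, hi, r, h0, h1, rfl⟩

theorem tangleVertex_congr (m m' : (ℤ × ℤ) × ℤ) {i : ℕ} (hi : i < 20) (h4 : i ≠ 4) (h5 : i ≠ 5) :
    tangleVertex m i = tangleVertex m' i ∧ tangleVertex m (i + 1) = tangleVertex m' (i + 1) := by
  interval_cases i <;> first | exact ⟨rfl, rfl⟩ | contradiction

theorem insertPath_eq_of_notMem_arcs {hN : HasStraightPiece N a b} {m m' : (ℤ × ℤ) × ℤ} {s : S1}
    (hs : s ∉ arcs (bigonArcs hN)) : insertPath N a b (tangleVertex m) 20 s =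
      insertPath N a b (tangleVertex m') 20 s := by
  by_cases hsJ : s ∈ ((↑) : ℝ → S1) '' Icc a b
  · obtain ⟨i, hi, r, h0, h1, rfl⟩ := exists_edge_of_mem (hN := hN) hsJ
    have hi' : i ≠ 4 ∧ i ≠ 5 := by
      constructor <;> rintro rfl <;> exact hs (mem_arcs_of_eq (by norm_num) h0 h1)
    rw [insertPath_rescale hN hi h0 h1, insertPath_rescale hN hi h0 h1]
    obtain ⟨e1, e2⟩ := tangleVertex_congr m m' hi hi'.1 hi'.2
    rw [e1, e2]
  · rw [insertPath_of_notMem hsJ, insertPath_of_notMem hsJ]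

theorem edgePoint_tangle (m : (ℤ × ℤ) × ℤ) (r : ℝ) :
    edgePoint (tangleVertex m) 3 r = (36 - 20 * r, -40 - r) ∧
    edgePoint (tangleVertex m) 4 r = (16 + r * (m.1.1 - 16), -41 + r * (m.1.2 + 41)) ∧
    edgePoint (tangleVertex m) 5 r = (m.1.1 + r * (-4 - m.1.1), m.1.2 + r * (-42 - m.1.2)) ∧
    edgePoint (tangleVertex m) 6 r = (-4 - 40 * r, -42 - 2 * r) ∧
    edgePoint (tangleVertex m) 13 r = (-48 + 44 * r, -32 - r) ∧
    edgePoint (tangleVertex m) 14 r = (-4 + 20 * r, -33 + r) ∧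
    edgePoint (tangleVertex m) 15 r = (16 + 4 * r, -32) := by
  refine ⟨?_, ?_, ?_, ?_, ?_, ?_, ?_⟩ <;>
    simp [edgePoint, tangleVertex, tangle, toSpace] <;> (try constructor) <;> ring

theorem rescale_congr {x y : ℝ} (h : x = y) : (rescale a b 20 x : S1) = rescale a b 20 y := by
  rw [h]

theorem meetsDiscIn_bigonDisc (hN : HasStraightPiece N a b) {W : List (ℕ × ℕ)} {y z : ℤ}
    (hT : FitsBox (tangleVertex ((6, y), z)) 20 W) (h45 : -45 < y) (h29 : y < -29) :
    MeetsDiscIn (generalPosition_insertPath hN hT).diagram bigonDisc (bigonArcs hN) := by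
  have h45' : (-45 : ℝ) < y := by exact_mod_cast h45
  have h29' : (y : ℝ) < -29 := by exact_mod_cast h29
  have hcurve : ∀ i : ℕ, i < 20 → ∀ r : ℝ, 0 ≤ r → r ≤ 1 →
      (generalPosition_insertPath hN hT).diagram.curve (rescale a b 20 (i + r) : ℝ) =
        edgePoint (tangleVertex ((6, y), z)) i r :=
    fun i hi r h0 h1 => insertPath_fst hN hi h0 h1
  have hedge := edgePoint_tangle ((6, y), z)
  push_cast at hedge
  refine ⟨?_, ?_, ?_⟩
  · intro s hs
    by_cases hsJ : s ∈ ((↑) : ℝ → S1) '' Icc a b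
    · obtain ⟨i, hi, r, h0, h1, rfl⟩ := exists_edge_of_mem (hN := hN) hsJ
      rw [hcurve i hi r h0 h1]
      have h4 : ¬ (i = 4 ∨ i = 5 ∨ i = 14) := fun h => hs (mem_arcs_of_eq h h0 h1)
      rw [rescale_mem_arcs (add_mem_Icc hi h0 h1)] at hs
      have hside : ∀ i < 20, ¬ (i = 4 ∨ i = 5 ∨ i = 14) → (i = 3 ∨ i = 6 ∨ i = 13 ∨ i = 15) ∨
          DiscOneSide (tangleVertex 0) i := by decide +kernel
      rcases hside i hi h4 with (rfl | rfl | rfl | rfl) | hside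
      · have : r ≠ 1 := fun e => hs (Or.inl (by rw [e]; norm_num))
        have : r < 1 := lt_of_le_of_ne h1 this
        rw [(hedge r).1]
        exact fun h => by linarith [h.1.2]
      · have : r ≠ 0 := fun e => hs (Or.inl (by rw [e]; norm_num))
        have : 0 < r := lt_of_le_of_ne h0 this.symm
        rw [(hedge r).2.2.2.1]
        exact fun h => by linarith [h.1.1]
      · have : r ≠ 1 := fun e => hs (Or.inr (by rw [e]; norm_num))
        have : r < 1 := lt_of_le_of_ne h1 this
        rw [(hedge r).2.2.2.2.1]
        exact fun h => by linarith [h.1.1]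
      · have : r ≠ 0 := fun e => hs (Or.inr (by rw [e]; norm_num))
        have : 0 < r := lt_of_le_of_ne h0 this.symm
        rw [(hedge r).2.2.2.2.2.2]
        exact fun h => by linarith [h.1.2]
      · obtain ⟨e1, e2⟩ := tangleVertex_congr ((6, y), z) 0 hi (fun e => h4 (by simp [e]))
          (fun e => h4 (by simp [e]))
        have := hside.notMem r
        rwa [edgePoint, ← e1, ← e2] at this
    · have : (generalPosition_insertPath hN hT).diagram.curve s = (N s).1 :=
        congrArg Prod.fst (insertPath_of_notMem hsJ)
      rw [this]
      rintro ⟨⟨h1, h2⟩, h3, h4⟩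
      rcases hN.outside s hsJ with h | h
      · exact absurd h (not_lt.2 (abs_le.2 ⟨by linarith, by linarith⟩))
      · exact absurd h (not_lt.2 (abs_le.2 ⟨by linarith, by linarith⟩))
  · rw [interior_bigonDisc]
    intro j s hs
    fin_cases j
    · obtain ⟨x, hx, rfl⟩ := exists_of_mem_pathArc hN (by norm_num) (by norm_num) (by norm_num) (Arc.inner_subset_closed _ hs)
      have hx' := (mem_pathArc_inner hN (by norm_num) (by norm_num) (by norm_num) ⟨by linarith [hx.1], by linarith [hx.2]⟩).1 hs
      rcases le_total x 5 with h | h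
      · obtain ⟨r, rfl⟩ : ∃ r, x = (4 : ℕ) + r := ⟨x - 4, by push_cast; ring⟩
        push_cast at h hx'
        have h0 : 0 < r := by linarith [hx'.1]
        rw [hcurve 4 (by norm_num) r h0.le (by linarith), (hedge r).2.1]
        refine ⟨⟨?_, ?_⟩, ?_, ?_⟩ <;> nlinarith
      · obtain ⟨r, rfl⟩ : ∃ r, x = (5 : ℕ) + r := ⟨x - 5, by push_cast; ring⟩
        push_cast at h hx'
        have h1 : r < 1 := by linarith [hx'.2]
        have h0 : 0 ≤ r := by linarith
        rw [hcurve 5 (by norm_num) r h0 h1.le, (hedge r).2.2.1]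
        refine ⟨⟨?_, ?_⟩, ?_, ?_⟩ <;> nlinarith
    · obtain ⟨x, hx, rfl⟩ := exists_of_mem_pathArc hN (by norm_num) (by norm_num) (by norm_num) (Arc.inner_subset_closed _ hs)
      have hx' := (mem_pathArc_inner hN (by norm_num) (by norm_num) (by norm_num) ⟨by linarith [hx.1], by linarith [hx.2]⟩).1 hs
      obtain ⟨r, rfl⟩ : ∃ r, x = (14 : ℕ) + r := ⟨x - 14, by push_cast; ring⟩
      push_cast at hx'
      have h1 : r < 1 := by linarith [hx'.2]
      have h0 : 0 < r := by linarith [hx'.1]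
      rw [hcurve 14 (by norm_num) r h0.le h1.le, (hedge r).2.2.2.2.2.1]
      refine ⟨⟨?_, ?_⟩, ?_, ?_⟩ <;> linarith
  · intro j
    fin_cases j
    · have e1 : (bigonArcs hN 0).a = (rescale a b 20 ((4 : ℕ) + 0) : ℝ) :=
        rescale_congr (by norm_num)
      have e2 : (bigonArcs hN 0).b = (rescale a b 20 ((5 : ℕ) + 1) : ℝ) :=
        rescale_congr (by norm_num)
      simp only [Fin.zero_eta]
      rw [e1, e2, hcurve 4 (by norm_num) 0 le_rfl zero_le_one,
        hcurve 5 (by norm_num) 1 zero_le_one le_rfl, (hedge 0).2.1, (hedge 1).2.2.1]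
      refine ⟨mem_frontier_bigonDisc (Or.inr ?_) ?_, mem_frontier_bigonDisc (Or.inl ?_) ?_⟩ <;>
        norm_num
    · have e1 : (bigonArcs hN 1).a = (rescale a b 20 ((14 : ℕ) + 0) : ℝ) :=
        rescale_congr (by norm_num)
      have e2 : (bigonArcs hN 1).b = (rescale a b 20 ((14 : ℕ) + 1) : ℝ) :=
        rescale_congr (by norm_num)
      simp only [Fin.mk_one]
      rw [e1, e2, hcurve 14 (by norm_num) 0 le_rfl zero_le_one,
        hcurve 14 (by norm_num) 1 zero_le_one le_rfl, (hedge 0).2.2.2.2.2.1,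
        (hedge 1).2.2.2.2.2.1]
      refine ⟨mem_frontier_bigonDisc (Or.inl ?_) ?_, mem_frontier_bigonDisc (Or.inr ?_) ?_⟩ <;>
        norm_num

theorem createsBigon_insertPath (hN : HasStraightPiece N a b) :
    CreatesBigon (generalPosition_insertPath hN fitsBox_short).diagram
      (generalPosition_insertPath hN fitsBox_long).diagram := by
  refine ⟨bigonArcs hN, ⟨?_, ⟨bigonDisc, isClosedDisc_bigonDisc,
    meetsDiscIn_bigonDisc hN fitsBox_short (by norm_num) (by norm_num),
    meetsDiscIn_bigonDisc hN fitsBox_long (by norm_num) (by norm_num)⟩, ?_, ?_⟩, ?_, ?_⟩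
  · have hd : Disjoint (bigonArcs hN 0).closed (bigonArcs hN 1).closed := by
      rw [Set.disjoint_left]
      intro s hs hs'
      obtain ⟨x, hx, rfl⟩ := exists_of_mem_pathArc hN (by norm_num) (by norm_num) (by norm_num) hs
      have := (mem_pathArc_closed hN (by norm_num) (by norm_num) (by norm_num) ⟨by linarith [hx.1], by linarith [hx.2]⟩).1 hs'
      linarith [hx.2, this.1]
    intro i j hij
    fin_cases i <;> fin_cases j <;> first | exact absurd rfl hij | exact hd | exact hd.symm
  · exact fun s hs => congrArg Prod.fst (insertPath_eq_of_notMem_arcs hs)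
  · intro s t hs ht
    simp only [GeneralPosition.diagram, IsDoublePoint,
      insertPath_eq_of_notMem_arcs (m := ((6, -42), 12)) (m' := ((6, -30), 12)) hs,
      insertPath_eq_of_notMem_arcs (m := ((6, -42), 12)) (m' := ((6, -30), 12)) ht]
  · intro s hs t ht h
    rcases insertPath_eq_or hN fitsBox_short (coe_mem_of_mem_arcs hs) h with h | ⟨w, hw, rfl, -⟩
    · exact h
    · rw [letterParam_mem_arcs fitsBox_short hw] at hs
      have : ∀ w ∈ shortWord, ¬ (w.1 = 4 ∨ w.1 = 5 ∨ w.1 = 14) := by decide +kernel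
      exact absurd hs (this w hw)
  · have hW : ∀ m : Fin 2, (![(4, 14), (5, 14)] : Fin 2 → ℕ × ℕ) m ∈ longWord := by decide +kernel
    have hpos : ∀ {w}, w ∈ longWord → (letterParam (tangleVertex ((6, -30), 12)) 20 a b w : S1) =
        rescale a b 20 (w.1 + (crossParam (tangleVertex ((6, -30), 12)) w.1 w.2 : ℚ)) :=
      fun _ => by rw [letterParam_eq]
    have hpos' := fun {w} (hw : w ∈ longWord) => fitsBox_long.reads.pos' hw
    refine ⟨fun m => letterParam (tangleVertex ((6, -30), 12)) 20 a b (![(4, 14), (5, 14)] m),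
      fun m => letterParam (tangleVertex ((6, -30), 12)) 20 a b
        ((![(4, 14), (5, 14)] : Fin 2 → ℕ × ℕ) m).swap, ?_, ?_, ?_, ?_, ?_⟩
    · intro m
      have hw := hW m
      obtain ⟨h0, h1⟩ := hpos' hw
      simp only [hpos hw]
      have h4 : 4 ≤ (![(4, 14), (5, 14)] m : ℕ × ℕ).1 ∧ (![(4, 14), (5, 14)] m : ℕ × ℕ).1 ≤ 5 := by
        fin_cases m <;> simp
      have h4' : (4 : ℝ) ≤ ((![(4, 14), (5, 14)] m : ℕ × ℕ).1 : ℝ) ∧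
          ((![(4, 14), (5, 14)] m : ℕ × ℕ).1 : ℝ) ≤ 5 := by exact_mod_cast h4
      refine (mem_pathArc_inner hN (by norm_num) (by norm_num) (by norm_num) ⟨by linarith, by linarith⟩).2 ⟨by linarith, by linarith⟩
    · intro m
      have hw := (fitsBox_long.reads.lt _ (hW m)).2.2.1
      obtain ⟨h0, h1⟩ := hpos' hw
      simp only [hpos hw]
      have h4 : ((![(4, 14), (5, 14)] : Fin 2 → ℕ × ℕ) m).swap.1 = 14 := by
        fin_cases m <;> rfl
      have h4' : (((![(4, 14), (5, 14)] : Fin 2 → ℕ × ℕ) m).swap.1 : ℝ) = 14 := by exact_mod_cast h4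
      refine (mem_pathArc_inner hN (by norm_num) (by norm_num) (by norm_num) ⟨by linarith, by linarith⟩).2 ⟨by linarith, by linarith⟩
    · intro h
      have := fitsBox_long.letterParam_inj hN (hW 0) (hW 1) h
      simp at this
    · intro m
      have hw := hW m
      have hw' := (fitsBox_long.reads.lt _ hw).2.2.1
      refine ⟨⟨fun h => ?_, insertPath_letter_eq hN fitsBox_long hw⟩, ?_⟩
      · have := fitsBox_long.letterParam_inj hN hw hw' h
        exact (fitsBox_long.reads.lt _ hw).2.2.2 (congrArg Prod.fst this)
      · rw [insertPath_letter_snd hN fitsBox_long hw, insertPath_letter_snd hN fitsBox_long hw']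
        have : ∀ m : Fin 2, crossHeight (tangleVertex ((6, -30), 12))
            ((![(4, 14), (5, 14)] : Fin 2 → ℕ × ℕ) m).2
            ((![(4, 14), (5, 14)] : Fin 2 → ℕ × ℕ) m).1 <
            crossHeight (tangleVertex ((6, -30), 12)) ((![(4, 14), (5, 14)] : Fin 2 → ℕ × ℕ) m).1
            ((![(4, 14), (5, 14)] : Fin 2 → ℕ × ℕ) m).2 := by decide +kernel
        exact_mod_cast this m
    · intro u hu v hv huv
      rcases insertPath_eq_or hN fitsBox_long (coe_mem_of_mem_arcs hu) huv.2 with h | ⟨w, hw, rfl, rfl⟩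
      · exact absurd h huv.1
      · rw [letterParam_mem_arcs fitsBox_long hw] at hu
        rw [letterParam_mem_arcs fitsBox_long (fitsBox_long.reads.lt w hw).2.2.1] at hv
        have key : ∀ w ∈ longWord, (w.1 = 4 ∨ w.1 = 5 ∨ w.1 = 14) ∧
            (w.swap.1 = 4 ∨ w.swap.1 = 5 ∨ w.swap.1 = 14) →
            ∃ m : Fin 2, w = (![(4, 14), (5, 14)] : Fin 2 → ℕ × ℕ) m ∨
              w.swap = (![(4, 14), (5, 14)] : Fin 2 → ℕ × ℕ) m := by decide +kernel
        obtain ⟨m, hm | hm⟩ := key w hw ⟨hu, hv⟩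
        · exact ⟨m, Or.inl ⟨by rw [hm], by rw [hm]⟩⟩
        · refine ⟨m, Or.inr ⟨?_, by rw [hm]⟩⟩
          dsimp only
          rw [← hm, Prod.swap_swap]

/-- Inserting the two tangles yields a pair of diagrams which is dependent on bigon moves. -/
theorem dependent_insertPath (hN : HasStraightPiece N a b) :
    Dependent MoveClass.omega2 (generalPosition_insertPath hN fitsBox_short).diagram
      (generalPosition_insertPath hN fitsBox_long).diagram := by
  refine ⟨Relation.ReflTransGen.single
    (Or.inr ⟨_, mem_univ MoveClass.omega2, Or.inl (createsBigon_insertPath hN)⟩), fun h => ?_⟩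
  refine HasWord.ncard_rigid_ne (hasWord_insertPath hN fitsBox_short) (by decide)
    wordConnected_short wordReduced_short (hasWord_insertPath hN fitsBox_long)
    wordConnected_long (i := 5) (by decide) (by decide +kernel) (by decide +kernel) ?_ h.ncard_rigid
  intro s t hs ht
  simp only [GeneralPosition.diagram, IsDoublePoint, insertPath_of_notMem hs,
    insertPath_of_notMem ht]

end Bigon

/-! ### Generic directions of projection -/

/-- The value at `κ` of the quadratic form `(q₁ · κ) (q₂ · κ) - (q₃ · κ) (q₄ · κ)`. -/
def quad (q : Space × Space × Space × Space) (κ : Space) : ℝ :=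
  dot q.1 κ * dot q.2.1 κ - dot q.2.2.1 κ * dot q.2.2.2 κ

/-- The linear form `n · κ` as a polynomial in the coordinates of `κ`. -/
noncomputable def linPoly (n : Space) : MvPolynomial (Fin 3) ℝ :=
  MvPolynomial.C n.1.1 * MvPolynomial.X 0 + MvPolynomial.C n.1.2 * MvPolynomial.X 1 +
    MvPolynomial.C n.2 * MvPolynomial.X 2

theorem eval_linPoly (n : Space) (x : Fin 3 → ℝ) :
    MvPolynomial.eval x (linPoly n) = dot n ((x 0, x 1), x 2) := by
  simp [linPoly, dot]

theorem dot_smul (n κ : Space) (c : ℝ) : dot n (c • κ) = c * dot n κ := by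
  simp only [dot, Prod.smul_fst, Prod.smul_snd, smul_eq_mul]
  ring

/-- Finitely many nonzero quadratic forms have a common point where none of them vanishes. -/
theorem exists_generic_direction {Q : Set (Space × Space × Space × Space)} (hQ : Q.Finite) :
    ∃ κ : Space, κ.2 = 1 ∧ ∀ q ∈ Q, (∃ κ', quad q κ' ≠ 0) → quad q κ ≠ 0 := by
  classical
  let P : Space × Space × Space × Space → MvPolynomial (Fin 3) ℝ := fun q =>
    linPoly q.1 * linPoly q.2.1 - linPoly q.2.2.1 * linPoly q.2.2.2
  have hP : ∀ q x, MvPolynomial.eval x (P q) = quad q ((x 0, x 1), x 2) := fun q x => by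
    simp [P, quad, eval_linPoly]
  let p : MvPolynomial (Fin 3) ℝ :=
    MvPolynomial.X 2 * ∏ q ∈ hQ.toFinset.filter (fun q => P q ≠ 0), P q
  have hp : p ≠ 0 := by
    refine mul_ne_zero (MvPolynomial.X_ne_zero _) (Finset.prod_ne_zero_iff.2 fun q hq => ?_)
    exact (Finset.mem_filter.1 hq).2
  obtain ⟨x, hx⟩ : ∃ x, MvPolynomial.eval x p ≠ 0 := by
    by_contra! h
    exact hp (MvPolynomial.funext fun x => by rw [h x, map_zero])
  rw [map_mul, MvPolynomial.eval_X, map_prod] at hx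
  have hx2 := left_ne_zero_of_mul hx
  refine ⟨(x 2)⁻¹ • ((x 0, x 1), x 2), inv_mul_cancel₀ hx2, ?_⟩
  rintro q hq ⟨κ', hκ'⟩
  have hPq : P q ≠ 0 := by
    intro h0
    apply hκ'
    have := hP q ![κ'.1.1, κ'.1.2, κ'.2]
    rw [h0, map_zero] at this
    exact this.symm
  have h1 := Finset.prod_ne_zero_iff.1 (right_ne_zero_of_mul hx) q
    (Finset.mem_filter.2 ⟨hQ.mem_toFinset.2 hq, hPq⟩)
  rw [hP] at h1
  have h2 : quad q ((x 2)⁻¹ • ((x 0, x 1), x 2)) =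
      ((x 2)⁻¹ * (x 2)⁻¹) * quad q ((x 0, x 1), x 2) := by
    simp only [quad, dot_smul]
    ring
  rw [h2]
  exact mul_ne_zero (mul_ne_zero (inv_ne_zero hx2) (inv_ne_zero hx2)) h1

/-- The projection of space to the plane in the direction `κ`. -/
def project (κ p : Space) : Plane := (p.1.1 - κ.1.1 * p.2, p.1.2 - κ.1.2 * p.2)

theorem project_add_smul (κ p d : Space) (r : ℝ) :
    project κ (p + r • d) = project κ p + r • project κ d := by
  simp only [project, Prod.fst_add, Prod.snd_add, Prod.smul_fst, Prod.smul_snd, smul_eq_mul]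
  ext
  · simp only [Prod.fst_add, Prod.smul_fst, smul_eq_mul]
    ring
  · simp only [Prod.snd_add, Prod.smul_snd, smul_eq_mul]
    ring

/-- Points with the same projection differ by a multiple of the direction. -/
theorem sub_eq_smul_of_project_eq {κ p q : Space} (hκ : κ.2 = 1) (h : project κ p = project κ q) :
    q - p = (q.2 - p.2) • κ := by
  simp only [project, Prod.ext_iff] at h
  ext
  · simp only [Prod.fst_sub, Prod.smul_fst, smul_eq_mul]
    linarith [h.1]
  · simp only [Prod.fst_sub, Prod.snd_sub, Prod.smul_fst, Prod.smul_snd, smul_eq_mul]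
    linarith [h.2]
  · simp [hκ]

theorem det_project {κ : Space} (hκ : κ.2 = 1) (d d' : Space) :
    det (project κ d) (project κ d') = dot (cross d d') κ := by
  simp only [det, project, dot, cross, hκ]
  ring

/-- The direction `κ` is generic for the polygon with the vertices `v 0, …, v n`: edges that are
not parallel have projections that are not parallel, the projection of a vertex lies on the
projected line of an edge only if the vertex lies on the line of the edge, no edge is parallel to
`κ`, and the quadratic form in `κ` which expresses that the projected lines of three edges are
concurrent vanishes only if it vanishes identically. -/
structure GenericDirection (n : ℕ) (v : ℕ → Space) (κ : Space) : Prop where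
  snd_eq : κ.2 = 1
  transverse : ∀ i < n, ∀ j < n, cross (v (i + 1) - v i) (v (j + 1) - v j) ≠ 0 →
    dot (cross (v (i + 1) - v i) (v (j + 1) - v j)) κ ≠ 0
  vertex : ∀ i < n + 1, ∀ j < n, cross (v j - v i) (v (j + 1) - v j) ≠ 0 →
    dot (cross (v j - v i) (v (j + 1) - v j)) κ ≠ 0
  edge : ∀ i < n, v (i + 1) - v i ≠ 0 → cross κ (v (i + 1) - v i) ≠ 0
  triple : ∀ i < n, ∀ j < n, ∀ k < n,
    quad (cross (v i - v j) (v (j + 1) - v j), cross (v (i + 1) - v i) (v (k + 1) - v k),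
      cross (v i - v k) (v (k + 1) - v k), cross (v (i + 1) - v i) (v (j + 1) - v j)) κ = 0 →
    ∀ κ', quad (cross (v i - v j) (v (j + 1) - v j), cross (v (i + 1) - v i) (v (k + 1) - v k),
      cross (v i - v k) (v (k + 1) - v k), cross (v (i + 1) - v i) (v (j + 1) - v j)) κ' = 0

theorem exists_genericDirection (n : ℕ) (v : ℕ → Space) : ∃ κ, GenericDirection n v κ := by
  let e : ℕ → Space := fun i => v (i + 1) - v i
  let sq : Space → Space × Space × Space × Space := fun m => (m, m, 0, 0)
  have hsq : ∀ m κ, quad (sq m) κ = dot m κ * dot m κ := fun m κ => by simp [quad, sq, dot]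
  let basis : Fin 3 → Space := ![((1, 0), 0), ((0, 1), 0), ((0, 0), 1)]
  let Q1 := (fun p : ℕ × ℕ => sq (cross (e p.1) (e p.2))) '' (Iio n ×ˢ Iio n)
  let Q2 := (fun p : ℕ × ℕ => sq (cross (v p.2 - v p.1) (e p.2))) '' (Iio (n + 1) ×ˢ Iio n)
  let Q3 := (fun p : ℕ × Fin 3 => sq (cross (e p.1) (basis p.2))) '' (Iio n ×ˢ univ)
  let Q4 := (fun p : ℕ × ℕ × ℕ => ((cross (v p.1 - v p.2.1) (e p.2.1), cross (e p.1) (e p.2.2),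
    cross (v p.1 - v p.2.2) (e p.2.2), cross (e p.1) (e p.2.1)) : Space × Space × Space × Space)) ''
    (Iio n ×ˢ Iio n ×ˢ Iio n)
  have hfin : (Q1 ∪ Q2 ∪ Q3 ∪ Q4).Finite :=
    ((((finite_Iio _).prod (finite_Iio _)).image _).union
      (((finite_Iio _).prod (finite_Iio _)).image _) |>.union
      (((finite_Iio _).prod finite_univ).image _)).union
      (((finite_Iio _).prod ((finite_Iio _).prod (finite_Iio _))).image _)
  obtain ⟨κ, hκ, h⟩ := exists_generic_direction hfin
  have hlin : ∀ m, sq m ∈ Q1 ∪ Q2 ∪ Q3 ∪ Q4 → m ≠ 0 → dot m κ ≠ 0 := by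
    intro m hm hm0 h0
    refine h _ hm ⟨m, ?_⟩ ?_
    · rw [hsq]
      exact mul_ne_zero (dot_self_pos hm0).ne' (dot_self_pos hm0).ne'
    · rw [hsq, h0, mul_zero]
  refine ⟨κ, hκ, ?_, ?_, ?_, ?_⟩
  · exact fun i hi j hj => hlin _ (Or.inl (Or.inl (Or.inl ⟨(i, j), ⟨hi, hj⟩, rfl⟩)))
  · exact fun i hi j hj => hlin _ (Or.inl (Or.inl (Or.inr ⟨(i, j), ⟨hi, hj⟩, rfl⟩)))
  · intro i hi he h0
    apply he
    -- an edge in the direction `κ` violates the linear conditions in `Q3`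
    have hzero : ∀ l, cross (e i) (basis l) = 0 := by
      intro l
      by_contra hne
      apply hlin _ (Or.inl (Or.inr ⟨(i, l), ⟨hi, trivial⟩, rfl⟩)) hne
      have hd : dot (cross (e i) (basis l)) κ = dot (cross κ (e i)) (basis l) := by
        simp only [dot, cross]
        ring
      rw [hd]
      change dot (cross κ (v (i + 1) - v i)) (basis l) = 0
      rw [h0]
      simp [dot]
    have h1 := hzero 0
    have h2 := hzero 1
    simp only [cross, basis, Matrix.cons_val_zero, Matrix.cons_val_one, Prod.ext_iff, Prod.fst_zero,
      Prod.snd_zero] at h1 h2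
    change e i = 0
    ext
    · simp only [Prod.fst_zero]
      linarith [h2.2]
    · simp only [Prod.fst_zero, Prod.snd_zero]
      linarith [h1.2]
    · simp only [Prod.snd_zero]
      linarith [h1.1.2]
  · intro i hi j hj k hk h0 κ'
    by_contra hne
    exact h _ (Or.inr ⟨(i, j, k), ⟨hi, hj, hk⟩, rfl⟩) ⟨κ', hne⟩ h0

/-- The vector identities behind the analysis of double points. -/
theorem GenericDirection.double {n : ℕ} {v : ℕ → Space} {κ : Space}
    (h : GenericDirection n v κ) {i j : ℕ} (hi : i < n + 1) (hj : j < n) {d : Space} {r q t : ℝ}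
    (hd : v (j + 1) - v j ≠ 0) (ht : t ≠ 0)
    (he : (v j + q • (v (j + 1) - v j)) - (v i + r • d) = t • κ) :
    r • cross d (v (j + 1) - v j) ≠ 0 := by
  intro h0
  have hc : cross (v j - v i) (v (j + 1) - v j) = t • cross κ (v (j + 1) - v j) := by
    have h1 : v j - v i = t • κ + r • d - q • (v (j + 1) - v j) := by
      rw [← he]
      abel
    have h2 : ∀ x y z w : Space, cross (t • x + r • y - q • w) w =
        t • cross x w + r • cross y w := by
      intro x y z w
      simp only [cross, Prod.fst_add, Prod.snd_add, Prod.smul_fst, Prod.smul_snd, Prod.fst_sub,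
        Prod.snd_sub, smul_eq_mul]
      ext
      · simp only [Prod.fst_add, Prod.smul_fst, smul_eq_mul]
        ring
      · simp only [Prod.fst_add, Prod.snd_add, Prod.smul_fst, Prod.smul_snd, smul_eq_mul]
        ring
      · simp only [Prod.snd_add, Prod.smul_snd, smul_eq_mul]
        ring
    rw [h1, h2 _ _ 0, h0, add_zero]
  by_cases hz : cross (v j - v i) (v (j + 1) - v j) = 0
  · rw [hz] at hc
    exact (smul_ne_zero ht (h.edge j hj hd)) hc.symm
  · apply h.vertex i hi j hj hz
    rw [hc]
    simp only [dot, cross, Prod.smul_fst, Prod.smul_snd, smul_eq_mul]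
    ring

/-- Three edges do not project to concurrent segments. -/
theorem GenericDirection.not_triple {n : ℕ} {v : ℕ → Space} {κ : Space}
    (h : GenericDirection n v κ) {i j k : ℕ} (hi : i < n) (hj : j < n) (hk : k < n) {r q p t u : ℝ}
    (hij : dot (cross (v (i + 1) - v i) (v (j + 1) - v j)) κ ≠ 0)
    (hik : dot (cross (v (i + 1) - v i) (v (k + 1) - v k)) κ ≠ 0)
    (h1 : (v j + q • (v (j + 1) - v j)) - (v i + r • (v (i + 1) - v i)) = t • κ)
    (h2 : (v k + p • (v (k + 1) - v k)) - (v i + r • (v (i + 1) - v i)) = u • κ) : t = u := by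
  have key := h.triple i hi j hj k hk
  have e1 : v i - v j = q • (v (j + 1) - v j) - r • (v (i + 1) - v i) - t • κ := by
    rw [← h1]
    abel
  have e2 : v i - v k = p • (v (k + 1) - v k) - r • (v (i + 1) - v i) - u • κ := by
    rw [← h2]
    abel
  rw [e1, e2] at key
  generalize v (i + 1) - v i = a at *
  generalize v (j + 1) - v j = b at *
  generalize v (k + 1) - v k = c at *
  have hq : ∀ (q t : ℝ) (b κ' : Space), dot (cross (q • b - r • a - t • κ) b) κ' =
      -r * dot (cross a b) κ' - t * dot (cross κ b) κ' := by
    intro q t b κ'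
    simp only [dot, cross, Prod.smul_fst, Prod.smul_snd, Prod.fst_sub, Prod.snd_sub, smul_eq_mul]
    ring
  have hκ : ∀ b : Space, dot (cross κ b) κ = 0 := by
    intro b
    simp only [dot, cross]
    ring
  have ha : ∀ b : Space, dot (cross a b) (κ + a) = dot (cross a b) κ := by
    intro b
    simp only [dot, cross, Prod.fst_add, Prod.snd_add]
    ring
  have hb : ∀ b : Space, dot (cross κ b) (κ + a) = -dot (cross a b) κ := by
    intro b
    simp only [dot, cross, Prod.fst_add, Prod.snd_add]
    ring
  -- the quadratic form vanishes at `κ`, hence also at `κ + a`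
  have h3 := key (by
    simp only [quad, hq, hκ]
    ring) (κ + a)
  simp only [quad, hq, ha, hb] at h3
  have h4 : (t - u) * (dot (cross a b) κ * dot (cross a c) κ) = 0 := by linarith
  rcases mul_eq_zero.1 h4 with h5 | h5
  · linarith
  · exact absurd h5 (mul_ne_zero hij hik)

/-! ### The projection of a polygon in a generic direction -/

/-- The curve `γ` runs through the vertices `v 0, …, v n` of a polygon. -/
def RunsThrough (γ : S1 → Space) (n : ℕ) (v : ℕ → Space) : Prop :=
  ∀ i < n, ∀ r : ℝ, 0 ≤ r → r ≤ 1 →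
    γ (((i + r) / n : ℝ) : S1) = v i + r • (v (i + 1) - v i)

/-- The shear of space that takes the direction `κ` to the vertical direction. -/
def shear (κ : Space) : Space ≃ₜ Space where
  toFun p := (project κ p, p.2)
  invFun p := ((p.1.1 + κ.1.1 * p.2, p.1.2 + κ.1.2 * p.2), p.2)
  left_inv p := by simp [project]
  right_inv p := by simp [project]
  continuous_toFun := by
    unfold project
    fun_prop
  continuous_invFun := by fun_prop

theorem ambientIsotopic_shear (κ : Space) (A : Set Space) : AmbientIsotopic A (shear κ '' A) := by
  have h := AmbientIsotopic.of_family (fun t : unitInterval => shear ((t : ℝ) • κ)) (by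
    change Continuous fun p : unitInterval × Space =>
      ((project ((p.1 : ℝ) • κ) p.2, p.2.2) : Space)
    unfold project
    fun_prop) (by
    intro x
    change ((project ((0 : ℝ) • κ) x, x.2) : Space) = x
    simp [project]) A
  simpa using h

section Polygon

variable {γ : S1 → Space} {n : ℕ} {v : ℕ → Space} {κ : Space}

theorem exists_coe_div (hn : 0 < n) (s : S1) :
    ∃ i < n, ∃ r : ℝ, 0 ≤ r ∧ r ≤ 1 ∧ s = (((i + r) / n : ℝ) : S1) := by
  have hn' : (0 : ℝ) < n := by exact_mod_cast hn
  obtain ⟨x, h0, h1, rfl⟩ := exists_coe_mem_Ico 0 s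
  obtain ⟨i, hi, r, hr0, hr1, h⟩ := exists_nat_add hn (y := n * x)
    ⟨by positivity, by nlinarith⟩
  refine ⟨i, hi, r, hr0, hr1, ?_⟩
  rw [← h, mul_div_cancel_left₀ _ hn'.ne']

theorem RunsThrough.edge_ne_zero (hγ : RunsThrough γ n v) (hinj : Function.Injective γ) {i : ℕ}
    (hi : i < n) : v (i + 1) - v i ≠ 0 := by
  intro h0
  have hn' : (0 : ℝ) < n := by exact_mod_cast (Nat.zero_le i).trans_lt hi
  have hi' : (i : ℝ) + 1 ≤ n := by exact_mod_cast hi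
  have h1 := hγ i hi 0 le_rfl zero_le_one
  have h2 := hγ i hi (1 / 2) (by norm_num) (by norm_num)
  rw [h0, smul_zero] at h1 h2
  have h3 := coe_injOn ⟨by positivity, (div_lt_one hn').2 (by linarith)⟩
    ⟨by positivity, (div_lt_one hn').2 (by linarith)⟩ (hinj (h1.trans h2.symm))
  rw [div_left_inj' hn'.ne'] at h3
  linarith

theorem RunsThrough.project_eq (hγ : RunsThrough γ n v) {i : ℕ} (hi : i < n) {r : ℝ} (h0 : 0 ≤ r)
    (h1 : r ≤ 1) : project κ (γ (((i + r) / n : ℝ) : S1)) =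
      project κ (v i) + r • project κ (v (i + 1) - v i) := by
  rw [hγ i hi r h0 h1, project_add_smul]

theorem GenericDirection.interior (h : GenericDirection n v κ) (hγ : RunsThrough γ n v)
    (hinj : Function.Injective γ) {i j : ℕ} (hi : i < n) (hj : j < n) {r q : ℝ} (hr0 : 0 ≤ r)
    (hr1 : r ≤ 1) (hq0 : 0 ≤ q) (hq1 : q ≤ 1)
    (hne : (((i + r) / n : ℝ) : S1) ≠ (((j + q) / n : ℝ) : S1))
    (he : project κ (γ (((i + r) / n : ℝ) : S1)) = project κ (γ (((j + q) / n : ℝ) : S1))) :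
    0 < r ∧ r < 1 ∧ dot (cross (v (i + 1) - v i) (v (j + 1) - v j)) κ ≠ 0 ∧
    ∃ t : ℝ, (v j + q • (v (j + 1) - v j)) - (v i + r • (v (i + 1) - v i)) = t • κ := by
  have hs := sub_eq_smul_of_project_eq h.snd_eq he
  generalize (γ (((j + q) / n : ℝ) : S1)).2 - (γ (((i + r) / n : ℝ) : S1)).2 = t at hs
  have ht : t ≠ 0 := by
    rintro rfl
    rw [zero_smul, sub_eq_zero] at hs
    exact hne (hinj hs.symm)
  rw [hγ i hi r hr0 hr1, hγ j hj q hq0 hq1] at hs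
  have hej := hγ.edge_ne_zero hinj hj
  have k1 := h.double (by omega) hj hej ht hs
  have k2 := h.double (i := i + 1) (r := r - 1) (d := v (i + 1) - v i) (by omega) hj hej ht (by
    rw [← hs]
    module)
  have hr : r ≠ 0 := left_ne_zero_of_smul k1
  have hr' : r - 1 ≠ 0 := left_ne_zero_of_smul k2
  refine ⟨lt_of_le_of_ne hr0 hr.symm, lt_of_le_of_ne hr1 fun e => hr' (by linarith), ?_, t, hs⟩
  exact h.transverse i hi j hj (right_ne_zero_of_smul k1)

theorem eq_zero_of_smul_eq_smul {x y : ℝ} {d d' : Plane} (hd : det d d' ≠ 0)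
    (h : x • d = y • d') : x = 0 ∧ y = 0 := by
  have e1 := congrArg Prod.fst h
  have e2 := congrArg Prod.snd h
  simp only [Prod.smul_fst, Prod.smul_snd, smul_eq_mul] at e1 e2
  have h1 : x * det d d' = 0 := by
    unfold det
    linear_combination d'.2 * e1 - d'.1 * e2
  have h2 : y * det d d' = 0 := by
    unfold det
    linear_combination d.2 * e1 - d.1 * e2
  exact ⟨(mul_eq_zero.1 h1).resolve_right hd, (mul_eq_zero.1 h2).resolve_right hd⟩

theorem RunsThrough.locallyInLine (hγ : RunsThrough γ n v) {i : ℕ} (hi : i < n) {r : ℝ}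
    (h0 : 0 < r) (h1 : r < 1) : LocallyInLine (fun s => project κ (γ s))
      (((i + r) / n : ℝ) : S1) (project κ (v (i + 1) - v i)) := by
  have hn : (0 : ℝ) < n := by exact_mod_cast (Nat.zero_le i).trans_lt hi
  rw [LocallyInLine, nhds_coe, Filter.eventually_map]
  have hmem : Ioo ((i : ℝ) / n) ((i + 1) / n) ∈ 𝓝 ((i + r) / n : ℝ) :=
    Ioo_mem_nhds (div_lt_div_of_pos_right (by linarith) hn)
      (div_lt_div_of_pos_right (by linarith) hn)
  filter_upwards [hmem] with x hx
  obtain ⟨q, rfl⟩ : ∃ q, x = (i + q) / n := ⟨n * x - i, by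
    field_simp
    ring⟩
  have hq0 := (div_lt_div_iff_of_pos_right hn).1 hx.1
  have hq1 := (div_lt_div_iff_of_pos_right hn).1 hx.2
  rw [hγ.project_eq hi h0.le h1.le, hγ.project_eq hi (by linarith) (by linarith)]
  exact ⟨q - r, by module⟩

/-- A polygon in a generic direction is in general position. -/
theorem GenericDirection.generalPosition (h : GenericDirection n v κ) (hn : 0 < n)
    (hγ : RunsThrough γ n v) (hc : Continuous γ) (hinj : Function.Injective γ) :
    GeneralPosition fun s => shear κ (γ s) := by
  refine ⟨(shear κ).continuous.comp hc, (shear κ).injective.comp hinj, ?_, ?_, ?_⟩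
  · let S : ℕ × ℕ → Set (S1 × S1) := fun ij => {p | ∃ r q : ℝ, 0 ≤ r ∧ r ≤ 1 ∧ 0 ≤ q ∧ q ≤ 1 ∧
      det (project κ (v (ij.1 + 1) - v ij.1)) (project κ (v (ij.2 + 1) - v ij.2)) ≠ 0 ∧
      project κ (v ij.1) + r • project κ (v (ij.1 + 1) - v ij.1) =
        project κ (v ij.2) + q • project κ (v (ij.2 + 1) - v ij.2) ∧
      p = ((((ij.1 + r) / n : ℝ) : S1), (((ij.2 + q) / n : ℝ) : S1))}
    refine (((finite_Iio n).prod (finite_Iio n)).biUnion (t := S) ?_).subset ?_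
    · rintro ⟨i, j⟩ -
      apply Set.Subsingleton.finite
      rintro _ ⟨r, q, -, -, -, -, hd, he, rfl⟩ _ ⟨r', q', -, -, -, -, -, he', rfl⟩
      have : (r - r') • project κ (v (i + 1) - v i) = (q - q') • project κ (v (j + 1) - v j) := by
        have := congrArg₂ (· - ·) he he'
        simp only [add_sub_add_left_eq_sub, ← sub_smul] at this
        exact this
      obtain ⟨h1, h2⟩ := eq_zero_of_smul_eq_smul hd this
      rw [sub_eq_zero] at h1 h2
      rw [h1, h2]
    · rintro ⟨s, t⟩ ⟨hne, he⟩
      obtain ⟨i, hi, r, hr0, hr1, rfl⟩ := exists_coe_div hn s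
      obtain ⟨j, hj, q, hq0, hq1, rfl⟩ := exists_coe_div hn t
      obtain ⟨-, -, hd, -⟩ := h.interior hγ hinj hi hj hr0 hr1 hq0 hq1 hne he
      refine mem_biUnion (x := (i, j)) ⟨hi, hj⟩ ⟨r, q, hr0, hr1, hq0, hq1, ?_, ?_, rfl⟩
      · rwa [det_project h.snd_eq]
      · rw [← hγ.project_eq hi hr0 hr1, ← hγ.project_eq hj hq0 hq1]
        exact he
  · intro s t u hst htu
    by_contra! hne
    obtain ⟨i, hi, r, hr0, hr1, rfl⟩ := exists_coe_div hn s
    obtain ⟨j, hj, q, hq0, hq1, rfl⟩ := exists_coe_div hn t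
    obtain ⟨k, hk, p, hp0, hp1, rfl⟩ := exists_coe_div hn u
    obtain ⟨-, -, hij, t1, h1⟩ := h.interior hγ hinj hi hj hr0 hr1 hq0 hq1 hne.1 hst
    obtain ⟨-, -, hik, t2, h2⟩ :=
      h.interior hγ hinj hi hk hr0 hr1 hp0 hp1 hne.2.2 (hst.trans htu)
    have := h.not_triple hi hj hk hij hik h1 h2
    rw [this, ← h2, sub_left_inj, ← hγ j hj q hq0 hq1, ← hγ k hk p hp0 hp1] at h1
    exact hne.2.1 (hinj h1)
  · rintro s t ⟨hne, he⟩
    obtain ⟨i, hi, r, hr0, hr1, rfl⟩ := exists_coe_div hn s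
    obtain ⟨j, hj, q, hq0, hq1, rfl⟩ := exists_coe_div hn t
    obtain ⟨h1, h2, hd, -⟩ := h.interior hγ hinj hi hj hr0 hr1 hq0 hq1 hne he
    obtain ⟨h3, h4, -⟩ := h.interior hγ hinj hj hi hq0 hq1 hr0 hr1 hne.symm he.symm
    rw [← det_project h.snd_eq] at hd
    exact (hγ.locallyInLine hi h1 h2).crossTransversally (hγ.locallyInLine hj h3 h4) hd he

end Polygon

theorem project_ne_zero {κ d : Space} (hκ : κ.2 = 1) (hd : cross κ d ≠ 0) : project κ d ≠ 0 := by
  intro h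
  apply hd
  simp only [project, Prod.ext_iff, Prod.fst_zero, Prod.snd_zero] at h
  have h1 : d.1.1 = κ.1.1 * d.2 := by linarith [h.1]
  have h2 : d.1.2 = κ.1.2 * d.2 := by linarith [h.2]
  ext
  · simp [cross, h1, h2, hκ]
  · simp [cross, h1, h2, hκ]
  · simp [cross, h1, h2, hκ]
    ring

/-- Every knot type contains a curve in general position with a straight piece. -/
theorem exists_generalPosition (K : Knot) : ∃ (N : S1 → Space) (c : ℝ) (p d : Space),
    GeneralPosition N ∧ AmbientIsotopic (range N) (range K.toFun) ∧ 0 < c ∧ c ≤ 1 ∧ d.1 ≠ 0 ∧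
      ∀ r : ℝ, 0 ≤ r → r ≤ 1 → N ((c * r : ℝ) : S1) = p + r • d := by
  obtain ⟨γ, hc, hinj, ⟨n, v, hn, hv⟩, hK⟩ := K.tame
  have hγ : RunsThrough γ n v := fun i hi r h0 h1 => by
    rw [hv i hi r ⟨h0, h1⟩, AffineMap.lineMap_apply_module']
    abel
  obtain ⟨κ, hκ⟩ := exists_genericDirection n v
  have hn' : (1 : ℝ) ≤ n := by exact_mod_cast hn
  refine ⟨_, 1 / n, shear κ (v 0), (project κ (v 1 - v 0), (v 1 - v 0).2),
    hκ.generalPosition hn hγ hc hinj, ?_, by positivity, (div_le_one (by linarith)).2 hn', ?_, ?_⟩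
  · rw [range_comp' (shear κ) γ]
    exact (ambientIsotopic_shear κ _).symm.trans hK
  · exact project_ne_zero hκ.snd_eq (hκ.edge 0 hn (hγ.edge_ne_zero hinj hn))
  · intro r h0 h1
    have : (1 / n * r : ℝ) = ((0 : ℕ) + r) / n := by
      rw [Nat.cast_zero]
      ring
    rw [this, hγ 0 hn r h0 h1]
    exact Prod.ext (project_add_smul κ _ _ r) rfl

/-! ### Enlarging a straight piece -/

/-- A homeomorphism of space that induces a homeomorphism of the plane preserves general position. -/
theorem GeneralPosition.image {N : S1 → Space} (hN : GeneralPosition N) (G : Space ≃ₜ Space)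
    (Ψ : Plane ≃ₜ Plane) (hG : ∀ p, (G p).1 = Ψ p.1) : GeneralPosition fun s => G (N s) := by
  refine ⟨G.continuous.comp hN.continuous, G.injective.comp hN.injective, ?_, ?_, ?_⟩
  · simpa only [IsDoublePoint, hG, Ψ.injective.eq_iff] using hN.finite_double
  · simpa only [hG, Ψ.injective.eq_iff] using hN.no_triple
  · simp only [IsDoublePoint, hG, Ψ.injective.eq_iff]
    exact fun s t h => (hN.transverse s t h).image Ψ

/-- The similarity `w ↦ z (w - p)` of the plane, where `z ≠ 0` is a complex number. -/
noncomputable def similarity (z : ℂ) (hz : z ≠ 0) (p : Plane) : Plane ≃ₜ Plane :=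
  (Homeomorph.subRight p).trans (Complex.equivRealProdCLM.symm.toHomeomorph.trans
    ((Homeomorph.mulLeft₀ z hz).trans Complex.equivRealProdCLM.toHomeomorph))

theorem similarity_apply (z : ℂ) (hz : z ≠ 0) (p w : Plane) : similarity z hz p w =
    (z.re * (w.1 - p.1) - z.im * (w.2 - p.2), z.re * (w.2 - p.2) + z.im * (w.1 - p.1)) := by
  simp [similarity]

/-- The shear of space over the plane that lowers the point over `w` by `h + k w₁`. -/
def lower (h k : ℝ) : Space ≃ₜ Space where
  toFun p := (p.1, p.2 - (h + k * p.1.1))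
  invFun p := (p.1, p.2 + (h + k * p.1.1))
  left_inv p := by simp
  right_inv p := by simp
  continuous_toFun := by fun_prop
  continuous_invFun := by fun_prop

theorem ambientIsotopic_similarity (z : ℂ) (hz : z ≠ 0) (p : Plane) (A : Set Space) :
    AmbientIsotopic A ((similarity z hz p).prodCongr (Homeomorph.refl ℝ) '' A) := by
  have h := AmbientIsotopic.of_family (fun t : unitInterval =>
    (similarity (Complex.exp ((t : ℝ) * Complex.log z)) (Complex.exp_ne_zero _)
      ((t : ℝ) • p)).prodCongr (Homeomorph.refl ℝ)) (by
    simp only [Homeomorph.coe_prodCongr, Prod.map, similarity_apply]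
    fun_prop) (by
    intro x
    ext <;> simp [Prod.map, similarity_apply]) A
  simpa [Complex.exp_log hz] using h

theorem ambientIsotopic_lower (h k : ℝ) (A : Set Space) : AmbientIsotopic A (lower h k '' A) := by
  have h := AmbientIsotopic.of_family (fun t : unitInterval => lower (t * h) (t * k)) (by
    change Continuous fun p : unitInterval × Space =>
      ((p.2.1, p.2.2 - (p.1 * h + p.1 * k * p.2.1.1)) : Space)
    fun_prop) (by
    intro x
    change ((x.1, x.2 - ((0 : ℝ) * h + (0 : ℝ) * k * x.1.1)) : Space) = x
    simp) A
  simpa using h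

/-- Some point of the straight piece is not a double point of the projection, and the rest of the
projection keeps away from it. -/
theorem GeneralPosition.exists_far {N : S1 → Space} (hN : GeneralPosition N) {c : ℝ} (h0 : 0 < c)
    (h1 : c ≤ 1) : ∃ r δ : ℝ, 0 < δ ∧ 0 < r - δ ∧ r + δ < 1 ∧
      ∀ s ∈ ((↑) : ℝ → S1) '' Icc (c * (r + δ)) (c * (r - δ) + 1),
        (N s).1 ≠ (N ((c * r : ℝ) : S1)).1 := by
  have hinj : InjOn (fun r : ℝ => ((c * r : ℝ) : S1)) (Ioo 0 1) := by
    intro r hr q hq h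
    have := coe_injOn ⟨by have := hr.1; positivity, by nlinarith [hr.1, hr.2]⟩
      ⟨by have := hq.1; positivity, by nlinarith [hq.1, hq.2]⟩ h
    exact mul_left_cancel₀ h0.ne' this
  obtain ⟨r, hr, hrF⟩ : ∃ r ∈ Ioo (0 : ℝ) 1, ((c * r : ℝ) : S1) ∉
      Prod.fst '' {p : S1 × S1 | IsDoublePoint (fun s => (N s).1) p.1 p.2} := by
    by_contra! h
    refine (Ioo_infinite (zero_lt_one' ℝ)) (Finite.of_finite_image
      ((hN.finite_double.image Prod.fst).subset ?_) hinj)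
    rintro _ ⟨r, hr, rfl⟩
    exact h r hr
  have hm1 := min_le_left r (1 - r)
  have hm2 := min_le_right r (1 - r)
  have hm : 0 < min r (1 - r) := lt_min hr.1 (by linarith [hr.2])
  obtain ⟨δ, hδ0, hδ1, hδ2⟩ : ∃ δ, 0 < δ ∧ 0 < r - δ ∧ r + δ < 1 :=
    ⟨min r (1 - r) / 2, by linarith, by linarith, by linarith⟩
  refine ⟨r, δ, hδ0, hδ1, hδ2, ?_⟩
  rintro _ ⟨x, hx, rfl⟩ he
  refine hrF ⟨(_, (x : S1)), ⟨fun h => ?_, he.symm⟩, rfl⟩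
  have hlt : c * r < c * (r + δ) := mul_lt_mul_of_pos_left (by linarith) h0
  have hlt' : c * (r - δ) < c * r := mul_lt_mul_of_pos_left (by linarith) h0
  have := (AddCircle.coe_eq_coe_iff_of_mem_Ico (p := (1 : ℝ)) (a := c * r) (x := c * r) (y := x)
    ⟨le_rfl, by linarith⟩ ⟨by linarith [hx.1], by linarith [hx.2]⟩).1 h
  linarith [hx.1]

/-- Every knot type contains a curve in general position with a straight piece in a large empty
rectangle. -/
theorem exists_hasStraightPiece (K : Knot) : ∃ (N : S1 → Space) (a b : ℝ),
    HasStraightPiece N a b ∧ AmbientIsotopic (range N) (range K.toFun) := by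
  obtain ⟨N, c, p, d, hN, hK, hc0, hc1, hd, hNd⟩ := exists_generalPosition K
  obtain ⟨r₀, δ, hδ, hδ0, hδ1, hfar⟩ := hN.exists_far hc0 hc1
  have hr₀ : N ((c * r₀ : ℝ) : S1) = p + r₀ • d := hNd r₀ (by linarith) (by linarith)
  set C : Set S1 := ((↑) : ℝ → S1) '' Icc (c * (r₀ + δ)) (c * (r₀ - δ) + 1) with hC
  have hcδ : c * (r₀ + δ) ≤ c * (r₀ - δ) + 1 := by nlinarith
  have hCc : IsCompact C := isCompact_Icc.image (AddCircle.continuous_mk' 1)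
  have hCne : C.Nonempty := ⟨_, _, ⟨le_rfl, hcδ⟩, rfl⟩
  -- the complex number `z₁` turns the direction of the straight piece into the first axis
  obtain ⟨z₁, hz₁⟩ : ∃ z : ℂ, z.re * d.1.1 - z.im * d.1.2 = 1 ∧
      z.re * d.1.2 + z.im * d.1.1 = 0 := by
    have hq : d.1.1 * d.1.1 + d.1.2 * d.1.2 ≠ 0 := by
      intro h
      apply hd
      ext <;> simp only [Prod.fst_zero, Prod.snd_zero] <;> nlinarith
    refine ⟨⟨d.1.1 / (d.1.1 * d.1.1 + d.1.2 * d.1.2), -d.1.2 / (d.1.1 * d.1.1 + d.1.2 * d.1.2)⟩,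
      ?_, ?_⟩
    · rw [div_mul_eq_mul_div, div_mul_eq_mul_div, ← sub_div, div_eq_one_iff_eq hq]
      ring
    · rw [div_mul_eq_mul_div, div_mul_eq_mul_div, ← add_div, div_eq_zero_iff]
      left
      ring
  have hz₁0 : z₁ ≠ 0 := by
    rintro rfl
    simp at hz₁
  set p₀ : Plane := (N ((c * r₀ : ℝ) : S1)).1 with hp₀
  obtain ⟨ρ, hρ0, hρ⟩ : ∃ ρ > 0, ∀ s ∈ C, ρ ≤ ‖similarity z₁ hz₁0 p₀ (N s).1‖ := by
    obtain ⟨s, hs, hmin⟩ := hCc.exists_isMinOn hCne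
      (f := fun s => ‖similarity z₁ hz₁0 p₀ (N s).1‖)
      (((similarity z₁ hz₁0 p₀).continuous.comp
        (continuous_fst.comp hN.continuous)).norm.continuousOn)
    refine ⟨_, norm_pos_iff.2 fun h => hfar s hs ?_, fun t ht => hmin ht⟩
    apply (similarity z₁ hz₁0 p₀).injective
    rw [h]
    simp [similarity_apply, Prod.ext_iff]
  obtain ⟨M, hM0, hM1, hM2⟩ : ∃ M : ℝ, 0 < M ∧ 512 < M * ρ ∧ 124 < M * δ := by
    refine ⟨513 / ρ + 125 / δ, by positivity, ?_, ?_⟩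
    · have : 0 ≤ 125 / δ * ρ := by positivity
      rw [add_mul, div_mul_cancel₀ _ hρ0.ne']
      linarith
    · have : 0 ≤ 513 / ρ * δ := by positivity
      rw [add_mul, div_mul_cancel₀ _ hδ.ne']
      linarith
  have hMc : (M : ℂ) ≠ 0 := by exact_mod_cast hM0.ne'
  let Ψ : Plane ≃ₜ Plane := similarity (M * z₁) (mul_ne_zero hMc hz₁0) p₀
  have hΨ : ∀ w, Ψ w = M • similarity z₁ hz₁0 p₀ w := by
    intro w
    simp only [Ψ, similarity_apply, Complex.mul_re, Complex.mul_im, Complex.ofReal_re,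
      Complex.ofReal_im, Prod.smul_mk, smul_eq_mul]
    ext <;> dsimp only <;> ring
  let G : Space ≃ₜ Space := (Ψ.prodCongr (Homeomorph.refl ℝ)).trans
    (lower (p.2 + r₀ * d.2) (d.2 / M))
  have hG : ∀ x, G x = (Ψ x.1, x.2 - (p.2 + r₀ * d.2 + d.2 / M * (Ψ x.1).1)) := fun _ => rfl
  have hline : ∀ r : ℝ, 0 ≤ r → r ≤ 1 → G (N ((c * r : ℝ) : S1)) = ((M * (r - r₀), 0), 0) := by
    intro r hr0 hr1
    have h1 : Ψ (N ((c * r : ℝ) : S1)).1 = (M * (r - r₀), 0) := by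
      rw [hΨ, hNd r hr0 hr1, hp₀, hr₀, similarity_apply]
      simp only [Prod.fst_add, Prod.snd_add, Prod.smul_fst, Prod.smul_snd, smul_eq_mul,
        Prod.smul_mk]
      ext <;> dsimp only
      · linear_combination M * (r - r₀) * hz₁.1
      · linear_combination M * (r - r₀) * hz₁.2
    rw [hG, h1, hNd r hr0 hr1]
    simp only [Prod.snd_add, Prod.smul_snd, smul_eq_mul]
    ext <;> dsimp only
    field_simp
    ring
  have hMδ : 124 / M < δ := by
    rw [div_lt_iff₀ hM0]
    linarith
  have hM' : 0 < 124 / M := by positivity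
  have ha : 0 < c * (r₀ - 124 / M) := mul_pos hc0 (by linarith)
  have hab : c * (r₀ - 124 / M) < c * (r₀ + 124 / M) := mul_lt_mul_of_pos_left (by linarith) hc0
  have hb : c * (r₀ + 124 / M) < 1 := by nlinarith
  refine ⟨fun s => G (N s), c * (r₀ - 124 / M), c * (r₀ + 124 / M),
    ⟨hN.image G Ψ fun _ => rfl, ha, hab, hb, ?_, ?_⟩, ?_⟩
  · intro x hx
    obtain ⟨r, rfl⟩ : ∃ r, x = c * r := ⟨x / c, by field_simp⟩
    have h1 := (mul_le_mul_iff_right₀ hc0).1 hx.1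
    have h2 := (mul_le_mul_iff_right₀ hc0).1 hx.2
    rw [hline r (by linarith) (by linarith)]
    ext <;> dsimp only
    have : c * (r₀ + 124 / M) - c * (r₀ - 124 / M) = c * (248 / M) := by ring
    rw [this]
    field_simp
    ring
  · intro s hs
    obtain ⟨x, hx0, hx1, rfl⟩ := exists_coe_mem_Ico (c * (r₀ - δ)) s
    rcases le_total x (c * (r₀ + δ)) with hx | hx
    · left
      obtain ⟨r, rfl⟩ : ∃ r, x = c * r := ⟨x / c, by field_simp⟩
      have h1 := (mul_le_mul_iff_right₀ hc0).1 hx0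
      have h2 := (mul_le_mul_iff_right₀ hc0).1 hx
      rw [hline r (by linarith) (by linarith)]
      by_contra! h
      rw [abs_mul, abs_of_pos hM0, ← le_div_iff₀' hM0, abs_le] at h
      exact hs ⟨_, ⟨mul_le_mul_of_nonneg_left (by linarith) hc0.le,
        mul_le_mul_of_nonneg_left (by linarith) hc0.le⟩, rfl⟩
    · have h1 := hρ (x : S1) ⟨x, ⟨hx, hx1.le⟩, rfl⟩
      have h2 : 512 < ‖Ψ (N (x : S1)).1‖ := by
        rw [hΨ, norm_smul, Real.norm_of_nonneg hM0.le]
        exact hM1.trans_le (mul_le_mul_of_nonneg_left h1 hM0.le)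
      rw [Prod.norm_def, lt_max_iff, Real.norm_eq_abs, Real.norm_eq_abs] at h2
      exact h2.imp (fun h => lt_trans (by norm_num) h) id
  · refine AmbientIsotopic.trans ?_ hK
    rw [range_comp' G N]
    refine AmbientIsotopic.symm ?_
    have h := (ambientIsotopic_similarity (M * z₁) (mul_ne_zero hMc hz₁0) p₀ (range N)).trans
      (ambientIsotopic_lower (p.2 + r₀ * d.2) (d.2 / M) _)
    rw [image_image] at h
    exact h

end KnotDiagrams

theorem theorem2 (K : KnotDiagrams.Knot) :
    ∃ D D' : KnotDiagrams.Diagram,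
      D.Represents K ∧ D'.Represents K ∧
      KnotDiagrams.IsMove KnotDiagrams.MoveClass.omega2 D D' ∧
      KnotDiagrams.Dependent KnotDiagrams.MoveClass.omega2 D D' := by
  obtain ⟨N, a, b, hN, hK⟩ := KnotDiagrams.exists_hasStraightPiece K
  exact ⟨_, _,
    KnotDiagrams.GeneralPosition.represents _
      ((KnotDiagrams.ambientIsotopic_insertPath hN KnotDiagrams.fitsBox_short (Or.inl rfl)).trans hK),
    KnotDiagrams.GeneralPosition.represents _
      ((KnotDiagrams.ambientIsotopic_insertPath hN KnotDiagrams.fitsBox_long (Or.inr rfl)).trans hK),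
    Or.inl (KnotDiagrams.createsBigon_insertPath hN), KnotDiagrams.dependent_insertPath hN⟩
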